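/- Let $d\ge 1$. A \emph{sandpile model} of dimension $d$ consists of a finite set $\mathcal N\subset\mathbb Z^d\setminus\{0\}$ (the neighborhood) such that every element of $\mathbb Z^d$ is a linear combination of the elements of $\mathcal N$ with positive integer coefficients, and of a distribution $\mathcal D:\mathcal N\to\{1,2,3,\dots\}$; its stability threshold is $\theta=\sum_{v\in\mathcal N}\mathcal D(v)$. A configuration is a map $c:\mathbb Z^d\to\mathbb N$. A cell $x\in\mathbb Z^d$ is unstable in $c$ if $c(x)\ge\theta$ and stable otherwise; $c$ is stable if all cells are stable. The configuration $F(c)$ is obtained from $c$ when all unstable cells topple in parallel: with $H(k)=1$ for $k\ge 0$ and $H(k)=0$ for $k<0$, $$F(c)(x)=c(x)-\theta\,H(c(x)-\theta)+\sum_{v\in\mathcal N}\mathcal D(v)\,H(c(x-v)-\theta).$$ Fix a sandpile model (it is not part of the input). Input configurations are given on an elementary hypercube $\{0,\dots,n-1\}^d$, $n\ge 1$, outside of which they are $0$, with fewer than $2\theta$ grains on every cell: an input string over a finite alphabet consists of $n$ in unary and the $n^d$ cell contents (one symbol per cell) in lexicographic order of the cells. Input cells are arbitrary elements of $\mathbb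 Z^d$ whose coordinates are written in signed binary. Consider the following problems. \begin{itemize} \item PRED: given $c$ and a cell $x$, is there $t\ge 0$ such that $x$ is unstable in $F^t(c)$? \item S-PRED: given a stable $c$ and cells $x,y$, is there $t\ge 0$ such that $x$ is unstable in $F^t(c+\mathbf 1_{\{y\}})$? \item 1stcol-S-PRED: given a stable $c$ and a cell $x$, the same question where $y$ is the lexicographically minimal cell (of the hypercube on which $c$ is given; or, in a second version for nonempty $c$, among the nonempty cells of $c$). \item Compute-PRED: given $c$, output the stable configuration reached from $c$, that is, the stable configuration of the form $F^t(c)$ with $t\ge 0$. \end{itemize} Then, for every sandpile model of any dimension $d\ge1$, all these problems are in $\mathsf P$: the languages of (codes of) positive instances of PRED, of S-PRED and of both versions of 1stcol-S-PRED are decided by deterministic Turing machines in time polynomial in the length of the input; and for every input configuration $c$ a stable configuration $F^t(c)$ is reached, and some deterministic Turing machine running in polynomial time computes from the code of $c$ a code of this stable configuration on some hypercube $\{-m,\dots,m\}^d$ containing all its grains. -/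

import Mathlib

namespace Sandpile

/-- A cell of the `d`-dimensional lattice. -/
abbrev Cell (d : ℕ) : Type := Fin d → ℤ

/-- A configuration: a finite number of grains on every cell. -/
abbrev Config (d : ℕ) : Type := Cell d → ℕ

/-- The set of linear combinations of the elements of `N` with positive integer coefficients. -/
def spanPlus {d : ℕ} (N : Finset (Cell d)) : Set (Cell d) :=
  {z | ∃ k : Cell d → ℕ, (∀ v ∈ N, 0 < k v) ∧ z = ∑ v ∈ N, k v • v}

/-- A sandpile model of dimension `d`. The distribution is extended by `0` outside the
neighborhood; the stability threshold is `SandpileModel.θ` below. -/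
structure SandpileModel (d : ℕ) where
  /-- the neighborhood -/
  N : Finset (Cell d)
  zero_notMem : (0 : Cell d) ∉ N
  /-- the distribution -/
  D : Cell d → ℕ
  D_pos_iff : ∀ v, 0 < D v ↔ v ∈ N
  complete : spanPlus N = Set.univ

namespace SandpileModel

variable {d : ℕ} (M : SandpileModel d)

/-- The stability threshold. -/
def θ : ℕ := ∑ v ∈ M.N, M.D v

/-- `1` if the cell `x` is unstable in `c`, and `0` otherwise. -/
def fires (c : Config d) (x : Cell d) : ℕ := if M.θ ≤ c x then 1 else 0

/-- The global rule: all unstable cells `x` topple in parallel, each of them sending `D v` grains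
to `x + v` for every `v ∈ N`. The truncated subtraction is exact: if `fires c x = 1`
then `θ ≤ c x`. -/
def step (c : Config d) : Config d := fun x =>
  c x - M.θ * M.fires c x + ∑ v ∈ M.N, M.D v * M.fires c (x - v)

/-- All cells are stable. -/
def Stable (c : Config d) : Prop := ∀ x, c x < M.θ

/-- The cell `x` is unstable at some time of the evolution that starts in `c`. -/
def EventuallyUnstable (c : Config d) (x : Cell d) : Prop :=
  ∃ t : ℕ, M.θ ≤ (M.step^[t] c) x

end SandpileModel

/-- The hypercube of side `n` whose lexicographically minimal corner is `(a, …, a)`. -/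
def cube (d : ℕ) (a : ℤ) (n : ℕ) : Set (Cell d) := {x | ∀ i, a ≤ x i ∧ x i < a + n}

/-- The `k`-th cell (`k < n ^ d`) of `cube d a n` in lexicographic order: its coordinates,
shifted by `-a`, are the digits of `k` in base `n`, most significant digit first. -/
def cubeCell (d : ℕ) (a : ℤ) (n k : ℕ) : Cell d :=
  fun i => a + ((k / n ^ (d - 1 - (i : ℕ)) % n : ℕ) : ℤ)

/-- `y` is the lexicographically minimal element of `S`. -/
def IsLexMin {d : ℕ} (S : Set (Cell d)) (y : Cell d) : Prop :=
  y ∈ S ∧ ∀ z ∈ S, toLex y ≤ toLex z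

/-- The alphabet used to write down instances: a bit, a separator, or the content of a cell,
which is a number smaller than the constant `q`. -/
inductive Symbol (q : ℕ) : Type
  | bit (b : Bool)
  | sep
  | grain (g : Fin q)

/-- The string `w` encodes the finite configuration `c` on the hypercube `cube d a n`: the grains
of `c` all lie in this hypercube, each cell holds less than `q` of them, and `w` consists of `n`
in unary, a separator, and the `n ^ d` cell contents in lexicographic order of the cells. -/
def EncodesConfig {d : ℕ} (q : ℕ) (a : ℤ) (n : ℕ) (c : Config d) (w : List (Symbol q)) : Prop :=
  (∀ x, x ∉ cube d a n → c x = 0) ∧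
  ∃ u : List (Fin q),
    u.map (fun g => (g : ℕ)) = (List.range (n ^ d)).map (fun k => c (cubeCell d a n k)) ∧
    w = List.replicate n (Symbol.bit true) ++ Symbol.sep :: u.map Symbol.grain

/-- The code of an arbitrary cell: its coordinates one after the other, each of them introduced by
a separator and written in binary as a sign bit and the bits of its absolute value. -/
def encodeCell {d : ℕ} (q : ℕ) (x : Cell d) : List (Symbol q) :=
  (List.ofFn fun i : Fin d =>
    Symbol.sep :: Symbol.bit (decide (x i < 0)) ::
      (Nat.bits (x i).natAbs).map (fun b => (Symbol.bit b : Symbol q))).flatten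

/-- The class P: languages decided by a deterministic (multi-stack) Turing machine in polynomial
time. -/
def InP {Γ : Type} (L : Set (List Γ)) : Prop :=
  ∃ f : List Γ → Bool, (∀ w, f w = true ↔ w ∈ L) ∧
    Nonempty (Turing.TM2ComputableInPolyTime (id : List Γ → List Γ) Computability.encodeBool f)

/-- Functions on strings computed by a deterministic (multi-stack) Turing machine in polynomial
time. -/
def PolyTimeComputable {Γ : Type} (f : List Γ → List Γ) : Prop :=
  Nonempty (Turing.TM2ComputableInPolyTime (id : List Γ → List Γ) (id : List Γ → List Γ) f)

namespace SandpileModel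

variable {d : ℕ} (M : SandpileModel d)

/-- The string `w` is the input code of the configuration `c` on the elementary hypercube
`{0, …, n - 1}ᵈ`, with less than `2 * θ` grains on every cell. -/
def EncodesInput (n : ℕ) (c : Config d) (w : List (Symbol (2 * M.θ))) : Prop :=
  0 < n ∧ EncodesConfig (2 * M.θ) 0 n c w

/-- The prediction problem, as the language of its positive instances. -/
def PRED : Set (List (Symbol (2 * M.θ))) :=
  {w | ∃ (n : ℕ) (c : Config d) (x : Cell d) (wc : List (Symbol (2 * M.θ))),
    M.EncodesInput n c wc ∧ w = wc ++ encodeCell (2 * M.θ) x ∧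
    M.EventuallyUnstable c x}

/-- The stable prediction problem: a grain is added on cell `y`. -/
def SPRED : Set (List (Symbol (2 * M.θ))) :=
  {w | ∃ (n : ℕ) (c : Config d) (x y : Cell d) (wc : List (Symbol (2 * M.θ))),
    M.EncodesInput n c wc ∧ M.Stable c ∧
    w = wc ++ (encodeCell (2 * M.θ) x ++ encodeCell (2 * M.θ) y) ∧
    M.EventuallyUnstable (c + Pi.single y 1) x}

/-- The first column stable prediction problem: a grain is added on the lexicographically minimal
cell of the hypercube on which the configuration is given. -/
def FirstColSPRED : Set (List (Symbol (2 * M.θ))) :=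
  {w | ∃ (n : ℕ) (c : Config d) (x y : Cell d) (wc : List (Symbol (2 * M.θ))),
    M.EncodesInput n c wc ∧ M.Stable c ∧ IsLexMin (cube d 0 n) y ∧
    w = wc ++ encodeCell (2 * M.θ) x ∧
    M.EventuallyUnstable (c + Pi.single y 1) x}

/-- The variant of the first column stable prediction problem for nonempty configurations in which
the grain is added on the lexicographically minimal nonempty cell. -/
def FirstColSPREDNonempty : Set (List (Symbol (2 * M.θ))) :=
  {w | ∃ (n : ℕ) (c : Config d) (x y : Cell d) (wc : List (Symbol (2 * M.θ))),
    M.EncodesInput n c wc ∧ M.Stable c ∧ IsLexMin {z | c z ≠ 0} y ∧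
    w = wc ++ encodeCell (2 * M.θ) x ∧
    M.EventuallyUnstable (c + Pi.single y 1) x}

/-- `g` solves the computational prediction problem: on the code of any `c` it outputs a code of
the stable configuration reached from `c`, on some hypercube `{-m, …, m}ᵈ` that contains all of
its grains. -/
def SolvesComputePRED (g : List (Symbol (2 * M.θ)) → List (Symbol (2 * M.θ))) : Prop :=
  ∀ (n : ℕ) (c : Config d) (w : List (Symbol (2 * M.θ))), M.EncodesInput n c w →
    ∃ (t m : ℕ), M.Stable (M.step^[t] c) ∧
      EncodesConfig (2 * M.θ) (-(m : ℤ)) (2 * m + 1) (M.step^[t] c) (g w)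

end SandpileModel

end Sandpile

/-!
Prediction problems of sandpile models are decided by simulating the sandpile until it is stable.
This takes polynomial time for two reasons, one about sandpiles and one about Turing machines.

**Sandpiles.** Since `0` is a positive combination of the neighbors, there is a finite set `P` of
cells with `0 ∈ P` that contains, with each of its cells, some neighbor of this cell
(`exists_trap`). Hence after a cell `x` has toppled, the translate `x + P` contains a grain for
ever: a grain leaves its cell only by a toppling, which puts a grain on a further cell of `x + P`.
As the number `G` of grains is preserved, at most `G * P.card` cells ever topple
(`ncard_toppled_le`). The cells that topple are linked to the initial hypercube by chains of steps
in the neighborhood, so all grains stay in a box whose side is polynomial in the side of the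
hypercube (`toppled_subset_box`). For the time, let `φ` be a coordinate, its negative, or its
square, such that each toppling increases the sum of `φ` over all grains by at least `1`
(`exists_weight`): a linear function works if the mean of the neighbors, weighted by the
distribution, is not zero in the direction of the coordinate, and the square works otherwise. This
sum is polynomially bounded on the box, and therefore a stable configuration is reached after
polynomially many steps (`exists_bounds`).

**Machines.** Polynomial time on the multi-stack machines of Mathlib is obtained from a small
programming language. While-programs over stacks (`Prog`) compile to stack machines step by step
(`Exec.iterate_step`). All data are encoded by binary trees, written in Polish notation on one data
stack, and a function is `PolyTime` if some program replaces the code of the argument by the code of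
the value in polynomially many steps. Such functions are closed under composition, pairing, case
distinction, and iteration with a polynomial bound on the sizes of all intermediate values
(`PolyTime.foldl`); arithmetic, with numbers in unary, and list processing follow. Words over a
finite alphabet are converted at both ends by `nonempty_computable_bool` and
`nonempty_computable_list`.

**Deciding the problems.** A configuration is handled as a list of cells with their contents, and
simulated in the box for the time given by the bounds (`lookup_simulate`). The coordinates of the
cells in the input are written in binary, so they may be exponentially large; they are never
decoded. Instead, the part of the input that encodes cells is compared with the codes of all
candidates: only cells of the box can become unstable, and a grain added outside of the
hypercube leaves a stable configuration stable.
-/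

open Turing

namespace PolyTM

/-! ### Structured programs over stacks and their compilation to stack machines -/

/-- Structured programs over stacks `k : K` with alphabets `Γ k` and a register with values
in `σ`. -/
inductive Prog (K : Type) (Γ : K → Type) (σ : Type) : Type
  | push (k : K) (f : σ → Γ k)
  | pop (k : K) (f : σ → Option (Γ k) → σ)
  | load (f : σ → σ)
  | seq (p q : Prog K Γ σ)
  | ite (f : σ → Bool) (p q : Prog K Γ σ)
  | while (f : σ → Bool) (p : Prog K Γ σ)

namespace Prog

variable {K : Type} {Γ : K → Type} {σ : Type}

/-- The labels of the stack machine that a program is compiled to: one for each primitive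
operation and one for each test. -/
def Lab : Prog K Γ σ → Type
  | push _ _ => Unit
  | pop _ _ => Unit
  | load _ => Unit
  | seq p q => p.Lab ⊕ q.Lab
  | ite _ p q => Option (p.Lab ⊕ q.Lab)
  | .while _ p => Option p.Lab

theorem finite_lab : (p : Prog K Γ σ) → Finite p.Lab
  | push _ _ => inferInstanceAs (Finite Unit)
  | pop _ _ => inferInstanceAs (Finite Unit)
  | load _ => inferInstanceAs (Finite Unit)
  | seq p q =>
    haveI := p.finite_lab
    haveI := q.finite_lab
    inferInstanceAs (Finite (p.Lab ⊕ q.Lab))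
  | ite _ p q =>
    haveI := p.finite_lab
    haveI := q.finite_lab
    inferInstanceAs (Finite (Option (p.Lab ⊕ q.Lab)))
  | .while _ p =>
    haveI := p.finite_lab
    inferInstanceAs (Finite (Option p.Lab))

/-- The label at which the execution of a program starts. -/
def entry : (p : Prog K Γ σ) → p.Lab
  | push _ _ => ()
  | pop _ _ => ()
  | load _ => ()
  | seq p _ => Sum.inl p.entry
  | ite _ _ _ => none
  | .while _ _ => none

/-- The statement at each label of a program, inside a machine with labels `Λ` in which the labels
of the program are embedded by `emb` and the program is left by a jump to `e`. -/
def stmt {Λ : Type} : (p : Prog K Γ σ) → (p.Lab → Λ) → Λ → p.Lab → TM2.Stmt Γ Λ σ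
  | push k f, _, e, _ => .push k f (.goto fun _ => e)
  | pop k f, _, e, _ => .pop k f (.goto fun _ => e)
  | load f, _, e, _ => .load f (.goto fun _ => e)
  | seq p q, emb, e, l =>
    match l with
    | Sum.inl l => p.stmt (fun x => emb (Sum.inl x)) (emb (Sum.inr q.entry)) l
    | Sum.inr l => q.stmt (fun x => emb (Sum.inr x)) e l
  | ite f p q, emb, e, l =>
    match l with
    | none => .branch f (.goto fun _ => emb (some (Sum.inl p.entry)))
        (.goto fun _ => emb (some (Sum.inr q.entry)))
    | some (Sum.inl l) => p.stmt (fun x => emb (some (Sum.inl x))) e l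
    | some (Sum.inr l) => q.stmt (fun x => emb (some (Sum.inr x))) e l
  | .while f p, emb, e, l =>
    match l with
    | none => .branch f (.goto fun _ => emb (some p.entry)) (.goto fun _ => e)
    | some l => p.stmt (fun x => emb (some x)) (emb none) l

variable [DecidableEq K]

/-- Big-step semantics: `Exec p n s s'` says that `p`, started with register and stacks `s`,
ends with `s'` after exactly `n` steps. -/
inductive Exec : Prog K Γ σ → ℕ → σ × (∀ k, List (Γ k)) → σ × (∀ k, List (Γ k)) → Prop
  | push {k f v S} : Exec (push k f) 1 (v, S) (v, Function.update S k (f v :: S k))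
  | pop {k f v S} :
      Exec (pop k f) 1 (v, S) (f v (S k).head?, Function.update S k (S k).tail)
  | load {f v S} : Exec (load f) 1 (v, S) (f v, S)
  | seq {p q n m s s' s''} : Exec p n s s' → Exec q m s' s'' → Exec (seq p q) (m + n) s s''
  | iteTrue {f p q n s s'} : f s.1 = true → Exec p n s s' → Exec (ite f p q) (n + 1) s s'
  | iteFalse {f p q n s s'} : f s.1 = false → Exec q n s s' → Exec (ite f p q) (n + 1) s s'
  | whileFalse {f p s} : f s.1 = false → Exec (.while f p) 1 s s
  | whileTrue {f p n m s s' s''} : f s.1 = true → Exec p n s s' →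
      Exec (.while f p) m s' s'' → Exec (.while f p) (m + (n + 1)) s s''

/-- The compiled program simulates the big-step semantics step by step. -/
theorem Exec.iterate_step {Λ : Type} {M : Λ → TM2.Stmt Γ Λ σ} {p : Prog K Γ σ} {n : ℕ}
    {s s' : σ × (∀ k, List (Γ k))} (h : Exec p n s s') :
    ∀ (emb : p.Lab → Λ) (e : Λ), (∀ l, M (emb l) = p.stmt emb e l) →
      (flip bind (TM2.step M))^[n] (some (⟨some (emb p.entry), s.1, s.2⟩ : TM2.Cfg Γ Λ σ)) =
        some ⟨some e, s'.1, s'.2⟩ := by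
  induction h with
  | push | pop | load =>
    intro emb e h
    simp [flip, TM2.step, h, stmt, TM2.stepAux]
  | seq _ _ ih₁ ih₂ =>
    intro emb e h
    rw [Function.iterate_add_apply]
    have h₁ := ih₁ (fun x => emb (Sum.inl x)) (emb (Sum.inr _)) (fun l => h (Sum.inl l))
    have h₂ := ih₂ (fun x => emb (Sum.inr x)) e (fun l => h (Sum.inr l))
    exact (congrArg _ h₁).trans h₂
  | iteTrue hf _ ih =>
    intro emb e h
    have h₁ := ih (fun x => emb (some (Sum.inl x))) e (fun l => h (some (Sum.inl l)))
    rw [Function.iterate_add_apply, ← h₁]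
    congr 1
    simp [flip, entry, h none, stmt, hf]
  | iteFalse hf _ ih =>
    intro emb e h
    have h₁ := ih (fun x => emb (some (Sum.inr x))) e (fun l => h (some (Sum.inr l)))
    rw [Function.iterate_add_apply, ← h₁]
    congr 1
    simp [flip, entry, h none, stmt, hf]
  | whileFalse hf =>
    intro emb e h
    simp [flip, entry, h none, stmt, hf]
  | whileTrue hf _ _ ih₁ ih₂ =>
    intro emb e h
    have h₁ := ih₁ (fun x => emb (some x)) (emb none) (fun l => h (some l))
    rw [Function.iterate_add_apply, Function.iterate_add_apply, ← ih₂ emb e h]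
    refine congrArg _ (Eq.trans ?_ h₁)
    congr 1
    simp [flip, entry, h none, stmt, hf]

/-- `ExecLe p n s s'` says that `p`, started with register and stacks `s`, ends with `s'` after
at most `n` steps. -/
def ExecLe (p : Prog K Γ σ) (n : ℕ) (s s' : σ × (∀ k, List (Γ k))) : Prop :=
  ∃ k ≤ n, Exec p k s s'

variable {p q : Prog K Γ σ} {n m : ℕ} {s s' s'' : σ × (∀ k, List (Γ k))} {f : σ → Bool}

theorem ExecLe.mono (h : ExecLe p n s s') (hn : n ≤ m) : ExecLe p m s s' :=
  let ⟨k, hk, h⟩ := h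
  ⟨k, hk.trans hn, h⟩

theorem ExecLe.seq (h₁ : ExecLe p n s s') (h₂ : ExecLe q m s' s'') :
    ExecLe (p.seq q) (n + m) s s'' :=
  let ⟨_, hk, h₁⟩ := h₁
  let ⟨_, hl, h₂⟩ := h₂
  ⟨_, by omega, h₁.seq h₂⟩

theorem ExecLe.iteTrue (hf : f s.1 = true) (h : ExecLe p n s s') :
    ExecLe (ite f p q) (n + 1) s s' :=
  let ⟨_, hk, h⟩ := h
  ⟨_, by omega, .iteTrue hf h⟩

theorem ExecLe.iteFalse (hf : f s.1 = false) (h : ExecLe q n s s') :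
    ExecLe (ite f p q) (n + 1) s s' :=
  let ⟨_, hk, h⟩ := h
  ⟨_, by omega, .iteFalse hf h⟩

theorem ExecLe.whileFalse (hf : f s.1 = false) : ExecLe (.while f p) 1 s s :=
  ⟨1, le_rfl, .whileFalse hf⟩

theorem ExecLe.whileTrue (hf : f s.1 = true) (h₁ : ExecLe p n s s')
    (h₂ : ExecLe (.while f p) m s' s'') : ExecLe (.while f p) (n + m + 1) s s'' :=
  let ⟨_, hk, h₁⟩ := h₁
  let ⟨_, hl, h₂⟩ := h₂
  ⟨_, by omega, .whileTrue hf h₁ h₂⟩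

/-- The compiled program, followed by the resetting of the register and the halting of the
machine. -/
def machine (p : Prog K Γ σ) (r : σ) : Option p.Lab → TM2.Stmt Γ (Option p.Lab) σ
  | none => .load (fun _ => r) .halt
  | some l => p.stmt some none l

theorem ExecLe.iterate_step_machine {r : σ} (h : ExecLe p n s s') :
    ∃ k ≤ n + 1, (flip bind (TM2.step (p.machine r)))^[k]
      (some (⟨some (some p.entry), s.1, s.2⟩ : TM2.Cfg Γ (Option p.Lab) σ)) =
        some ⟨none, r, s'.2⟩ := by
  obtain ⟨k, hk, h⟩ := h
  refine ⟨1 + k, by omega, ?_⟩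
  rw [Function.iterate_add_apply]
  refine (congrArg _ (h.iterate_step (M := p.machine r) some none fun _ => rfl)).trans ?_
  simp [flip, TM2.step, machine, TM2.stepAux]

end Prog

end PolyTM

namespace PolyTM

/-! ### A stack machine that operates on binary trees -/

/-- Binary trees, the universal data type. -/
inductive BTree : Type
  | leaf
  | node (l r : BTree)

namespace BTree

/-- The code of a tree in Polish notation; it is self-delimiting. -/
def code : BTree → List Bool
  | leaf => [false]
  | node l r => true :: (l.code ++ r.code)

theorem code_append_inj : ∀ {t t' : BTree} {l l' : List Bool},
    t.code ++ l = t'.code ++ l' → t = t' ∧ l = l'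
  | leaf, leaf, _, _, h => by simpa [code] using h
  | leaf, node _ _, _, _, h => by simp [code] at h
  | node _ _, leaf, _, _, h => by simp [code] at h
  | node a b, node a' b', l, l', h => by
    simp only [code, List.cons_append, List.append_assoc, List.cons.injEq, true_and] at h
    obtain ⟨h₁, h⟩ := code_append_inj h
    obtain ⟨h₂, h⟩ := code_append_inj h
    exact ⟨h₁ ▸ h₂ ▸ rfl, h⟩

theorem code_injective : Function.Injective code := fun t t' h =>
  (code_append_inj (l := []) (l' := []) (by simpa using h)).1

theorem length_code_pos (t : BTree) : 0 < t.code.length := by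
  cases t <;> simp [code]

end BTree

open BTree

/-- The stacks of the machine: the input stack, which also receives word outputs, the data stack
`D`, a stack `C` used as a counter, and three auxiliary stacks. -/
inductive Stk : Type
  | inp
  | D
  | C
  | aux (j : Fin 3)
  deriving DecidableEq, Fintype

/-- The stack alphabets: an alphabet of `m + 1` symbols for the input stack, and bits for all other
stacks. -/
def Γ (m : ℕ) : Stk → Type
  | .inp => Fin (m + 1)
  | .D => Bool
  | .C => Bool
  | .aux _ => Bool

/-- The register: the bit popped last, a flag, and an input symbol. -/
structure Reg (m : ℕ) : Type where
  /-- the bit popped last, if any -/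
  b : Option Bool
  /-- a flag -/
  g : Bool
  /-- the input symbol popped last, if any -/
  s : Option (Fin (m + 1))
  deriving Fintype

variable {m : ℕ}

/-- The initial value of the register. -/
def r0 : Reg m := ⟨none, false, none⟩

/-- The contents of all stacks. -/
def st (i : List (Fin (m + 1))) (d c : List Bool) (f : Fin 3 → List Bool) : ∀ k, List (Γ m k)
  | .inp => i
  | .D => d
  | .C => c
  | .aux j => f j

/-- Programs of the tree machine. -/
abbrev TProg (m : ℕ) : Type := Prog Stk (Γ m) (Reg m)

section

variable {i x : List (Fin (m + 1))} {d c y : List Bool} {f : Fin 3 → List Bool} {j : Fin 3}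

@[simp] theorem update_st_inp : Function.update (st i d c f) .inp x = st x d c f := by
  funext k
  cases k <;> rfl

@[simp] theorem update_st_D : Function.update (st i d c f) .D y = st i y c f := by
  funext k
  cases k <;> rfl

@[simp] theorem update_st_C : Function.update (st i d c f) .C y = st i d y f := by
  funext k
  cases k <;> rfl

@[simp] theorem update_st_aux :
    Function.update (st i d c f) (.aux j) y = st i d c (Function.update f j y) := by
  funext k
  cases k with
  | aux k =>
    by_cases h : k = j
    · subst h
      exact (Function.update_self (β := fun k => List (Γ m k)) _ _ _).trans
        (Function.update_self (β := fun _ => List Bool) _ _ _).symm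
    · exact (Function.update_of_ne (β := fun k => List (Γ m k)) (by simpa using h) _ _).trans
        (Function.update_of_ne (β := fun _ => List Bool) h _ _).symm
  | _ => rfl

end

namespace Prog

variable {i : List (Fin (m + 1))} {d c : List Bool} {f : Fin 3 → List Bool} {r : Reg m}

theorem ExecLe.of_exec {p : TProg m} {r' : Reg m} {S S' S'' : ∀ k, List (Γ m k)}
    (h : Exec p 1 (r, S) (r', S')) (e : S' = S'') : ExecLe p 1 (r, S) (r', S'') :=
  ⟨1, le_rfl, e ▸ h⟩

theorem execLe_push_inp (g : Reg m → Fin (m + 1)) :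
    ExecLe (push .inp g : TProg m) 1 (r, st i d c f) (r, st (g r :: i) d c f) :=
  .of_exec .push update_st_inp

theorem execLe_push_D (g : Reg m → Bool) :
    ExecLe (push .D g : TProg m) 1 (r, st i d c f) (r, st i (g r :: d) c f) :=
  .of_exec .push update_st_D

theorem execLe_push_C (g : Reg m → Bool) :
    ExecLe (push .C g : TProg m) 1 (r, st i d c f) (r, st i d (g r :: c) f) :=
  .of_exec .push update_st_C

theorem execLe_push_aux (j : Fin 3) (g : Reg m → Bool) :
    ExecLe (push (.aux j) g : TProg m) 1 (r, st i d c f)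
      (r, st i d c (Function.update f j (g r :: f j))) :=
  .of_exec .push update_st_aux

theorem execLe_pop_inp (g : Reg m → Option (Fin (m + 1)) → Reg m) :
    ExecLe (pop .inp g : TProg m) 1 (r, st i d c f) (g r i.head?, st i.tail d c f) :=
  .of_exec .pop update_st_inp

theorem execLe_pop_D (g : Reg m → Option Bool → Reg m) :
    ExecLe (pop .D g : TProg m) 1 (r, st i d c f) (g r d.head?, st i d.tail c f) :=
  .of_exec .pop update_st_D

theorem execLe_pop_C (g : Reg m → Option Bool → Reg m) :
    ExecLe (pop .C g : TProg m) 1 (r, st i d c f) (g r c.head?, st i d c.tail f) :=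
  .of_exec .pop update_st_C

theorem execLe_pop_aux (j : Fin 3) (g : Reg m → Option Bool → Reg m) :
    ExecLe (pop (.aux j) g : TProg m) 1 (r, st i d c f)
      (g r (f j).head?, st i d c (Function.update f j (f j).tail)) :=
  .of_exec .pop update_st_aux

theorem execLe_load {S : ∀ k, List (Γ m k)} (g : Reg m → Reg m) :
    ExecLe (load g : TProg m) 1 (r, S) (g r, S) :=
  ⟨1, le_rfl, .load⟩

/-- Store a popped bit in the register. -/
def setB (r : Reg m) (o : Option Bool) : Reg m := { r with b := o }

/-- Whether the last pop found a bit. -/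
def hasB (r : Reg m) : Bool := r.b.isSome

/-- Whether the last pop found the bit `true`. -/
def isB (r : Reg m) : Bool := r.b == some true

/-- Push the bit popped last to the auxiliary stacks selected by `J`. -/
def pushSel (J : Fin 3 → Bool) : TProg m :=
  let p (j : Fin 3) : TProg m :=
    if J j then push (.aux j) fun r => r.b.getD false else load id
  (p 0).seq ((p 1).seq (p 2))

theorem execLe_pushSel (J : Fin 3 → Bool) (b : Bool) :
    ExecLe (pushSel J : TProg m) 3 (setB r0 (some b), st i d c f)
      (setB r0 (some b), st i d c fun j => if J j then b :: f j else f j) := by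
  have H (j : Fin 3) (f : Fin 3 → List Bool) :
      ExecLe (if J j then push (.aux j) fun r => r.b.getD false else load id : TProg m) 1
        (setB r0 (some b), st i d c f)
        (setB r0 (some b), st i d c (Function.update f j (if J j then b :: f j else f j))) := by
    cases hj : J j
    · simpa [hj] using execLe_load (m := m) (r := setB r0 (some b)) (S := st i d c f) id
    · exact execLe_push_aux j _
  have H' := (H 0 f).seq ((H 1 _).seq (H 2 _))
  refine cast (congrArg (fun f' => ExecLe (pushSel J : TProg m) 3 _ (_, st i d c f')) ?_) H'
  ext j : 1
  fin_cases j <;> simp [Function.update]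

/-- The body of the loop of `moveTree`. -/
def moveBody (J : Fin 3 → Bool) : TProg m :=
  (pop .D setB).seq <| (pushSel J).seq <|
    (ite isB ((push .C fun _ => true).seq (push .C fun _ => true)) (load id)).seq (pop .C setB)

/-- Move the tree on top of the data stack to the auxiliary stacks selected by `J`, which reverses
its code. The counter stack holds one bit for every tree that remains to be read. -/
def moveTree (J : Fin 3 → Bool) : TProg m :=
  (push .C fun _ => true).seq <| (pop .C setB).seq <| .while hasB (moveBody J)

theorem execLe_moveBody (J : Fin 3 → Bool) (b : Bool) (o : Option Bool) :
    ExecLe (moveBody J : TProg m) 8 (setB r0 o, st i (b :: d) c f)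
      (setB r0 ((if b then [true, true] else []) ++ c).head?,
        st i d ((if b then [true, true] else []) ++ c).tail
          (fun j => if J j then b :: f j else f j)) := by
  refine (ExecLe.seq (s' := (setB r0 (some b), st i d c f)) (execLe_pop_D setB)
    ((execLe_pushSel J b).seq (.seq (n := 3) (m := 1)
    (s' := (setB r0 (some b), st i d ((if b then [true, true] else []) ++ c)
      (fun j => if J j then b :: f j else f j))) ?_ (execLe_pop_C _))))
  cases b
  · exact (ExecLe.iteFalse rfl (execLe_load _)).mono (by omega)
  · exact ExecLe.iteTrue rfl ((execLe_push_C _).seq (execLe_push_C _))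

/-- The loop invariant of `moveTree`, in continuation form: if the tree `t` comes next, then the
loop is, some steps later, in the state in which `t` has been moved and the counter has been popped
once. -/
theorem execLe_while_moveBody (J : Fin 3 → Bool) {s : Reg m × ∀ k, List (Γ m k)} (t : BTree) :
    ∀ {n : ℕ} {b : Bool} {c d : List Bool} {f : Fin 3 → List Bool},
      ExecLe (.while hasB (moveBody J)) n (setB r0 c.head?,
        st i d c.tail (fun j => if J j then t.code.reverse ++ f j else f j)) s →
      ExecLe (.while hasB (moveBody J)) (9 * t.code.length + n)
        (setB r0 (some b), st i (t.code ++ d) c f) s := by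
  induction t with
  | leaf =>
    intro n b c d f h
    refine (ExecLe.whileTrue rfl (execLe_moveBody J false _) (m := n) ?_).mono ?_
    · simpa [code] using h
    · simp [code]
  | node t₁ t₂ ih₁ ih₂ =>
    intro n b c d f h
    have h₂ := ih₂ (n := n) (b := true) (c := c) (d := d)
      (f := fun j => if J j then t₁.code.reverse ++ (true :: f j) else f j) <|
      cast (congrArg (fun f' => ExecLe _ n (_, st i d c.tail f') s) (by
        ext j : 1
        cases hj : J j <;> simp [code])) h
    have h₁ := ih₁ (n := 9 * t₂.code.length + n) (b := true) (c := true :: c) (d := t₂.code ++ d)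
      (f := fun j => if J j then true :: f j else f j) <|
      cast (congrArg (fun f' => ExecLe _ _ (_, st i (t₂.code ++ d) c f') s) (by
        ext j : 1
        cases hj : J j <;> simp)) h₂
    refine (ExecLe.whileTrue rfl (execLe_moveBody J true _) (by simpa using h₁)).mono ?_
    simp [code]; omega

theorem execLe_moveTree (J : Fin 3 → Bool) (t : BTree) :
    ExecLe (moveTree J : TProg m) (9 * t.code.length + 3) (r0, st i (t.code ++ d) [] f)
      (r0, st i d [] fun j => if J j then t.code.reverse ++ f j else f j) := by
  refine ((execLe_push_C _).seq ((execLe_pop_C _).seq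
    (execLe_while_moveBody J t (n := 1) (b := true) (c := []) ?_))).mono (by omega)
  exact ExecLe.whileFalse rfl

/-- Move an auxiliary stack back to the data stack, reversing it. -/
def moveBack (j : Fin 3) : TProg m :=
  (pop (.aux j) setB).seq <| .while hasB <|
    (push .D fun r => r.b.getD false).seq (pop (.aux j) setB)

theorem execLe_moveBack (j : Fin 3) : ∀ {l d : List Bool} {f : Fin 3 → List Bool}, f j = l →
    ExecLe (moveBack j : TProg m) (3 * l.length + 2) (r0, st i d c f)
      (r0, st i (l.reverse ++ d) c (Function.update f j [])) := by
  suffices H : ∀ (l d : List Bool) (f : Fin 3 → List Bool), f j = l.tail →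
      ExecLe (.while hasB <| (push .D fun r => r.b.getD false).seq (pop (.aux j) setB) : TProg m)
        (3 * l.length + 1) (setB r0 l.head?, st i d c f)
        (r0, st i (l.reverse ++ d) c (Function.update f j [])) by
    intro l d f hf
    refine ((execLe_pop_aux j setB).seq (?_ : ExecLe _ (3 * l.length + 1) _ _)).mono (by omega)
    rw [hf]
    simpa using H l d (Function.update f j l.tail) (by simp)
  intro l
  induction l with
  | nil =>
    intro d f hf
    have : Function.update f j [] = f := by
      rw [Function.update_eq_self_iff]; simpa using hf.symm
    rw [this]
    exact ExecLe.whileFalse rfl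
  | cons b l ih =>
    intro d f hf
    refine (ExecLe.whileTrue rfl ((execLe_push_D _).seq (execLe_pop_aux j _))
      (m := 3 * l.length + 1) ?_).mono (by simp; omega)
    have := ih (b :: d) (Function.update f j l.tail) (by simp)
    simp only [List.tail_cons] at hf
    simpa [setB, hf] using this

/-- Empty an auxiliary stack. -/
def clear (j : Fin 3) : TProg m :=
  (pop (.aux j) setB).seq <| .while hasB <| pop (.aux j) setB

theorem execLe_clear (j : Fin 3) : ∀ {l d : List Bool} {f : Fin 3 → List Bool}, f j = l →
    ExecLe (clear j : TProg m) (2 * l.length + 2) (r0, st i d c f)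
      (r0, st i d c (Function.update f j [])) := by
  suffices H : ∀ (l d : List Bool) (f : Fin 3 → List Bool), f j = l.tail →
      ExecLe (.while hasB <| (pop (.aux j) setB) : TProg m)
        (2 * l.length + 1) (setB r0 l.head?, st i d c f)
        (r0, st i d c (Function.update f j [])) by
    intro l d f hf
    refine ((execLe_pop_aux j setB).seq (?_ : ExecLe _ (2 * l.length + 1) _ _)).mono (by omega)
    rw [hf]
    simpa using H l d (Function.update f j l.tail) (by simp)
  intro l
  induction l with
  | nil =>
    intro d f hf
    have : Function.update f j [] = f := by
      rw [Function.update_eq_self_iff]; simpa using hf.symm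
    rw [this]
    exact ExecLe.whileFalse rfl
  | cons b l ih =>
    intro d f hf
    refine (ExecLe.whileTrue rfl (execLe_pop_aux j _)
      (m := 2 * l.length + 1) ?_).mono (by simp; omega)
    have := ih d (Function.update f j l.tail) (by simp)
    simp only [List.tail_cons] at hf
    simpa [setB, hf] using this

end Prog

end PolyTM

namespace PolyTM

/-! ### Operations on the trees on top of the data stack -/

open BTree Prog

variable {m : ℕ}

/-- The state between two operations: only the input and data stacks are in use. -/
def idle (i : List (Fin (m + 1))) (d : List Bool) : Reg m × ∀ k, List (Γ m k) :=
  (r0, st i d [] ![[], [], []])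

/-- The program `p` replaces the word `x` on top of the data stack by `y`, in at most `n` steps. -/
def Rewrites (p : TProg m) (n : ℕ) (x y : List Bool) : Prop :=
  ∀ i d, ExecLe p n (idle i (x ++ d)) (idle i (y ++ d))

namespace Rewrites

variable {p q : TProg m} {n n' : ℕ} {x y z : List Bool}

theorem mono (h : Rewrites p n x y) (hn : n ≤ n') : Rewrites p n' x y :=
  fun i d => (h i d).mono hn

theorem seq (h₁ : Rewrites p n x y) (h₂ : Rewrites q n' y z) : Rewrites (p.seq q) (n + n') x z :=
  fun i d => (h₁ i d).seq (h₂ i d)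

theorem frame (h : Rewrites p n x y) (z : List Bool) : Rewrites p n (x ++ z) (y ++ z) :=
  fun i d => by simpa using h i (z ++ d)

end Rewrites

namespace Prog

@[simp] theorem update_vec_zero {a b e x : List Bool} :
    Function.update ![a, b, e] 0 x = ![x, b, e] := by
  ext j : 1; fin_cases j <;> rfl

@[simp] theorem update_vec_one {a b e x : List Bool} :
    Function.update ![a, b, e] 1 x = ![a, x, e] := by
  ext j : 1; fin_cases j <;> rfl

@[simp] theorem update_vec_two {a b e x : List Bool} :
    Function.update ![a, b, e] 2 x = ![a, b, x] := by
  ext j : 1; fin_cases j <;> rfl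

section

variable {i : List (Fin (m + 1))} {d a b e l : List Bool} (t : BTree)

theorem execLe_moveTree_zero : ExecLe (moveTree ![true, false, false] : TProg m)
    (9 * t.code.length + 3) (r0, st i (t.code ++ d) [] ![a, b, e])
    (r0, st i d [] ![t.code.reverse ++ a, b, e]) :=
  cast (congrArg (fun f => ExecLe _ _ _ (_, st i d [] f)) (by ext j : 1; fin_cases j <;> rfl))
    (execLe_moveTree (m := m) (i := i) (d := d) (f := ![a, b, e]) ![true, false, false] t)

theorem execLe_moveTree_one : ExecLe (moveTree ![false, true, false] : TProg m)
    (9 * t.code.length + 3) (r0, st i (t.code ++ d) [] ![a, b, e])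
    (r0, st i d [] ![a, t.code.reverse ++ b, e]) :=
  cast (congrArg (fun f => ExecLe _ _ _ (_, st i d [] f)) (by ext j : 1; fin_cases j <;> rfl))
    (execLe_moveTree (m := m) (i := i) (d := d) (f := ![a, b, e]) ![false, true, false] t)

theorem execLe_moveTree_two : ExecLe (moveTree ![false, false, true] : TProg m)
    (9 * t.code.length + 3) (r0, st i (t.code ++ d) [] ![a, b, e])
    (r0, st i d [] ![a, b, t.code.reverse ++ e]) :=
  cast (congrArg (fun f => ExecLe _ _ _ (_, st i d [] f)) (by ext j : 1; fin_cases j <;> rfl))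
    (execLe_moveTree (m := m) (i := i) (d := d) (f := ![a, b, e]) ![false, false, true] t)

theorem execLe_moveTree_zero_one : ExecLe (moveTree ![true, true, false] : TProg m)
    (9 * t.code.length + 3) (r0, st i (t.code ++ d) [] ![a, b, e])
    (r0, st i d [] ![t.code.reverse ++ a, t.code.reverse ++ b, e]) :=
  cast (congrArg (fun f => ExecLe _ _ _ (_, st i d [] f)) (by ext j : 1; fin_cases j <;> rfl))
    (execLe_moveTree (m := m) (i := i) (d := d) (f := ![a, b, e]) ![true, true, false] t)

theorem execLe_moveBack_zero : ExecLe (moveBack 0 : TProg m) (3 * a.length + 2)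
    (r0, st i d [] ![a, b, e]) (r0, st i (a.reverse ++ d) [] ![[], b, e]) := by
  simpa using execLe_moveBack (m := m) (i := i) (d := d) (c := []) (f := ![a, b, e]) 0 rfl

theorem execLe_moveBack_one : ExecLe (moveBack 1 : TProg m) (3 * b.length + 2)
    (r0, st i d [] ![a, b, e]) (r0, st i (b.reverse ++ d) [] ![a, [], e]) := by
  simpa using execLe_moveBack (m := m) (i := i) (d := d) (c := []) (f := ![a, b, e]) 1 rfl

theorem execLe_moveBack_two : ExecLe (moveBack 2 : TProg m) (3 * e.length + 2)
    (r0, st i d [] ![a, b, e]) (r0, st i (e.reverse ++ d) [] ![a, b, []]) := by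
  simpa using execLe_moveBack (m := m) (i := i) (d := d) (c := []) (f := ![a, b, e]) 2 rfl

theorem execLe_clear_zero : ExecLe (clear 0 : TProg m) (2 * a.length + 2)
    (r0, st i d [] ![a, b, e]) (r0, st i d [] ![[], b, e]) := by
  simpa using execLe_clear (m := m) (i := i) (d := d) (c := []) (f := ![a, b, e]) 0 rfl

theorem execLe_clear_one : ExecLe (clear 1 : TProg m) (2 * b.length + 2)
    (r0, st i d [] ![a, b, e]) (r0, st i d [] ![a, [], e]) := by
  simpa using execLe_clear (m := m) (i := i) (d := d) (c := []) (f := ![a, b, e]) 1 rfl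

end

/-- Duplicate the tree on top. -/
def dup : TProg m :=
  (moveTree ![true, true, false]).seq <| (moveBack 0).seq (moveBack 1)

/-- Exchange the two trees on top. -/
def swap : TProg m :=
  (moveTree ![true, false, false]).seq <| (moveTree ![false, true, false]).seq <|
    (moveBack 0).seq <| moveBack 1

/-- Exchange the two trees below the top one. -/
def rot : TProg m :=
  (moveTree ![true, false, false]).seq <| (moveTree ![false, true, false]).seq <|
    (moveTree ![false, false, true]).seq <| (moveBack 1).seq <| (moveBack 2).seq <| moveBack 0

/-- Remove the tree on top. -/
def drop : TProg m := (moveTree ![true, false, false]).seq (clear 0)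

theorem rewrites_drop (t : BTree) :
    Rewrites (drop : TProg m) (11 * t.code.length + 5) t.code [] := fun i d => by
  refine ((execLe_moveTree_zero t).seq execLe_clear_zero).mono ?_
  simp; omega

theorem rewrites_swap (t t' : BTree) :
    Rewrites (swap : TProg m) (12 * (t.code.length + t'.code.length) + 10) (t.code ++ t'.code)
      (t'.code ++ t.code) := fun i d => by
  refine ((by simpa [idle] using execLe_moveTree_zero t : ExecLe _ _ _ _).seq
    ((execLe_moveTree_one t').seq (execLe_moveBack_zero.seq (m := 3 * t'.code.length + 2) ?_))).mono
    ?_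
  · simpa [idle] using execLe_moveBack_one (m := m) (i := i) (a := []) (b := t'.code.reverse)
      (e := []) (d := t.code ++ d)
  · simp; omega

theorem rewrites_rot (t t₁ t₂ : BTree) :
    Rewrites (rot : TProg m) (12 * (t.code.length + t₁.code.length + t₂.code.length) + 15)
      (t.code ++ (t₁.code ++ t₂.code)) (t.code ++ (t₂.code ++ t₁.code)) := fun i d => by
  refine ((by simpa [idle] using execLe_moveTree_zero t : ExecLe _ _ _ _).seq
    ((execLe_moveTree_one t₁).seq ((execLe_moveTree_two t₂).seq
      (execLe_moveBack_one.seq (execLe_moveBack_two.seq (m := 3 * t.code.length + 2) ?_))))).mono ?_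
  · simpa [idle] using execLe_moveBack_zero (m := m) (i := i) (a := t.code.reverse) (b := [])
      (e := []) (d := t₂.code ++ (t₁.code ++ d))
  · simp; omega

theorem rewrites_dup (t : BTree) :
    Rewrites (dup : TProg m) (15 * t.code.length + 7) t.code (t.code ++ t.code) := fun i d => by
  refine ((execLe_moveTree_zero_one t).seq (execLe_moveBack_zero.seq
    (m := 3 * t.code.length + 2) ?_)).mono ?_
  · simpa [idle] using execLe_moveBack_one (m := m) (i := i) (a := []) (b := t.code.reverse)
      (e := []) (d := t.code ++ d)
  · simp; omega

/-- Push a constant word. -/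
def pushWord : List Bool → TProg m
  | [] => load id
  | b :: l => (pushWord l).seq (push .D fun _ => b)

theorem rewrites_pushWord : ∀ l : List Bool,
    Rewrites (pushWord l : TProg m) (l.length + 1) [] l
  | [], _, _ => execLe_load _
  | _ :: l, i, d => (rewrites_pushWord l i d).seq (execLe_push_D _)

/-- Remove one bit. -/
def discard : TProg m := pop .D fun r _ => r

theorem rewrites_discard (b : Bool) : Rewrites (discard : TProg m) 1 [b] [] :=
  fun _ _ => execLe_pop_D _

/-- Branch on the bit on top, which is removed. -/
def branch (p q : TProg m) : TProg m :=
  (pop .D setB).seq (ite isB ((load fun _ => r0).seq p) ((load fun _ => r0).seq q))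

theorem rewrites_branch_true {p q : TProg m} {n : ℕ} {x y : List Bool} (h : Rewrites p n x y) :
    Rewrites (branch p q) (n + 3) (true :: x) y := fun i d =>
  ((execLe_pop_D _).seq (.iteTrue rfl ((execLe_load _).seq (h i d)))).mono (by omega)

theorem rewrites_branch_false {p q : TProg m} {n : ℕ} {x y : List Bool} (h : Rewrites q n x y) :
    Rewrites (branch p q) (n + 3) (false :: x) y := fun i d =>
  ((execLe_pop_D _).seq (.iteFalse rfl ((execLe_load _).seq (h i d)))).mono (by omega)

/-- The loop of `repeatWhile`. -/
def repeatLoop (p : TProg m) : TProg m :=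
  Prog.while isB ((load fun _ => r0).seq (p.seq (pop .D setB)))

/-- Repeat `p` as long as the bit on top is `true`; this bit is removed before each test. -/
def repeatWhile (p : TProg m) : TProg m :=
  (pop .D setB).seq <| (repeatLoop p).seq (load fun _ => r0)

/-- The loop of `repeatWhile` replaces the word `x` by `z`. The loop is entered with the first bit
of `x` in the register, and is left with the bit `false` there. -/
def Repeats (p : TProg m) (n : ℕ) (x z : List Bool) : Prop :=
  ∀ i d, ExecLe (repeatLoop p) n
    (setB r0 (x ++ d).head?, st i (x ++ d).tail [] ![[], [], []])
    (setB r0 (some false), st i (z ++ d) [] ![[], [], []])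

theorem repeats_false {p : TProg m} {x : List Bool} : Repeats p 1 (false :: x) x :=
  fun _ _ => .whileFalse rfl

theorem repeats_true {p : TProg m} {x y z : List Bool} {n n' : ℕ}
    (h : Rewrites p n x y) (h' : Repeats p n' y z) :
    Repeats p (n + n' + 3) (true :: x) z := fun i d =>
  (ExecLe.whileTrue rfl ((execLe_load _).seq ((h i d).seq (execLe_pop_D _))) (h' i d)).mono
    (by omega)

theorem Repeats.rewrites {p : TProg m} {x z : List Bool} {n : ℕ} (h : Repeats p n x z) :
    Rewrites (repeatWhile p) (n + 2) x z := fun i d =>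
  ((execLe_pop_D _).seq ((h i d).seq (execLe_load _))).mono (by omega)

/-- Test the two trees on top for equality, and replace them by the bit `true` if they are equal,
and `false` otherwise. -/
def eqTest : TProg m :=
  (moveTree ![true, false, false]).seq <| (moveTree ![false, true, false]).seq <|
  (load fun r => { r with g := true }).seq <|
  (pop (.aux 0) setB).seq <|
  (Prog.while hasB <| (pop (.aux 1) fun r o => { r with g := r.g && (r.b == o) }).seq
    (pop (.aux 0) setB)).seq <|
  (pop (.aux 1) fun r o => { r with g := r.g && (r.b == o) }).seq <|
  (push .D fun r => r.g).seq <| (load fun _ => r0).seq <| clear 1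

/-- The comparison loop of `eqTest` on the reversed codes `a` and `b`. It ends when `a` is used up,
so equality also requires that nothing is left of `b`. -/
theorem execLe_while_eqTest {i : List (Fin (m + 1))} {d e : List Bool} :
    ∀ (a b : List Bool) (g : Bool), ∃ g' : Bool, ∃ b' : List Bool, b'.length ≤ b.length ∧
      (g' && (none == b'.head?)) = (g && decide (a = b)) ∧
      ExecLe (Prog.while hasB <| (pop (.aux 1) fun r o => { r with g := r.g && (r.b == o) }).seq
        (pop (.aux 0) setB) : TProg m) (3 * a.length + 1)
        (⟨a.head?, g, none⟩, st i d [] ![a.tail, b, e])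
        (⟨none, g', none⟩, st i d [] ![[], b', e])
  | [], b, g => by
    refine ⟨g, b, le_rfl, ?_, .whileFalse rfl⟩
    cases b <;> simp
  | x :: a, b, g => by
    obtain ⟨g', b', h₁, h₂, h₃⟩ := execLe_while_eqTest (i := i) (d := d) (e := e) a b.tail
      (g && (some x == b.head?))
    refine ⟨g', b', h₁.trans (by simp), ?_, ?_⟩
    · rw [h₂]
      cases b <;> simp [Bool.and_assoc, Bool.decide_and]
      rfl
    · refine (ExecLe.whileTrue rfl ((execLe_pop_aux _ _).seq (execLe_pop_aux _ _))
        (m := 3 * a.length + 1) ?_).mono (by simp; omega)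
      simpa [setB] using h₃

open Classical in
theorem rewrites_eqTest (t t' : BTree) :
    Rewrites (eqTest : TProg m) (12 * (t.code.length + t'.code.length) + 20)
      (t.code ++ t'.code) [decide (t = t')] := fun i d => by
  obtain ⟨g', b', h₁, h₂, h₃⟩ := execLe_while_eqTest (i := i) (d := d) (e := [])
    t.code.reverse t'.code.reverse true
  simp only [List.reverse_inj, decide_eq_decide.2 code_injective.eq_iff, Bool.true_and,
    List.length_reverse] at h₁ h₂ h₃
  refine ((by simpa [idle] using execLe_moveTree_zero t : ExecLe _ _ _ _).seq
    ((execLe_moveTree_one t').seq ((execLe_load _).seq ((execLe_pop_aux _ _).seq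
      (.seq (by simpa [setB, r0] using h₃) ((execLe_pop_aux _ _).seq ((execLe_push_D _).seq
        ((execLe_load _).seq (.mono (m := 2 * t'.code.length + 2) (n := 2 * b'.tail.length + 2)
          ?_ ?_))))))))).mono ?_
  · simpa [idle, h₂] using execLe_clear_one (m := m) (i := i) (a := []) (b := b'.tail) (e := [])
      (d := decide (t = t') :: d)
  · simp; omega
  · omega

end Prog

end PolyTM

namespace PolyTM

open BTree Prog

/-! ### Polynomial time functions between encoded types -/

/-- Types whose elements are encoded by trees. -/
class Enc (α : Type) where
  /-- the code of an element -/
  enc : α → BTree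
  enc_injective : Function.Injective enc

/-- The length of the code of an element. -/
def size {α : Type} [Enc α] (a : α) : ℕ := (Enc.enc a).code.length

theorem size_pos {α : Type} [Enc α] (a : α) : 0 < size a := length_code_pos _

/-- The tree of a bit. -/
def encBool : Bool → BTree
  | false => leaf
  | true => node leaf leaf

instance : Enc Bool := ⟨encBool, fun a b h => by cases a <;> cases b <;> simp_all [encBool]⟩

/-- A pair is encoded by a tree whose code is the bit `true` and the two codes. -/
instance {α β : Type} [Enc α] [Enc β] : Enc (α × β) :=
  ⟨fun p => node (Enc.enc p.1) (Enc.enc p.2), fun a b h => by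
    simp only [node.injEq] at h
    exact Prod.ext (Enc.enc_injective h.1) (Enc.enc_injective h.2)⟩

/-- The tree of a list, with the elements as left subtrees of its right spine. -/
def encList {α : Type} [Enc α] : List α → BTree
  | [] => leaf
  | a :: l => node (Enc.enc a) (encList l)

theorem encList_injective {α : Type} [Enc α] : Function.Injective (encList (α := α))
  | [], [], _ => rfl
  | a :: l, b :: l', h => by
    simp only [encList, node.injEq] at h
    rw [Enc.enc_injective h.1, encList_injective h.2]

instance {α : Type} [Enc α] : Enc (List α) := ⟨encList, encList_injective⟩

/-- The tree of a natural number in unary. -/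
def encNat : ℕ → BTree
  | 0 => leaf
  | n + 1 => node leaf (encNat n)

theorem encNat_injective : Function.Injective encNat
  | 0, 0, _ => rfl
  | n + 1, k + 1, h => by
    simp only [encNat, node.injEq, true_and] at h
    rw [encNat_injective h]

/-- Numbers are encoded in unary, so their sizes are of the order of their values. -/
instance : Enc ℕ := ⟨encNat, encNat_injective⟩

section size

variable {α β : Type} [Enc α] [Enc β]

@[simp] theorem size_mk (a : α) (b : β) : size (a, b) = size a + size b + 1 := by
  simp [size, Enc.enc, code]

theorem size_prod (p : α × β) : size p = size p.1 + size p.2 + 1 := size_mk _ _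

@[simp] theorem size_nil : size ([] : List α) = 1 := rfl

@[simp] theorem size_cons (a : α) (l : List α) : size (a :: l) = size a + size l + 1 := by
  simp [size, Enc.enc, encList, code]

@[simp] theorem size_nat (n : ℕ) : size n = 2 * n + 1 := by
  induction n with
  | zero => rfl
  | succ n ih =>
    simp only [size, Enc.enc, encNat, code, List.length_append, List.length_cons,
      List.length_nil] at ih ⊢
    omega

theorem size_bool_le (b : Bool) : size b ≤ 3 := by cases b <;> decide

theorem size_append_add_one (l l' : List α) : size (l ++ l') + 1 = size l + size l' := by
  induction l with
  | nil => simp; omega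
  | cons a l ih => simp; omega

@[simp] theorem size_reverse (l : List α) : size l.reverse = size l := by
  induction l with
  | nil => simp
  | cons a l ih =>
    have := size_append_add_one l.reverse [a]
    simp at this ⊢; omega

theorem length_lt_size (l : List α) : l.length < size l := by
  induction l with
  | nil => simp
  | cons a l ih => simp; omega

theorem size_le_of_mem {a : α} {l : List α} (h : a ∈ l) : size a ≤ size l := by
  induction l with
  | nil => simp at h
  | cons b l ih =>
    rcases List.mem_cons.1 h with rfl | h
    · simp; omega
    · have := ih h
      simp; omega

end size

/-- The natural number `t a` is bounded by a polynomial in the size of `a`. -/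
def PolyBounded {α : Type} [Enc α] (t : α → ℕ) : Prop :=
  ∃ P : Polynomial ℕ, ∀ a, t a ≤ P.eval (size a)

theorem eval_mono (P : Polynomial ℕ) : Monotone fun n => P.eval n := by
  intro a b h
  induction P using Polynomial.induction_on' with
  | add p q hp hq => simpa using add_le_add hp hq
  | monomial n c =>
    simp only [Polynomial.eval_monomial]
    gcongr

namespace PolyBounded

variable {α : Type} [Enc α] {t t' : α → ℕ}

theorem mono (h : PolyBounded t) (h' : ∀ a, t' a ≤ t a) : PolyBounded t' :=
  let ⟨P, hP⟩ := h
  ⟨P, fun a => (h' a).trans (hP a)⟩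

theorem size : PolyBounded fun a : α => PolyTM.size a := ⟨Polynomial.X, by simp⟩

theorem const (n : ℕ) : PolyBounded fun _ : α => n := ⟨Polynomial.C n, by simp⟩

theorem add (h : PolyBounded t) (h' : PolyBounded t') : PolyBounded fun a => t a + t' a :=
  let ⟨P, hP⟩ := h
  let ⟨Q, hQ⟩ := h'
  ⟨P + Q, fun a => by simpa using add_le_add (hP a) (hQ a)⟩

theorem mul (h : PolyBounded t) (h' : PolyBounded t') : PolyBounded fun a => t a * t' a :=
  let ⟨P, hP⟩ := h
  let ⟨Q, hQ⟩ := h'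
  ⟨P * Q, fun a => by simpa using Nat.mul_le_mul (hP a) (hQ a)⟩

theorem eval (P : Polynomial ℕ) (h : PolyBounded t) : PolyBounded fun a => P.eval (t a) :=
  let ⟨Q, hQ⟩ := h
  ⟨P.comp Q, fun a => by simpa using eval_mono P (hQ a)⟩

theorem comp {β : Type} [Enc β] {t : β → ℕ} {f : α → β} (h : PolyBounded t)
    (hf : PolyBounded fun a => PolyTM.size (f a)) : PolyBounded fun a => t (f a) :=
  let ⟨P, hP⟩ := h
  (hf.eval P).mono fun a => hP (f a)

end PolyBounded

/-- The polynomial time functions between encoded types: those computed, for each size of the input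
alphabet of the tree machine, by a program that replaces the code of the argument on top of the
data stack by the code of the value, in polynomially many steps. -/
@[fun_prop]
def PolyTime {α β : Type} [Enc α] [Enc β] (f : α → β) : Prop :=
  PolyBounded (fun a => size (f a)) ∧ ∀ m : ℕ, ∃ p : TProg m, ∃ t : α → ℕ, PolyBounded t ∧
    ∀ a, Rewrites p (t a) (Enc.enc a).code (Enc.enc (f a)).code

namespace PolyTime

variable {α β γ δ : Type} [Enc α] [Enc β] [Enc γ] [Enc δ]

/-- A function that does not change the code is computed by the program that does nothing. -/
theorem of_enc_eq {f : α → β} (h : ∀ a, Enc.enc (f a) = Enc.enc a) : PolyTime f := by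
  refine ⟨PolyBounded.size.mono fun a => by simp [size, h], fun m => ⟨load id, fun _ => 1, .const 1,
    fun a i d => ?_⟩⟩
  rw [h]
  exact execLe_load _

@[fun_prop]
theorem id : PolyTime fun a : α => a := of_enc_eq fun _ => rfl

@[fun_prop]
theorem comp {g : β → γ} {f : α → β} (hg : PolyTime g) (hf : PolyTime f) :
    PolyTime fun a => g (f a) := by
  refine ⟨hg.1.comp hf.1, fun m => ?_⟩
  obtain ⟨p, t, ht, hp⟩ := hf.2 m
  obtain ⟨q, t', ht', hq⟩ := hg.2 m
  exact ⟨p.seq q, _, ht.add (ht'.comp hf.1), fun a => (hp a).seq (hq (f a))⟩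

@[fun_prop]
theorem const (b : β) : PolyTime fun _ : α => b := by
  refine ⟨.const _, fun m => ⟨drop.seq (pushWord (Enc.enc b).code), _,
    (((PolyBounded.const 11).mul .size).add (.const 5)).add (.const _),
    fun a => (rewrites_drop _).seq (rewrites_pushWord _)⟩⟩

@[fun_prop]
theorem prodMk {f : α → β} {g : α → γ} (hf : PolyTime f) (hg : PolyTime g) :
    PolyTime fun a => (f a, g a) := by
  refine ⟨((hf.1.add hg.1).add (.const 1)).mono fun a => by simp, fun m => ?_⟩
  obtain ⟨p, t, ht, hp⟩ := hf.2 m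
  obtain ⟨q, t', ht', hq⟩ := hg.2 m
  refine ⟨dup.seq <| p.seq <| swap.seq <| q.seq <| swap.seq <| pushWord [true],
    _, (((PolyBounded.const 15).mul .size).add (.const 7)).add <| ht.add <|
      (((PolyBounded.const 12).mul (hf.1.add .size)).add (.const 10)).add <| ht'.add <|
      (((PolyBounded.const 12).mul (hg.1.add hf.1)).add (.const 10)).add (.const 2),
    fun a => (rewrites_dup _).seq <| ((hp a).frame _).seq <| (rewrites_swap _ _).seq <|
      ((hq a).frame _).seq <| (rewrites_swap _ _).seq <| (rewrites_pushWord [true]).frame _⟩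

@[fun_prop]
theorem fst : PolyTime fun p : α × β => p.1 := by
  refine ⟨PolyBounded.size.mono fun p => by simp [size_prod]; omega, fun m => ?_⟩
  refine ⟨discard.seq (swap.seq drop), _, (PolyBounded.const 1).add <|
    ((((PolyBounded.const 12).mul .size).add (.const 10))).add
      (((PolyBounded.const 11).mul .size).add (.const 5)), fun p => ?_⟩
  refine Rewrites.seq (((rewrites_discard true).frame _)) <|
    (Rewrites.mono (rewrites_swap (Enc.enc p.1) (Enc.enc p.2)) ?_).seq
    (Rewrites.mono ((rewrites_drop (Enc.enc p.2)).frame _) ?_)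
  · have := size_prod p
    simp only [size] at this ⊢; omega
  · have := size_prod p
    simp only [size] at this ⊢; omega

@[fun_prop]
theorem snd : PolyTime fun p : α × β => p.2 := by
  refine ⟨PolyBounded.size.mono fun p => by simp [size_prod]; omega, fun m => ?_⟩
  refine ⟨discard.seq drop, _, (PolyBounded.const 1).add
      (((PolyBounded.const 11).mul .size).add (.const 5)), fun p => ?_⟩
  refine Rewrites.seq (((rewrites_discard true).frame _))
    (Rewrites.mono ((rewrites_drop (Enc.enc p.1)).frame _) ?_)
  have := size_prod p
  simp only [size] at this ⊢; omega

theorem boolCond {c : α → Bool} {f g : α → β} (hc : PolyTime c) (hf : PolyTime f)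
    (hg : PolyTime g) : PolyTime fun a => bif c a then f a else g a := by
  refine ⟨(hf.1.add hg.1).mono fun a => by cases h : c a <;> simp [h], fun m => ?_⟩
  obtain ⟨p, t, ht, hp⟩ := (hc.prodMk id).2 m
  obtain ⟨p₁, t₁, ht₁, hp₁⟩ := hf.2 m
  obtain ⟨p₂, t₂, ht₂, hp₂⟩ := hg.2 m
  refine ⟨p.seq <| discard.seq <| branch (discard.seq <| discard.seq p₁) p₂, _,
    ht.add <| (PolyBounded.const 1).add <| ((ht₁.add ht₂).add (.const 5)), fun a => ?_⟩
  suffices Rewrites (branch (discard.seq <| discard.seq p₁) p₂) (t₁ a + t₂ a + 5)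
      ((Enc.enc (c a)).code ++ (Enc.enc a).code) (Enc.enc (bif c a then f a else g a)).code from
    (hp a).seq (((rewrites_discard true).frame _).seq this)
  cases h : c a
  · exact (rewrites_branch_false (hp₂ a)).mono (by omega)
  · exact (rewrites_branch_true (((rewrites_discard false).frame (false :: (Enc.enc a).code)).seq
      (((rewrites_discard false).frame _).seq (hp₁ a)))).mono (by omega)

@[fun_prop]
theorem ite {c : α → Prop} [DecidablePred c] {f g : α → β} (hc : PolyTime fun a => decide (c a))
    (hf : PolyTime f) (hg : PolyTime g) : PolyTime fun a => if c a then f a else g a := by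
  convert hc.boolCond hf hg using 2 with a
  by_cases h : c a <;> simp [h]

theorem decide_eq [DecidableEq β] {f g : α → β} (hf : PolyTime f) (hg : PolyTime g) :
    PolyTime fun a => decide (f a = g a) := by
  suffices PolyTime fun p : β × β => decide (p.1 = p.2) from this.comp (hf.prodMk hg)
  refine ⟨(PolyBounded.const 3).mono fun _ => size_bool_le _, fun m => ?_⟩
  refine ⟨discard.seq <| eqTest.seq <| branch (pushWord [true, false, false]) (pushWord [false]), _,
    (PolyBounded.const 1).add <| (((PolyBounded.const 12).mul .size).add (.const 20)).add <|
      .const 7, fun p => ?_⟩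
  refine Rewrites.seq ((rewrites_discard true).frame _) <|
    (Rewrites.mono (rewrites_eqTest (Enc.enc p.1) (Enc.enc p.2)) ?_).seq ?_
  · have := size_prod p
    simp only [size] at this ⊢; omega
  · by_cases h : p.1 = p.2
    · have h' : Enc.enc p.1 = Enc.enc p.2 := by rw [h]
      simp only [h, decide_true]
      exact rewrites_branch_true (rewrites_pushWord _)
    · have h' : Enc.enc p.1 ≠ Enc.enc p.2 := fun e => h (Enc.enc_injective e)
      simp only [h, h', decide_false]
      exact (rewrites_branch_false (rewrites_pushWord _)).mono (by simp)

/-- The loop that computes a left fold: while the list on top of the data stack is not empty, which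
its first bit tells, its head is combined with the accumulator below its tail. The number `n` bounds
the steps of each round. -/
theorem repeats_foldl {m : ℕ} {f : α × β → β} {p : TProg m} {t : α × β → ℕ} {n : ℕ}
    (hp : ∀ a, Rewrites p (t a) (Enc.enc a).code (Enc.enc (f a)).code) :
    ∀ (l : List α) (s : β),
      (∀ l₁ a l₂, l = l₁ ++ a :: l₂ →
        24 * (size a + size l₂ + size (l₁.foldl (fun s a => f (a, s)) s) +
          size (f (a, l₁.foldl (fun s a => f (a, s)) s))) +
          t (a, l₁.foldl (fun s a => f (a, s)) s) + 40 ≤ n) →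
      Repeats (rot.seq <| (pushWord [true]).seq <| p.seq swap) (l.length * n + 1)
        ((Enc.enc l).code ++ (Enc.enc s).code)
        (Enc.enc (l.foldl (fun s a => f (a, s)) s)).code
  | [], s, _ => by
    rw [List.length_nil, Nat.zero_mul]
    exact repeats_false
  | a :: l, s, h => by
    have ih := repeats_foldl (n := n) hp l (f (a, s)) fun l₁ a' l₂ e => by
      simpa using h (a :: l₁) a' l₂ (by simp [e])
    have hr : Rewrites (rot.seq <| (pushWord [true]).seq <| p.seq swap) _
        ((Enc.enc a).code ++ ((Enc.enc l).code ++ (Enc.enc s).code))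
        ((Enc.enc l).code ++ (Enc.enc (f (a, s))).code) :=
      (rewrites_rot _ _ _).seq <| ((rewrites_pushWord [true]).frame _).seq <|
        Rewrites.seq (y := (Enc.enc (f (a, s))).code ++ (Enc.enc l).code) (by
          have := (hp (a, s)).frame (Enc.enc l).code
          simp only [Enc.enc, code] at this ⊢
          simpa using this) (rewrites_swap _ _)
    have := repeats_true hr ih
    intro i d
    refine cast ?_ ((this i d).mono (m := (a :: l).length * n + 1) ?_)
    · simp [Enc.enc, encList, code]
    · have := h [] a l rfl
      simp only [size, List.foldl_nil, List.length_cons, Nat.add_mul, List.length_nil] at this ⊢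
      omega

theorem foldl_uncurry {f : α × β → β} {g : γ → List α × β} (hf : PolyTime f) (hg : PolyTime g)
    {B : γ → ℕ} (hB : PolyBounded B)
    (h : ∀ c l₁ l₂, (g c).1 = l₁ ++ l₂ → size (l₁.foldl (fun s a => f (a, s)) (g c).2) ≤ B c) :
    PolyTime fun c => (g c).1.foldl (fun s a => f (a, s)) (g c).2 := by
  refine ⟨hB.mono fun c => h c _ [] (by simp), fun m => ?_⟩
  obtain ⟨p, t, ht, hp⟩ := hg.2 m
  obtain ⟨q, t', ⟨P, hP⟩, hq⟩ := hf.2 m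
  -- a generous bound for the sizes of everything that occurs in a round of the loop
  have hsz : PolyBounded fun c => size (g c) + B c + 1 := (hg.1.add hB).add (.const 1)
  refine ⟨p.seq <| discard.seq <| repeatWhile (rot.seq <| (pushWord [true]).seq <| q.seq swap), _,
    ht.add <| (PolyBounded.const 1).add <| (hg.1.mul
      ((((PolyBounded.const 100).mul hsz).add (hsz.eval P)).add (.const 40))).add (.const 3),
    fun c => ?_⟩
  refine (hp c).seq <| Rewrites.seq ((rewrites_discard true).frame _) <|
    ((repeats_foldl (n := 100 * (size (g c) + B c + 1) + P.eval (size (g c) + B c + 1) + 40) hq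
      (g c).1 (g c).2 fun l₁ a l₂ e => ?_).rewrites).mono ?_
  · have h₁ := h c l₁ (a :: l₂) e
    have h₂ := h c (l₁ ++ [a]) l₂ (by simp [e])
    have h₃ := size_append_add_one l₁ (a :: l₂)
    have h₄ := size_prod (g c)
    simp only [List.foldl_append, List.foldl_cons, List.foldl_nil] at h₂
    simp only [e, size_cons] at h₃ h₄
    have h₅ := size_pos l₁
    have h₆ := (hP (a, l₁.foldl (fun s a => f (a, s)) (g c).2)).trans
      (eval_mono P (show _ ≤ size (g c) + B c + 1 by simp only [size_mk]; omega))
    simp only at h₆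
    omega
  · have := length_lt_size (g c).1
    have h₄ := size_prod (g c)
    have := Nat.mul_le_mul_right (100 * (size (g c) + B c + 1) +
      P.eval (size (g c) + B c + 1) + 40) (show (g c).1.length ≤ size (g c) by omega)
    omega

/-- Iteration over a list takes polynomial time if all intermediate values have polynomially
bounded size. -/
theorem foldl {l : γ → List α} {s : γ → β} {f : γ → β → α → β} (hl : PolyTime l) (hs : PolyTime s)
    (hf : PolyTime fun p : γ × β × α => f p.1 p.2.1 p.2.2) {B : γ → ℕ} (hB : PolyBounded B)
    (h : ∀ c l₁ l₂, l c = l₁ ++ l₂ → size (l₁.foldl (f c) (s c)) ≤ B c) :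
    PolyTime fun c => (l c).foldl (f c) (s c) := by
  have key (c : γ) (l : List α) (s : β) : l.foldl (fun (q : γ × β) a => (q.1, f q.1 q.2 a)) (c, s) =
      (c, l.foldl (f c) s) := by
    induction l generalizing s with
    | nil => rfl
    | cons a l ih => exact ih _
  -- the parameter `c` travels along with the accumulator
  have H := foldl_uncurry (f := fun p : α × γ × β => (p.2.1, f p.2.1 p.2.2 p.1))
    (g := fun c => (l c, c, s c)) (B := fun c => size c + B c + 1)
    (prodMk (by fun_prop) (hf.comp (f := fun p : α × γ × β => (p.2.1, p.2.2, p.1)) (by fun_prop)))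
    (by fun_prop) ((PolyBounded.size.add hB).add (.const 1)) fun c l₁ l₂ e => by
      have := h c l₁ l₂ e
      simp only [key, size_mk]; omega
  simpa only [key] using snd.comp H

end PolyTime

end PolyTM

namespace PolyTM

open BTree Prog

/-! ### Input and output -/

/-- Symbols are encoded like numbers. -/
instance {n : ℕ} : Enc (Fin n) :=
  ⟨fun a => encNat a, fun _ _ h => Fin.ext (encNat_injective h)⟩

theorem size_fin_le {n : ℕ} (a : Fin n) : size a ≤ 2 * n := by
  have h : size a = size (a : ℕ) := rfl
  rw [h, size_nat]
  omega

namespace Prog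

variable {m : ℕ} {i : List (Fin (m + 1))} {d : List Bool} {r : Reg m}

/-- Push the code of the number `min k s`, where `s` is the input symbol in the register. -/
def pushUnary : ℕ → TProg m
  | 0 => push .D fun _ => false
  | k + 1 => (pushUnary k).seq <|
      ite (fun r => decide (k < (r.s.getD 0 : ℕ)))
        ((push .D fun _ => false).seq (push .D fun _ => true)) (load id)

theorem execLe_pushUnary (s : Fin (m + 1)) : ∀ k : ℕ,
    ExecLe (pushUnary k : TProg m) (3 * k + 1) (⟨none, false, some s⟩, st i d [] ![[], [], []])
      (⟨none, false, some s⟩, st i ((encNat (min k s)).code ++ d) [] ![[], [], []])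
  | 0 => by
    rw [Nat.zero_min]
    exact execLe_push_D _
  | k + 1 => by
    refine ((execLe_pushUnary s k).seq (m := 3) ?_).mono (by omega)
    by_cases h : k < (s : ℕ)
    · rw [min_eq_left h.le, min_eq_left (by omega : k + 1 ≤ s)]
      exact ExecLe.iteTrue (by simpa using h) ((execLe_push_D _).seq (execLe_push_D _))
    · rw [min_eq_right (by omega), min_eq_right (by omega)]
      exact (ExecLe.iteFalse (by simpa using h) (execLe_load _)).mono (by omega)

/-- The loop of `readAll`. -/
def readLoop : TProg m :=
  .while (fun r => r.s.isSome) <| (pushUnary m).seq <| (push .D fun _ => true).seq <|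
    pop .inp fun r o => { r with s := o }

/-- Move the word on the input stack to the data stack, as the code of the reversed list. -/
def readAll : TProg m :=
  (push .D fun _ => false).seq <| (pop .inp fun r o => { r with s := o }).seq readLoop

theorem execLe_readLoop : ∀ l y : List (Fin (m + 1)),
    ExecLe (readLoop : TProg m) ((3 * m + 4) * l.length + 1)
      (⟨none, false, l.head?⟩, st l.tail (Enc.enc y).code [] ![[], [], []])
      (r0, st [] (Enc.enc (l.reverse ++ y)).code [] ![[], [], []])
  | [], y => .whileFalse rfl
  | a :: l, y => by
    refine (ExecLe.whileTrue rfl ((execLe_pushUnary a m).seq ((execLe_push_D _).seq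
      (execLe_pop_inp _))) (m := (3 * m + 4) * l.length + 1) ?_).mono ?_
    · have := execLe_readLoop l (a :: y)
      rw [min_eq_right (by omega)]
      simpa [Enc.enc, encList, code, readLoop] using this
    · simp [Nat.mul_add]; omega

theorem execLe_readAll (l : List (Fin (m + 1))) :
    ExecLe (readAll : TProg m) ((3 * m + 4) * l.length + 3) (idle l [])
      (idle [] (Enc.enc l.reverse).code) := by
  refine ((execLe_push_D _).seq ((execLe_pop_inp _).seq
    (?_ : ExecLe _ ((3 * m + 4) * l.length + 1) _ _))).mono (by omega)
  have := execLe_readLoop l []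
  rw [List.append_nil] at this
  exact this

/-- The loop of `writeSym`: count the bits `true` of the unary code in the register. -/
def writeSymLoop : TProg m :=
  .while isB <| discard.seq <|
    (load fun r => { r with
      s := r.s.map fun s : Fin (m + 1) => Fin.ofNat (m + 1) (s.val + 1) }).seq <|
    pop .D setB

/-- Move the symbol on top of the data stack to the input stack. -/
def writeSym : TProg m :=
  (load fun _ => ⟨none, false, some 0⟩).seq <| (pop .D setB).seq <| writeSymLoop.seq <|
    (push .inp fun r => r.s.getD 0)

theorem execLe_writeSymLoop : ∀ (k s : ℕ) (_ : s + k < m + 1),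
    ExecLe (writeSymLoop : TProg m) (4 * k + 1)
      (⟨(encNat k).code.head?, false, some (Fin.ofNat (m + 1) s)⟩,
        st i ((encNat k).code.tail ++ d) [] ![[], [], []])
      (⟨some false, false, some (Fin.ofNat (m + 1) (s + k))⟩, st i d [] ![[], [], []])
  | 0, s, _ => .whileFalse rfl
  | k + 1, s, h => by
    refine (ExecLe.whileTrue rfl ((execLe_pop_D _).seq ((execLe_load _).seq (execLe_pop_D _)))
      (m := 4 * k + 1) ?_).mono (by omega)
    have := execLe_writeSymLoop k (s + 1) (by omega)
    have hs : s % (m + 1) = s := Nat.mod_eq_of_lt (by omega)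
    have hk : (encNat k).code = (encNat k).code.head?.getD false :: (encNat k).code.tail := by
      cases k <;> rfl
    rw [Nat.add_assoc, Nat.add_comm 1 k] at this
    simp only [encNat, code, setB, List.tail_cons, List.cons_append,
      Option.map_some, Fin.val_ofNat, hs]
    generalize encNat k = z at hk this
    rw [hk] at this ⊢
    exact this

theorem execLe_writeSym (s : Fin (m + 1)) :
    ExecLe (writeSym : TProg m) (4 * (s : ℕ) + 4) (r, st i ((Enc.enc s).code ++ d) [] ![[], [], []])
      (⟨some false, false, some s⟩, st (s :: i) d [] ![[], [], []]) := by
  have H := execLe_writeSymLoop (m := m) (i := i) (d := d) s 0 (by omega)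
  have hk : (encNat s).code = (encNat s).code.head?.getD false :: (encNat s).code.tail := by
    cases (s : ℕ) <;> rfl
  have hs : Fin.ofNat (m + 1) (0 + s) = s := by
    ext; simp
  rw [hs] at H
  refine ((execLe_load _).seq ((execLe_pop_D _).seq (.seq (n := 4 * (s : ℕ) + 1) (m := 1)
    (s' := (⟨some false, false, some s⟩, st i d [] ![[], [], []])) ?_
    (execLe_push_inp _)))).mono (?_ : 1 + (1 + (4 * (s : ℕ) + 1 + 1)) ≤ _)
  swap
  · omega
  simp only [Enc.enc, setB]
  generalize encNat s = z at hk H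
  rw [hk] at H ⊢
  exact H

/-- The loop of `writeAll`. -/
def writeLoop : TProg m := .while isB <| writeSym.seq (pop .D setB)

/-- Move the list on the data stack to the input stack, which reverses it. -/
def writeAll : TProg m := (pop .D setB).seq writeLoop

theorem execLe_writeLoop : ∀ (l : List (Fin (m + 1))) (r : Reg m) (i : List (Fin (m + 1))),
    ∃ r', ExecLe (writeLoop : TProg m) ((4 * m + 10) * l.length + 1)
      (setB r (Enc.enc l).code.head?, st i (Enc.enc l).code.tail [] ![[], [], []])
      (r', st (l.reverse ++ i) [] [] ![[], [], []])
  | [], r, i => ⟨_, .whileFalse rfl⟩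
  | a :: l, r, i => by
    obtain ⟨r', h⟩ := execLe_writeLoop l ⟨some false, false, some a⟩ (a :: i)
    refine ⟨r', (ExecLe.whileTrue rfl ((execLe_writeSym (d := (Enc.enc l).code) a).seq
      (execLe_pop_D _)) (m := (4 * m + 10) * l.length + 1) ?_).mono ?_⟩
    · simpa [writeLoop] using h
    · have := a.2
      simp [Nat.mul_add]; omega

theorem execLe_writeAll (l : List (Fin (m + 1))) :
    ∃ r', ExecLe (writeAll : TProg m) ((4 * m + 10) * l.length + 2) (idle [] (Enc.enc l).code)
      (r', st l.reverse [] [] ![[], [], []]) := by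
  obtain ⟨r', h⟩ := execLe_writeLoop l r0 []
  exact ⟨r', ((execLe_pop_D _).seq (by simpa using h)).mono (by omega)⟩

/-- The bundled machine of a program, with output on the stack `k`. -/
noncomputable def toFinTM2 (p : TProg m) (k : Stk) : FinTM2 :=
  haveI := p.finite_lab
  { K := Stk
    k₀ := .inp
    k₁ := k
    Γ := Γ m
    Λ := Option p.Lab
    main := some p.entry
    ΛFin := Fintype.ofFinite _
    σ := Reg m
    initialState := r0
    Γk₀Fin := inferInstanceAs (Fintype (Fin (m + 1)))
    m := p.machine r0 }

theorem initList_toFinTM2 (p : TProg m) (k : Stk) (w : List (Fin (m + 1))) :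
    initList (p.toFinTM2 k) w =
      (⟨some (some p.entry), r0, st w [] [] ![[], [], []]⟩ :
        TM2.Cfg (Γ m) (Option p.Lab) (Reg m)) := by
  refine congrArg (TM2.Cfg.mk _ _) (funext fun j => ?_)
  cases j with
  | aux j => fin_cases j <;> rfl
  | _ => rfl

theorem haltList_toFinTM2_D (p : TProg m) (w : List Bool) :
    haltList (p.toFinTM2 .D) w =
      (⟨none, r0, st [] w [] ![[], [], []]⟩ : TM2.Cfg (Γ m) (Option p.Lab) (Reg m)) := by
  refine congrArg (TM2.Cfg.mk _ _) (funext fun j => ?_)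
  cases j with
  | aux j => fin_cases j <;> rfl
  | _ => rfl

theorem haltList_toFinTM2_inp (p : TProg m) (w : List (Fin (m + 1))) :
    haltList (p.toFinTM2 .inp) w =
      (⟨none, r0, st w [] [] ![[], [], []]⟩ : TM2.Cfg (Γ m) (Option p.Lab) (Reg m)) := by
  refine congrArg (TM2.Cfg.mk _ _) (funext fun j => ?_)
  cases j with
  | aux j => fin_cases j <;> rfl
  | _ => rfl

end Prog

namespace PolyTime

theorem reverse {α : Type} [Enc α] : PolyTime fun l : List α => l.reverse := by
  have key (l s : List α) : l.foldl (fun s a => a :: s) s = l.reverse ++ s := by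
    induction l generalizing s with
    | nil => rfl
    | cons a l ih => simp [ih]
  have H := foldl (l := fun l : List α => l) (s := fun _ => []) (f := fun _ s a => a :: s) id
    (const _) ?_ .size fun c l₁ l₂ e => ?_
  · simpa [key] using H
  · exact of_enc_eq (α := α × List α) (f := fun p => p.1 :: p.2) (fun _ => rfl) |>.comp
      (f := fun p : List α × List α × α => (p.2.2, p.2.1)) (by fun_prop)
  · have := size_append_add_one l₁ l₂
    have := size_pos l₂
    rw [key, List.append_nil, size_reverse, e]; omega

variable {m : ℕ}

theorem size_word_le : ∀ w : List (Fin (m + 1)), size w ≤ (2 * m + 3) * w.length + 1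
  | [] => by simp
  | a :: w => by
    have := size_word_le w
    have := size_fin_le a
    simp [Nat.mul_add]; omega

/-- A polynomial time predicate on words is decided by a Turing machine in polynomial time. Reading
the input reverses it, hence the composition with `reverse`. -/
theorem nonempty_computable_bool {Γ₀ : Type} (e : Γ₀ ≃ Fin (m + 1))
    {f : List (Fin (m + 1)) → Bool} (hf : PolyTime f) :
    Nonempty (TM2ComputableInPolyTime (_root_.id : List Γ₀ → List Γ₀) Computability.encodeBool
      fun w => f (w.map e)) := by
  obtain ⟨p, t, ⟨P, ht⟩, hp⟩ := (hf.comp reverse).2 m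
  let q : TProg m := readAll.seq <| p.seq <|
    branch (discard.seq <| discard.seq <| pushWord [true]) (pushWord [false])
  have hq (w : List (Fin (m + 1))) : ExecLe q ((3 * m + 4) * w.length + 3 +
      (P.eval ((2 * m + 3) * w.length + 1) + 7)) (idle w []) (idle [] [f w]) := by
    refine (execLe_readAll w).seq (.seq ?_ (m := 7) (s' := idle [] (Enc.enc (f w)).code) ?_)
    · have := (hp w.reverse).mono ((ht _).trans (eval_mono P
        (show _ ≤ (2 * m + 3) * w.length + 1 by simpa using size_word_le w))) [] []
      simpa using this
    · cases f w
      · exact ((rewrites_branch_false (rewrites_pushWord _)).mono (by simp)) [] []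
      · exact (rewrites_branch_true (((rewrites_discard false).frame [false]).seq
          ((rewrites_discard false).seq (rewrites_pushWord [true])))).mono (by simp) [] []
  refine ⟨⟨⟨q.toFinTM2 .D, e.symm, Equiv.refl Bool⟩,
    Polynomial.C (3 * m + 4) * Polynomial.X + 3 +
      (P.comp (Polynomial.C (2 * m + 3) * Polynomial.X + 1) + 7) + 1,
    fun w => Classical.choice ?_⟩⟩
  obtain ⟨k, hk, h⟩ := (hq (w.map e)).iterate_step_machine (r := r0)
  refine ⟨⟨⟨k, ?_⟩, hk.trans ?_⟩⟩
  · refine (congrArg (fun c => _^[k] (some c)) (initList_toFinTM2 q .D _)).trans (h.trans ?_)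
    exact congrArg some (haltList_toFinTM2_D q [f (w.map e)]).symm
  · simp

/-- A polynomial time function on words is computed by a Turing machine in polynomial time. -/
theorem nonempty_computable_list {Γ₀ : Type} (e : Γ₀ ≃ Fin (m + 1))
    {f : List (Fin (m + 1)) → List (Fin (m + 1))} (hf : PolyTime f) :
    Nonempty (TM2ComputableInPolyTime (_root_.id : List Γ₀ → List Γ₀)
      (_root_.id : List Γ₀ → List Γ₀) fun w => (f (w.map e)).map e.symm) := by
  obtain ⟨p, t, ⟨P, ht⟩, hp⟩ := (reverse.comp (hf.comp reverse)).2 m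
  obtain ⟨Q, hQ⟩ := hf.1
  let q : TProg m := readAll.seq <| p.seq writeAll
  have hq (w : List (Fin (m + 1))) : ∃ r', ExecLe q ((3 * m + 4) * w.length + 3 +
      (P.eval ((2 * m + 3) * w.length + 1) +
        ((4 * m + 10) * Q.eval ((2 * m + 3) * w.length + 1) + 2))) (idle w [])
      (r', st (f w) [] [] ![[], [], []]) := by
    obtain ⟨r', h⟩ := execLe_writeAll (f w).reverse
    rw [List.reverse_reverse] at h
    refine ⟨r', (execLe_readAll w).seq (.seq ?_ (h.mono ?_))⟩
    · have := (hp w.reverse).mono ((ht _).trans (eval_mono P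
        (show _ ≤ (2 * m + 3) * w.length + 1 by simpa using size_word_le w))) [] []
      simpa using this
    · have h₁ := (hQ w).trans (eval_mono Q (size_word_le w))
      have h₂ := length_lt_size (f w)
      rw [List.length_reverse]
      gcongr
      exact h₂.le.trans h₁
  refine ⟨⟨⟨q.toFinTM2 .inp, e.symm, e.symm⟩,
    Polynomial.C (3 * m + 4) * Polynomial.X + 3 +
      (P.comp (Polynomial.C (2 * m + 3) * Polynomial.X + 1) +
        (Polynomial.C (4 * m + 10) * Q.comp (Polynomial.C (2 * m + 3) * Polynomial.X + 1) + 2)) + 1,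
    fun w => Classical.choice ?_⟩⟩
  obtain ⟨r', h⟩ := hq (w.map e)
  obtain ⟨k, hk, h⟩ := h.iterate_step_machine (r := r0)
  refine ⟨⟨⟨k, ?_⟩, hk.trans ?_⟩⟩
  · refine (congrArg (fun c => _^[k] (some c)) (initList_toFinTM2 q .inp _)).trans (h.trans ?_)
    refine congrArg some ((haltList_toFinTM2_inp q (f (w.map e))).symm.trans ?_)
    refine congrArg (haltList (q.toFinTM2 .inp)) ?_
    have H (l : List (Fin (m + 1))) : (l.map e.symm).map e = l := by simp
    exact (H _).symm
  · simp

end PolyTime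

end PolyTM

namespace PolyTM

/-! ### Basic polynomial time functions on lists and numbers -/

instance : Enc Unit := ⟨fun _ => BTree.leaf, fun _ _ _ => rfl⟩

namespace PolyTime

variable {α β γ δ : Type} [Enc α] [Enc β] [Enc γ] [Enc δ]

attribute [fun_prop] reverse

@[fun_prop]
theorem listCons {f : γ → α} {g : γ → List α} (hf : PolyTime f) (hg : PolyTime g) :
    PolyTime fun c => f c :: g c :=
  (of_enc_eq (f := fun p : α × List α => p.1 :: p.2) fun _ => rfl).comp (hf.prodMk hg)

/-- Recursion over a list takes polynomial time if each step increases the size by a polynomially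
bounded amount. -/
theorem foldr {l : γ → List α} {s : γ → β} {f : γ → α → β → β} (hl : PolyTime l) (hs : PolyTime s)
    (hf : PolyTime fun p : γ × α × β => f p.1 p.2.1 p.2.2) {K : γ → ℕ} (hK : PolyBounded K)
    (h : ∀ c, ∀ a ∈ l c, ∀ t, size (f c a t) ≤ size t + K c) :
    PolyTime fun c => (l c).foldr (f c) (s c) := by
  have key (c : γ) (l : List α) (s : β) (h : ∀ a ∈ l, ∀ t, size (f c a t) ≤ size t + K c) :
      size (l.foldr (f c) s) ≤ size s + l.length * K c := by
    induction l with
    | nil => simp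
    | cons a l ih =>
      have h₁ := ih fun a ha => h a (List.mem_cons_of_mem _ ha)
      have h₂ := h a List.mem_cons_self (l.foldr (f c) s)
      simp only [List.foldr_cons, List.length_cons, Nat.add_mul]
      omega
  have H := foldl (l := fun c => (l c).reverse) (s := s) (f := fun c t a => f c a t)
    (reverse.comp hl) hs
    (hf.comp (f := fun p : γ × β × α => (p.1, p.2.2, p.2.1)) (by fun_prop))
    (B := fun c => size (s c) + size (l c) * K c) (hs.1.add (hl.1.mul hK)) fun c l₁ l₂ e => by
      have e' : l c = l₂.reverse ++ l₁.reverse := by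
        rw [← List.reverse_append, ← e, List.reverse_reverse]
      rw [← List.foldr_reverse]
      refine (key c l₁.reverse (s c) fun a ha =>
        h c a (by simp [e', List.mem_reverse.1 ha])).trans ?_
      have := length_lt_size (l c)
      gcongr
      simp [e'] at this ⊢; omega
  simpa using H

/-- A polynomial time function applied to the elements of a list has polynomially bounded values. -/
theorem exists_size_le {l : γ → List α} {g : γ → α → β} (hl : PolyTime l)
    (hg : PolyTime fun p : γ × α => g p.1 p.2) :
    ∃ K : γ → ℕ, PolyBounded K ∧ ∀ c, ∀ a ∈ l c, size (g c a) ≤ K c := by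
  obtain ⟨P, hP⟩ := hg.1
  refine ⟨_, ((PolyBounded.size.add hl.1).add (.const 1)).eval P, fun c a ha =>
    (hP (c, a)).trans (eval_mono P ?_)⟩
  have := size_le_of_mem ha
  simp only [size_mk]
  omega

@[fun_prop]
theorem listMap {l : γ → List α} {g : γ → α → β} (hl : PolyTime l)
    (hg : PolyTime fun p : γ × α => g p.1 p.2) : PolyTime fun c => (l c).map (g c) := by
  obtain ⟨K, hK, h⟩ := exists_size_le hl hg
  have H := foldr (l := l) (s := fun _ => []) (f := fun c a t => g c a :: t) hl (const _)
    ((hg.comp (f := fun p : γ × α × List β => (p.1, p.2.1)) (by fun_prop)).listCons (by fun_prop))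
    (hK.add (.const 1)) fun c a ha t => by have := h c a ha; simp; omega
  convert H using 2 with c
  induction l c <;> simp_all

@[fun_prop]
theorem listAppend {f g : γ → List α} (hf : PolyTime f) (hg : PolyTime g) :
    PolyTime fun c => f c ++ g c := by
  have H := foldr (l := f) (s := g) (f := fun _ a t => a :: t) hf hg
    (by fun_prop) (hf.1.add (.const 1)) fun c a ha t => by
      have := size_le_of_mem ha
      simp; omega
  simpa using H

@[fun_prop]
theorem listFlatMap {l : γ → List α} {g : γ → α → List β} (hl : PolyTime l)
    (hg : PolyTime fun p : γ × α => g p.1 p.2) : PolyTime fun c => (l c).flatMap (g c) := by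
  obtain ⟨K, hK, h⟩ := exists_size_le hl hg
  have H := foldr (l := l) (s := fun _ => []) (f := fun c a t => g c a ++ t) hl (const _)
    ((hg.comp (f := fun p : γ × α × List β => (p.1, p.2.1)) (by fun_prop)).listAppend
      (by fun_prop)) hK fun c a ha t => by
      have := h c a ha
      have := size_append_add_one (g c a) t
      omega
  convert H using 2 with c
  induction l c <;> simp_all

@[fun_prop]
theorem and {f g : γ → Bool} (hf : PolyTime f) (hg : PolyTime g) :
    PolyTime fun c => f c && g c := by
  convert hf.boolCond hg (const false) using 2 with c
  cases f c <;> simp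

@[fun_prop]
theorem or {f g : γ → Bool} (hf : PolyTime f) (hg : PolyTime g) :
    PolyTime fun c => f c || g c := by
  convert hf.boolCond (const true) hg using 2 with c
  cases f c <;> simp

@[fun_prop]
theorem not {f : γ → Bool} (hf : PolyTime f) : PolyTime fun c => !(f c) := by
  convert hf.boolCond (const false) (const true) using 2 with c
  cases f c <;> simp

@[fun_prop]
theorem listAny {l : γ → List α} {g : γ → α → Bool} (hl : PolyTime l)
    (hg : PolyTime fun p : γ × α => g p.1 p.2) : PolyTime fun c => (l c).any (g c) := by
  have H := foldr (l := l) (s := fun _ => false) (f := fun c a t => g c a || t) hl (const _)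
    ((hg.comp (f := fun p : γ × α × Bool => (p.1, p.2.1)) (by fun_prop)).or (by fun_prop))
    (.const 3) fun c a _ t => (size_bool_le _).trans (by omega)
  convert H using 2 with c
  induction l c <;> simp_all

@[fun_prop]
theorem listAll {l : γ → List α} {g : γ → α → Bool} (hl : PolyTime l)
    (hg : PolyTime fun p : γ × α => g p.1 p.2) : PolyTime fun c => (l c).all (g c) := by
  convert (listAny (g := fun c a => !(g c a)) hl hg.not).not using 2 with c
  exact List.all_eq_not_any_not

@[fun_prop]
theorem listFilter {l : γ → List α} {g : γ → α → Bool} (hl : PolyTime l)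
    (hg : PolyTime fun p : γ × α => g p.1 p.2) : PolyTime fun c => (l c).filter (g c) := by
  have H := listFlatMap (l := l) (g := fun c a => bif g c a then [a] else []) hl
    (hg.boolCond (by fun_prop) (by fun_prop))
  convert H using 2 with c
  induction l c with
  | nil => rfl
  | cons a l ih => cases h : g c a <;> simp [h, ih]

@[fun_prop]
theorem listHeadD {l : γ → List α} {d : γ → α} (hl : PolyTime l) (hd : PolyTime d) :
    PolyTime fun c => (l c).headD (d c) := by
  have H := foldr (l := l) (s := d) (f := fun _ a _ => a) hl hd (by fun_prop) hl.1
    fun c a ha t => (size_le_of_mem ha).trans (by omega)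
  convert H using 2 with c
  cases l c <;> simp

@[fun_prop]
theorem listTail {l : γ → List α} (hl : PolyTime l) : PolyTime fun c => (l c).tail := by
  -- the fold keeps both the list built so far and its tail
  have key (l : List α) : l.foldr (fun a (p : List α × List α) => (p.2, a :: p.2)) ([], []) =
      (l.tail, l) := by
    induction l with
    | nil => rfl
    | cons a l ih => simp [ih]
  have key' (l : List α) : l.foldl (fun (p : List α × List α) a => (p.2, a :: p.2)) ([], []) =
      (l.reverse.tail, l.reverse) := by
    rw [← key, List.foldr_reverse]
  have H := foldl (l := fun c => (l c).reverse) (s := fun _ => ([], []))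
    (f := fun _ (p : List α × List α) a => (p.2, a :: p.2)) (B := fun c => 2 * size (l c) + 1)
    (by fun_prop) (const _) (by fun_prop) (((PolyBounded.const 2).mul hl.1).add (.const 1))
    fun c l₁ l₂ e => by
      rw [key', size_mk, size_reverse]
      have h₁ : size l₁.reverse.tail ≤ size l₁ := by
        rw [← size_reverse l₁]
        cases l₁.reverse <;> simp; omega
      have h₂ := size_append_add_one l₁ l₂
      rw [← e, size_reverse] at h₂
      have := size_pos l₂
      omega
  simpa [key'] using fst.comp H

@[fun_prop]
theorem listLength {l : γ → List α} (hl : PolyTime l) : PolyTime fun c => (l c).length := by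
  have h₁ : PolyTime fun n : List Unit => n.length := of_enc_eq fun l => by
    induction l with
    | nil => rfl
    | cons a l ih => exact congrArg (BTree.node _) ih
  convert h₁.comp (hl.listMap (g := fun _ _ => ()) (const ())) using 2
  simp

theorem replicate_unit : PolyTime fun n : ℕ => List.replicate n () := of_enc_eq fun n => by
  induction n with
  | zero => rfl
  | succ n ih => exact congrArg (BTree.node _) ih

@[fun_prop]
theorem natSucc {n : γ → ℕ} (hn : PolyTime n) : PolyTime fun c => n c + 1 := by
  simpa using (listCons (const ()) (replicate_unit.comp hn)).listLength

@[fun_prop]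
theorem natPred {n : γ → ℕ} (hn : PolyTime n) : PolyTime fun c => n c - 1 := by
  simpa using (replicate_unit.comp hn).listTail.listLength

/-- Iteration takes polynomial time if all intermediate values have polynomially bounded size. -/
theorem iterate {n : γ → ℕ} {s : γ → β} {f : γ → β → β} (hn : PolyTime n) (hs : PolyTime s)
    (hf : PolyTime fun p : γ × β => f p.1 p.2) {B : γ → ℕ} (hB : PolyBounded B)
    (h : ∀ c, ∀ i ≤ n c, size ((f c)^[i] (s c)) ≤ B c) :
    PolyTime fun c => (f c)^[n c] (s c) := by
  have key (c : γ) (l : List Unit) (t : β) :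
      l.foldl (fun t _ => f c t) t = (f c)^[l.length] t := by
    induction l generalizing t with
    | nil => rfl
    | cons a l ih => exact ih _
  have H := foldl (l := fun c => List.replicate (n c) ()) (s := s) (f := fun c t _ => f c t)
    (replicate_unit.comp hn) hs (hf.comp (f := fun p : γ × β × Unit => (p.1, p.2.1))
      (by fun_prop)) hB fun c l₁ l₂ e => by
      rw [key]
      refine h c _ ?_
      have := congrArg List.length e
      simp at this; omega
  simpa [key] using H

@[fun_prop]
theorem natAdd {a b : γ → ℕ} (ha : PolyTime a) (hb : PolyTime b) :
    PolyTime fun c => a c + b c := by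
  have key (a i : ℕ) : (fun n => n + 1)^[i] a = a + i := Nat.succ_iterate a i
  have H := iterate (n := b) (s := a) (f := fun _ n => n + 1) hb ha (by fun_prop)
    (ha.1.add hb.1) fun c i hi => by
      simp only [key, size_nat]
      omega
  simpa only [key] using H

@[fun_prop]
theorem natSub {a b : γ → ℕ} (ha : PolyTime a) (hb : PolyTime b) :
    PolyTime fun c => a c - b c := by
  have key (a i : ℕ) : (fun n => n - 1)^[i] a = a - i := Nat.pred_iterate a i
  have H := iterate (n := b) (s := a) (f := fun _ n => n - 1) hb ha (by fun_prop)
    ha.1 fun c i hi => by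
      simp only [key, size_nat]
      omega
  simpa only [key] using H

@[fun_prop]
theorem natMul {a b : γ → ℕ} (ha : PolyTime a) (hb : PolyTime b) :
    PolyTime fun c => a c * b c := by
  have key (a i : ℕ) : (fun n => n + a)^[i] 0 = a * i := by
    induction i with
    | zero => rfl
    | succ i ih => rw [Function.iterate_succ_apply', ih, Nat.mul_succ]
  have H := iterate (n := b) (s := fun _ => 0) (f := fun c n => n + a c) hb (const 0)
    (natAdd snd (ha.comp fst))
    ((ha.1.mul hb.1).add (.const 1)) fun c i hi => by
      simp only [key, size_nat]
      have := Nat.mul_le_mul_left (a c) hi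
      ring_nf
      nlinarith
  simpa [key] using H

@[fun_prop]
theorem natPow {a : γ → ℕ} (ha : PolyTime a) (k : ℕ) : PolyTime fun c => a c ^ k := by
  induction k with
  | zero => simpa using const 1
  | succ k ih => simpa only [pow_succ] using ih.natMul ha

@[fun_prop]
theorem decide_le {a b : γ → ℕ} (ha : PolyTime a) (hb : PolyTime b) :
    PolyTime fun c => decide (a c ≤ b c) := by
  simpa only [Nat.sub_eq_zero_iff_le] using (ha.natSub hb).decide_eq (const 0)

/-- A function of a natural number that is constant from some point on takes polynomial time, as a
finite case distinction. -/
theorem of_eventually_const {f : ℕ → β} (k : ℕ) (h : ∀ n, k ≤ n → f n = f k) : PolyTime f := by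
  induction k generalizing f with
  | zero =>
    rw [funext fun n => h n (Nat.zero_le n)]
    exact const _
  | succ k ih =>
    have H := ite (c := fun n : ℕ => n = 0) (decide_eq (f := fun n : ℕ => n) id (const 0))
      (const (f 0)) ((ih (f := fun n => f (n + 1)) fun n hn => h _ (by omega)).comp (natPred id))
    convert H using 2 with n
    rcases n with _ | n <;> simp

/-- Every function on a finite set of symbols takes polynomial time. -/
theorem of_fin {n : ℕ} (f : Fin n → β) : PolyTime f := by
  rcases n with _ | n
  · exact of_enc_eq fun a => a.elim0
  have h₁ : PolyTime fun a : Fin (n + 1) => (a : ℕ) := of_enc_eq fun _ => rfl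
  have h₂ := (of_eventually_const
    (f := fun k : ℕ => f (if h : k < n + 1 then ⟨k, h⟩ else 0)) (n + 1)
    fun k hk => by
      rw [dif_neg (by omega), dif_neg (by omega)]).comp h₁
  convert h₂ using 2 with a
  rw [dif_pos a.2]

@[fun_prop]
theorem listRange {n : γ → ℕ} (hn : PolyTime n) : PolyTime fun c => List.range (n c) := by
  have key (i : ℕ) : (fun p : ℕ × List ℕ => (p.1 + 1, p.1 :: p.2))^[i] (0, []) =
      (i, (List.range i).reverse) := by
    induction i with
    | zero => rfl
    | succ i ih => simp [Function.iterate_succ_apply', ih, List.range_succ]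
  have hsz (i : ℕ) : size (List.range i) ≤ (2 * i + 2) * i + 1 := by
    induction i with
    | zero => simp
    | succ i ih =>
      have := size_append_add_one (List.range i) [i]
      rw [List.range_succ]
      simp at this
      nlinarith
  have H := iterate (n := n) (s := fun _ => ((0, []) : ℕ × List ℕ))
    (f := fun _ p => (p.1 + 1, p.1 :: p.2)) hn (const _) (by fun_prop)
    (B := fun c => size (n c) + ((size (n c) + 1) * size (n c) + 1) + 1)
    ((hn.1.add ((((hn.1.add (.const 1)).mul hn.1)).add (.const 1))).add (.const 1))
    fun c i hi => by
      have := hsz i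
      rw [key, size_mk, size_reverse]
      simp only [size_nat]
      nlinarith
  simpa [key] using reverse.comp (snd.comp H)

theorem listReplicate {n : γ → ℕ} {a : γ → α} (hn : PolyTime n) (ha : PolyTime a) :
    PolyTime fun c => List.replicate (n c) (a c) := by
  simpa using listMap (l := fun c => List.replicate (n c) ()) (g := fun c _ => a c)
    (replicate_unit.comp hn) (ha.comp fst)

/-- Whether a function takes polynomial time depends only on the codes of its values. -/
theorem congr_enc {f : γ → α} {g : γ → β} (hg : PolyTime g)
    (h : ∀ c, Enc.enc (f c) = Enc.enc (g c)) : PolyTime f := by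
  simpa only [PolyTime, size, h] using hg

theorem listTakeWhile {l : γ → List α} {p : α → Bool} (hl : PolyTime l) (hp : PolyTime p) :
    PolyTime fun c => (l c).takeWhile p := by
  have H := foldr (l := l) (s := fun _ => ([] : List α))
    (f := fun _ a t => bif p a then a :: t else []) hl (const _)
    (boolCond (hp.comp (by fun_prop)) (by fun_prop) (by fun_prop)) (hl.1.add (.const 1))
    fun c a ha t => by
      have := size_le_of_mem ha
      have := size_pos t
      cases p a <;> simp <;> omega
  convert H using 2 with c
  induction l c with
  | nil => rfl
  | cons a l ih => cases h : p a <;> simp [h, ih]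

theorem listDropWhile {l : γ → List α} {p : α → Bool} (hl : PolyTime l) (hp : PolyTime p) :
    PolyTime fun c => (l c).dropWhile p := by
  -- iterating the removal of one element reaches a fixed point after at most `l.length` steps
  let f : List α → List α := fun s => bif (s.map p).headD false then s.tail else s
  have hf : PolyTime f := boolCond (by fun_prop) (by fun_prop) id
  have key (l : List α) : f^[l.length] l = l.dropWhile p := by
    have hfix (l : List α) (h : f l = l) (k : ℕ) : f^[k] l = l := by
      induction k with
      | zero => rfl
      | succ k ih => rw [Function.iterate_succ_apply, h, ih]
    induction l with
    | nil => rfl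
    | cons a l ih =>
      rw [List.length_cons]
      cases h : p a
      · rw [hfix _ (by simp [f, h]), List.dropWhile_cons_of_neg (by simp [h])]
      · rw [Function.iterate_succ_apply, List.dropWhile_cons_of_pos h, ← ih]
        simp [f, h]
  have hsz (l : List α) (i : ℕ) : size (f^[i] l) ≤ size l := by
    induction i generalizing l with
    | zero => rfl
    | succ i ih =>
      rw [Function.iterate_succ_apply]
      refine (ih _).trans ?_
      cases l with
      | nil => simp [f]
      | cons a l => cases h : p a <;> simp [f, h]; omega
  have H := iterate (n := fun c => (l c).length) (s := l) (f := fun _ => f) (by fun_prop) hl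
    (hf.comp snd) hl.1 fun c i _ => hsz _ _
  simpa only [key] using H

theorem listDrop {l : γ → List α} {k : γ → ℕ} (hl : PolyTime l) (hk : PolyTime k) :
    PolyTime fun c => (l c).drop (k c) := by
  have key (l : List α) (i : ℕ) : List.tail^[i] l = l.drop i := by
    induction i generalizing l with
    | zero => rfl
    | succ i ih => rw [Function.iterate_succ_apply, ih, List.drop_tail, add_comm]
  have hsz (l : List α) (i : ℕ) : size (l.drop i) ≤ size l := by
    have h₁ := size_append_add_one (l.take i) (l.drop i)
    have h₂ := size_pos (l.take i)
    rw [List.take_append_drop] at h₁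
    omega
  have H := iterate (n := k) (s := l) (f := fun _ => List.tail) hk hl
    (by fun_prop) hl.1 fun c i _ => by rw [key]; exact hsz _ _
  simpa only [key] using H

@[fun_prop]
theorem listGetD {l : γ → List α} {k : γ → ℕ} {d : γ → α} (hl : PolyTime l) (hk : PolyTime k)
    (hd : PolyTime d) : PolyTime fun c => (l c).getD (k c) (d c) := by
  convert (hl.listDrop hk).listHeadD hd using 2 with c
  generalize l c = l
  induction k c generalizing l with
  | zero => cases l <;> rfl
  | succ k ih => cases l <;> simp_all

@[fun_prop]
theorem natDiv {a b : γ → ℕ} (ha : PolyTime a) (hb : PolyTime b) :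
    PolyTime fun c => a c / b c := by
  -- the quotient counts the positive multiples of `b` up to `a`
  have key (a b : ℕ) : a / b = if b = 0 then 0 else
      ((List.range a).filter fun k => decide ((k + 1) * b ≤ a)).length := by
    split_ifs with h
    · rw [h, Nat.div_zero]
    · have hb : 0 < b := Nat.pos_of_ne_zero h
      have h₁ (k : ℕ) : (k + 1) * b ≤ a ↔ k < a / b := (Nat.le_div_iff_mul_le hb).symm
      simp only [h₁]
      have h₂ (i q : ℕ) : ((List.range i).filter fun k => decide (k < q)).length = min i q := by
        induction i with
        | zero => simp
        | succ i ih =>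
          rw [List.range_succ, List.filter_append, List.length_append, ih]
          by_cases h : i < q <;> simp [h] <;> omega
      rw [h₂, min_eq_right (Nat.div_le_self a b)]
  simp only [key]
  exact ite (decide_eq hb (const 0)) (const 0) (by fun_prop)

@[fun_prop]
theorem natMod {a b : γ → ℕ} (ha : PolyTime a) (hb : PolyTime b) :
    PolyTime fun c => a c % b c := by
  simp only [Nat.mod_eq_sub_mul_div]
  fun_prop

end PolyTime

/-! ### Integers and vectors -/

/-- An integer is encoded by its sign and its absolute value in unary. -/
instance : Enc ℤ := ⟨fun x => Enc.enc (decide (x < 0), x.natAbs), fun x y h => by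
  have := Enc.enc_injective h
  simp only [Prod.mk.injEq, decide_eq_decide] at this
  omega⟩

/-- A vector is encoded by the list of its entries. -/
instance {d : ℕ} {α : Type} [Enc α] : Enc (Fin d → α) :=
  ⟨fun x => Enc.enc (List.ofFn x), fun _ _ h => List.ofFn_injective (Enc.enc_injective h)⟩

namespace PolyTime

variable {α β γ δ : Type} [Enc α] [Enc β] [Enc γ] [Enc δ]

@[fun_prop]
theorem natAbs {a : γ → ℤ} (ha : PolyTime a) : PolyTime fun c => (a c).natAbs :=
  comp (g := Prod.snd) snd
    (congr_enc (f := fun c => (decide (a c < 0), (a c).natAbs)) ha fun _ => rfl)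

@[fun_prop]
theorem decide_neg {a : γ → ℤ} (ha : PolyTime a) : PolyTime fun c => decide (a c < 0) :=
  comp (g := Prod.fst) fst
    (congr_enc (f := fun c => (decide (a c < 0), (a c).natAbs)) ha fun _ => rfl)

@[fun_prop]
theorem intSubNat {a b : γ → ℕ} (ha : PolyTime a) (hb : PolyTime b) :
    PolyTime fun c => (a c : ℤ) - (b c : ℤ) := by
  refine congr_enc (g := fun c => (!decide (b c ≤ a c), (a c - b c) + (b c - a c)))
    (prodMk (not (decide_le hb ha)) (by fun_prop)) fun c => ?_
  refine congrArg (Enc.enc (α := Bool × ℕ)) (Prod.ext ?_ ?_)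
  · by_cases h : b c ≤ a c <;> simp [h]; omega
  · simp; omega

@[fun_prop]
theorem intAdd {a b : γ → ℤ} (ha : PolyTime a) (hb : PolyTime b) :
    PolyTime fun c => a c + b c := by
  have H : PolyTime fun c =>
      (((if a c < 0 then 0 else (a c).natAbs) + (if b c < 0 then 0 else (b c).natAbs) : ℕ) : ℤ) -
      (((if a c < 0 then (a c).natAbs else 0) +
        (if b c < 0 then (b c).natAbs else 0) : ℕ) : ℤ) := by
    fun_prop
  convert H using 2 with c
  split_ifs <;> omega

@[fun_prop]
theorem natCast {a : γ → ℕ} (ha : PolyTime a) : PolyTime fun c => (a c : ℤ) := by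
  simpa using ha.intSubNat (const 0)

@[fun_prop]
theorem listOfFn {d : ℕ} {f : γ → Fin d → α} (hf : PolyTime f) :
    PolyTime fun c => List.ofFn (f c) := congr_enc hf fun _ => rfl

theorem pi {d : ℕ} {f : γ → Fin d → α} (hf : ∀ i, PolyTime fun c => f c i) : PolyTime f := by
  suffices PolyTime fun c => List.ofFn (f c) from congr_enc this fun _ => rfl
  induction d with
  | zero => simpa using const []
  | succ d ih =>
    simp only [List.ofFn_succ]
    exact (hf 0).listCons (ih fun i => hf i.succ)

theorem proj [Inhabited α] {d : ℕ} {f : γ → Fin d → α} (hf : PolyTime f) (i : Fin d) :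
    PolyTime fun c => f c i := by
  simpa using hf.listOfFn.listGetD (const (i : ℕ)) (const default)

end PolyTime

end PolyTM

namespace Sandpile

namespace SandpileModel

variable {d : ℕ} (M : SandpileModel d)

/-! ### Sandpiles stabilize in polynomial time -/

theorem D_pos {v : Cell d} (hv : v ∈ M.N) : 0 < M.D v := (M.D_pos_iff v).2 hv

/-- A single direction does not span the lattice with positive coefficients, so there are at least
two neighbors. -/
theorem two_le_θ (hd : 0 < d) : 2 ≤ M.θ := by
  have h₀ : (0 : Cell d) ∈ spanPlus M.N := M.complete ▸ Set.mem_univ _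
  obtain ⟨k, hk, hs⟩ := h₀
  have h₁ : (Pi.single ⟨0, hd⟩ 1 : Cell d) ∈ spanPlus M.N := M.complete ▸ Set.mem_univ _
  have hcard : 2 ≤ M.N.card := by
    by_contra! h
    interval_cases h' : M.N.card
    · rw [Finset.card_eq_zero] at h'
      obtain ⟨l, -, hl⟩ := h₁
      have := congrFun hl ⟨0, hd⟩
      simp [h'] at this
    · obtain ⟨v, hv⟩ := Finset.card_eq_one.1 h'
      have hk' := hk v (by simp [hv])
      simp only [hv, Finset.sum_singleton] at hs
      rcases smul_eq_zero.1 hs.symm with h | h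
      · omega
      · exact M.zero_notMem (by simp [hv, h])
  calc 2 ≤ M.N.card := hcard
    _ = ∑ v ∈ M.N, 1 := by simp
    _ ≤ M.θ := Finset.sum_le_sum fun v hv => M.D_pos hv

variable {M}

theorem fires_eq_one {c : Config d} {x : Cell d} (h : M.θ ≤ c x) : M.fires c x = 1 := if_pos h

theorem fires_eq_zero {c : Config d} {x : Cell d} (h : c x < M.θ) : M.fires c x = 0 :=
  if_neg h.not_ge

theorem fires_le_one (c : Config d) (x : Cell d) : M.fires c x ≤ 1 := by
  unfold fires; split_ifs <;> simp

theorem θ_mul_fires_le (c : Config d) (x : Cell d) : M.θ * M.fires c x ≤ c x := by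
  unfold fires; split_ifs with h <;> simp [h]

theorem fires_le (hθ : 0 < M.θ) (c : Config d) (x : Cell d) : M.fires c x ≤ c x :=
  (Nat.le_mul_of_pos_left _ hθ).trans (θ_mul_fires_le c x)

theorem step_lt {c : Config d} (hc : ∀ x, c x < 2 * M.θ) (x : Cell d) :
    M.step c x < 2 * M.θ := by
  have h₁ : ∑ v ∈ M.N, M.D v * M.fires c (x - v) ≤ M.θ :=
    Finset.sum_le_sum fun v _ => by
      simpa using Nat.mul_le_mul_left (M.D v) (fires_le_one c (x - v))
  have h₂ := hc x
  unfold step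
  by_cases h : M.θ ≤ c x
  · rw [fires_eq_one h]; omega
  · rw [fires_eq_zero (not_le.1 h)]; omega

theorem iterate_step_lt {c : Config d} (hc : ∀ x, c x < 2 * M.θ) (t : ℕ) (x : Cell d) :
    (M.step^[t] c) x < 2 * M.θ := by
  induction t generalizing x with
  | zero => exact hc x
  | succ t ih => rw [Function.iterate_succ_apply']; exact step_lt ih x

theorem Stable.step_eq {c : Config d} (h : M.Stable c) : M.step c = c := by
  funext x
  simp [step, fun y => fires_eq_zero (h y)]

theorem Stable.iterate_step_eq {c : Config d} (h : M.Stable c) (t : ℕ) : M.step^[t] c = c :=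
  Function.iterate_fixed h.step_eq t

/-- A stable configuration never has an unstable cell. -/
theorem Stable.not_eventuallyUnstable {c : Config d} (h : M.Stable c) (x : Cell d) :
    ¬M.EventuallyUnstable c x := by
  rintro ⟨t, ht⟩
  rw [h.iterate_step_eq] at ht
  exact (h x).not_ge ht

theorem D_mul_fires_le_step (c : Config d) (x v : Cell d) (hv : v ∈ M.N) :
    M.D v * M.fires c (x - v) ≤ M.step c x :=
  (Finset.single_le_sum (f := fun v => M.D v * M.fires c (x - v)) (fun _ _ => Nat.zero_le _)
    hv).trans (Nat.le_add_left _ _)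

/-- A cell that fires sends a grain to each of its neighbors. -/
theorem step_pos_of_fires {c : Config d} {x v : Cell d} (hv : v ∈ M.N) (h : M.θ ≤ c x) :
    0 < M.step c (x + v) := by
  have := D_mul_fires_le_step c (x + v) v hv
  rw [add_sub_cancel_right, fires_eq_one h, mul_one] at this
  exact (M.D_pos hv).trans_le this

theorem le_step_of_lt {c : Config d} {x : Cell d} (h : c x < M.θ) : c x ≤ M.step c x := by
  simp [step, fires_eq_zero h]

/-- A grain can only be where there was a grain before, or next to a cell that fires. -/
theorem pos_of_step_pos {c : Config d} {x : Cell d} (h : 0 < M.step c x) :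
    0 < c x ∨ ∃ v ∈ M.N, M.θ ≤ c (x - v) := by
  by_contra! h'
  obtain ⟨h₁, h₂⟩ := h'
  refine h.ne' ?_
  rw [step, Nat.le_zero.1 h₁, Nat.zero_sub, zero_add]
  exact Finset.sum_eq_zero fun v hv => by rw [fires_eq_zero (h₂ v hv), mul_zero]

theorem finite_support_step {c : Config d} (hc : c.support.Finite) :
    (M.step c).support.Finite := by
  refine (hc.union (M.N.finite_toSet.image2 (fun v x => x + v) hc)).subset fun x hx => ?_
  by_cases hθ : M.θ = 0
  · have : M.N = ∅ := by
      by_contra! h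
      obtain ⟨v, hv⟩ := h
      have := Finset.sum_eq_zero_iff.1 hθ v hv
      exact (M.D_pos hv).ne' this
    left
    simpa [step, hθ, this] using hx
  · rcases pos_of_step_pos (Nat.pos_of_ne_zero hx) with h | ⟨v, hv, h⟩
    · exact Or.inl h.ne'
    · exact Or.inr ⟨v, hv, x - v, by simp; omega, by simp⟩

theorem finite_support_iterate {c : Config d} (hc : c.support.Finite) (t : ℕ) :
    (M.step^[t] c).support.Finite := by
  induction t with
  | zero => exact hc
  | succ t ih => rw [Function.iterate_succ_apply']; exact finite_support_step ih

/-- The sum of a weight function over all grains. -/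
noncomputable def weight (φ : Cell d → ℤ) (c : Config d) : ℤ := ∑ᶠ x, (c x : ℤ) * φ x

/-- Every toppling of a cell `x` changes the weight by `∑ v, D v * (φ (x + v) - φ x)`. -/
theorem weight_step (hθ : 0 < M.θ) (φ : Cell d → ℤ) {c : Config d} (hc : c.support.Finite) :
    weight φ (M.step c) = weight φ c +
      ∑ᶠ x, (M.fires c x : ℤ) * ∑ v ∈ M.N, (M.D v : ℤ) * (φ (x + v) - φ x) := by
  have hf : (fun x => (M.fires c x : ℤ)).support.Finite := hc.subset fun x hx => by
    have := fires_le hθ c x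
    simp at hx ⊢; omega
  have hfin (g : Cell d → ℤ) : (fun x => (M.fires c x : ℤ) * g x).support.Finite :=
    hf.subset (Function.support_mul_subset_left _ _)
  have h₁ (x : Cell d) : ((M.step c x : ℕ) : ℤ) * φ x = (c x : ℤ) * φ x +
      ((∑ v ∈ M.N, (M.D v : ℤ) * ((M.fires c (x - v) : ℤ) * φ x)) -
        (M.fires c x : ℤ) * (M.θ * φ x)) := by
    rw [step, Nat.cast_add, Nat.cast_sub (θ_mul_fires_le c x), Nat.cast_sum, add_mul, sub_mul,
      Finset.sum_mul]
    push_cast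
    simp only [mul_assoc]
    ring
  have h₂ (v : Cell d) : ∑ᶠ x, (M.fires c (x - v) : ℤ) * φ x =
      ∑ᶠ x, (M.fires c x : ℤ) * φ (x + v) := by
    rw [← finsum_comp_equiv (Equiv.addRight v)]
    simp
  have h₃ (x : Cell d) :
      (M.fires c x : ℤ) * ∑ v ∈ M.N, (M.D v : ℤ) * (φ (x + v) - φ x) =
        (∑ v ∈ M.N, (M.D v : ℤ) * ((M.fires c x : ℤ) * φ (x + v))) -
          (M.fires c x : ℤ) * (M.θ * φ x) := by
    simp only [θ, Nat.cast_sum, Finset.mul_sum, Finset.sum_mul, ← Finset.sum_sub_distrib]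
    exact Finset.sum_congr rfl fun v _ => by ring
  have hfin₁ (v : Cell d) : (fun x => (M.fires c (x - v) : ℤ) * φ x).support.Finite := by
    refine (hf.image (· + v)).subset fun x hx => ⟨x - v, ?_, by simp⟩
    exact left_ne_zero_of_mul hx
  have hfin₂ (v : Cell d) :
      (fun x => (M.D v : ℤ) * ((M.fires c (x - v) : ℤ) * φ x)).support.Finite :=
    (hfin₁ v).subset (Function.support_mul_subset_right _ _)
  have hfin₃ (v : Cell d) :
      (fun x => (M.D v : ℤ) * ((M.fires c x : ℤ) * φ (x + v))).support.Finite :=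
    (hfin fun x => φ (x + v)).subset (Function.support_mul_subset_right _ _)
  have hsum (g : Cell d → Cell d → ℤ) (hg : ∀ v, (g v).support.Finite) :
      (fun x => ∑ v ∈ M.N, g v x).support.Finite := by
    refine (M.N.finite_toSet.biUnion fun v _ => hg v).subset fun x hx => ?_
    obtain ⟨v, hv, h⟩ := Finset.exists_ne_zero_of_sum_ne_zero hx
    exact Set.mem_biUnion hv h
  have hc' : (fun x => (c x : ℤ) * φ x).support.Finite := hc.subset fun x hx => by
    have := left_ne_zero_of_mul hx
    simpa using this
  have hθ' : (fun x => (M.fires c x : ℤ) * (M.θ * φ x)).support.Finite := hfin _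
  unfold weight
  simp only [h₁, h₃]
  rw [finsum_add_distrib hc' (((hsum _ hfin₂).union hθ').subset (Function.support_sub _ _)),
    finsum_sub_distrib (hsum _ hfin₂) hθ', finsum_sub_distrib (hsum _ hfin₃) hθ',
    finsum_sum_comm _ _ fun v _ => hfin₂ v, finsum_sum_comm _ _ fun v _ => hfin₃ v]
  simp only [← mul_finsum, h₂]

/-- Toppling preserves the number of grains. -/
theorem weight_one_iterate (hθ : 0 < M.θ) {c : Config d} (hc : c.support.Finite) (t : ℕ) :
    weight (fun _ => 1) (M.step^[t] c) = weight (fun _ => 1) c := by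
  induction t with
  | zero => rfl
  | succ t ih =>
    rw [Function.iterate_succ_apply', weight_step hθ _ (finite_support_iterate hc t), ih]
    simp

theorem weight_eq_sum (φ : Cell d → ℤ) {c : Config d} {s : Finset (Cell d)}
    (h : ∀ x, c x ≠ 0 → x ∈ s) : weight φ c = ∑ x ∈ s, (c x : ℤ) * φ x :=
  finsum_eq_sum_of_support_subset _ fun x hx => h x (by
    have := left_ne_zero_of_mul hx
    simpa using this)

theorem card_support_le {c : Config d} (hc : c.support.Finite) :
    (hc.toFinset.card : ℤ) ≤ weight (fun _ => 1) c := by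
  rw [weight_eq_sum (s := hc.toFinset) _ fun x hx => by simpa using hx, Finset.card_eq_sum_ones,
    Nat.cast_sum]
  refine Finset.sum_le_sum fun x hx => ?_
  have : c x ≠ 0 := by simpa using hx
  simp; omega

/-- A weight function that is at most `B` on all grains has weight at most `B` times their
number. -/
theorem abs_weight_le {φ : Cell d → ℤ} {B : ℤ} {c : Config d} (hc : c.support.Finite)
    (h : ∀ x, c x ≠ 0 → |φ x| ≤ B) : |weight φ c| ≤ weight (fun _ => 1) c * B := by
  have hs (x) (hx : c x ≠ 0) : x ∈ hc.toFinset := by simpa using hx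
  rw [weight_eq_sum φ hs, weight_eq_sum _ hs, Finset.sum_mul]
  refine (Finset.abs_sum_le_sum_abs _ _).trans (Finset.sum_le_sum fun x hx => ?_)
  rw [abs_mul, mul_one, abs_of_nonneg (Int.natCast_nonneg _)]
  exact mul_le_mul_of_nonneg_left (h x (by simpa using hx)) (Int.natCast_nonneg _)

variable (M)

/-- There is a finite set of cells containing the origin such that whenever one of its cells fires,
a cell of the set receives a grain. -/
theorem exists_trap (hd : 0 < d) : ∃ P : Finset (Cell d), 0 ∈ P ∧
    ∀ p ∈ P, ∃ v ∈ M.N, p + v ∈ P := by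
  obtain ⟨k, hk, hs⟩ : (0 : Cell d) ∈ spanPlus M.N := M.complete ▸ Set.mem_univ _
  -- the partial sums of a closed walk with steps in the neighborhood
  let L : List (Cell d) := M.N.toList.flatMap fun v => List.replicate (k v) v
  have hL : ∀ v ∈ L, v ∈ M.N := fun v hv => by
    obtain ⟨w, hw, h⟩ := List.mem_flatMap.1 hv
    rw [List.eq_of_mem_replicate h]
    simpa using hw
  have hsum : L.sum = 0 := by
    have hL' : L = (M.N.toList.map fun v => List.replicate (k v) v).flatten := List.flatMap_def
    rw [hs, hL', List.sum_flatten, List.map_map, ← Finset.sum_map_toList]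
    simp [Function.comp_def]
  have hpos : 0 < L.length := by
    rw [List.length_pos_iff]
    intro h
    have hN : M.N = ∅ := by
      by_contra! hne
      obtain ⟨v, hv⟩ := hne
      have : v ∈ L := List.mem_flatMap.2 ⟨v, by simpa using hv, by simp [(hk v hv).ne']⟩
      simp [h] at this
    have := two_le_θ M hd
    simp [θ, hN] at this
  refine ⟨(Finset.range L.length).image fun i => (L.take i).sum,
    Finset.mem_image.2 ⟨0, by simpa using hpos, by simp⟩, fun p hp => ?_⟩
  obtain ⟨i, hi, rfl⟩ := Finset.mem_image.1 hp
  rw [Finset.mem_range] at hi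
  refine ⟨L[i], hL _ (List.getElem_mem hi), ?_⟩
  rw [← List.sum_take_succ L i hi]
  by_cases h : i + 1 < L.length
  · exact Finset.mem_image.2 ⟨i + 1, by simpa using h, rfl⟩
  · rw [List.take_of_length_le (by omega), hsum]
    exact Finset.mem_image.2 ⟨0, by simpa using hpos, by simp⟩

theorem exists_range : ∃ r : ℕ, ∀ v ∈ M.N, ∀ i, |v i| ≤ r := by
  refine ⟨∑ v ∈ M.N, ∑ i, (v i).natAbs, fun v hv i => ?_⟩
  have h₁ : (v i).natAbs ≤ ∑ i, (v i).natAbs :=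
    Finset.single_le_sum (f := fun i => (v i).natAbs) (fun _ _ => Nat.zero_le _) (Finset.mem_univ i)
  have h₂ : ∑ i, (v i).natAbs ≤ ∑ v ∈ M.N, ∑ i, (v i).natAbs :=
    Finset.single_le_sum (f := fun v : Cell d => ∑ i, (v i).natAbs) (fun _ _ => Nat.zero_le _) hv
  rw [Int.abs_eq_natAbs]
  exact_mod_cast h₁.trans h₂

/-- There is a weight function of at most quadratic growth that increases with every toppling: a
coordinate or its negative if the drift in its direction does not vanish, and the square of the
coordinate otherwise. -/
theorem exists_weight (hd : 0 < d) : ∃ φ : Cell d → ℤ,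
    (∀ x, 1 ≤ ∑ v ∈ M.N, (M.D v : ℤ) * (φ (x + v) - φ x)) ∧
    ∀ (x : Cell d) (B : ℕ), (∀ i, |x i| ≤ B) → |φ x| ≤ (B : ℤ) ^ 2 := by
  set i : Fin d := ⟨0, hd⟩
  set μ : ℤ := ∑ v ∈ M.N, (M.D v : ℤ) * v i with hμ
  have hle (a : ℤ) (B : ℕ) (h : |a| ≤ B) : |a| ≤ (B : ℤ) ^ 2 := by
    rcases Nat.eq_zero_or_pos B with rfl | hB
    · simpa using h
    · have : (1 : ℤ) ≤ B := by exact_mod_cast hB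
      nlinarith
  rcases lt_trichotomy μ 0 with h | h | h
  · refine ⟨fun x => -x i, fun x => ?_, fun x B hB => hle _ B (by simpa using hB i)⟩
    have : ∑ v ∈ M.N, (M.D v : ℤ) * (-(x + v) i - -x i) = -μ := by
      rw [hμ, ← Finset.sum_neg_distrib]
      exact Finset.sum_congr rfl fun v _ => by simp
    simp only [this]
    omega
  · refine ⟨fun x => x i ^ 2, fun x => ?_, fun x B hB => ?_⟩
    · have h₁ : ∑ v ∈ M.N, (M.D v : ℤ) * ((x + v) i ^ 2 - x i ^ 2) =
          2 * x i * μ + ∑ v ∈ M.N, (M.D v : ℤ) * v i ^ 2 := by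
        rw [hμ, Finset.mul_sum, ← Finset.sum_add_distrib]
        exact Finset.sum_congr rfl fun v _ => by simp only [Pi.add_apply]; ring
      obtain ⟨v, hv, hvi⟩ : ∃ v ∈ M.N, v i ≠ 0 := by
        by_contra! h'
        obtain ⟨k, -, hs⟩ : (Pi.single i 1 : Cell d) ∈ spanPlus M.N := M.complete ▸ Set.mem_univ _
        have := congrFun hs i
        simp only [Pi.single_eq_same, Finset.sum_apply, Pi.smul_apply] at this
        rw [Finset.sum_eq_zero fun v hv => by rw [h' v hv, smul_zero]] at this
        exact one_ne_zero this
      have h₂ : (M.D v : ℤ) * v i ^ 2 ≤ ∑ v ∈ M.N, (M.D v : ℤ) * v i ^ 2 :=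
        Finset.single_le_sum (f := fun v : Cell d => (M.D v : ℤ) * v i ^ 2)
          (fun _ _ => by positivity) hv
      have h₃ : (1 : ℤ) ≤ M.D v := by exact_mod_cast M.D_pos hv
      have h₄ : 0 < v i ^ 2 := by positivity
      simp only [h₁, h, mul_zero, zero_add]
      nlinarith
    · rw [abs_pow]
      exact pow_le_pow_left₀ (abs_nonneg _) (hB i) 2
  · refine ⟨fun x => x i, fun x => ?_, fun x B hB => hle _ B (hB i)⟩
    have : ∑ v ∈ M.N, (M.D v : ℤ) * ((x + v) i - x i) = μ :=
      Finset.sum_congr rfl fun v _ => by simp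
    simp only [this]
    omega

variable {M}

/-- The set of cells that have toppled before time `t`. -/
def toppled (M : SandpileModel d) (c : Config d) (t : ℕ) : Set (Cell d) :=
  {x | ∃ s < t, M.θ ≤ (M.step^[s] c) x}

theorem toppled_mono {c : Config d} {t t' : ℕ} (h : t ≤ t') : M.toppled c t ⊆ M.toppled c t' :=
  fun _ ⟨s, hs, hx⟩ => ⟨s, hs.trans_le h, hx⟩

/-- Near a cell that has toppled, there is a grain at all later times. -/
theorem exists_pos_of_mem_toppled {P : Finset (Cell d)} (h₀ : 0 ∈ P)
    (hP : ∀ p ∈ P, ∃ v ∈ M.N, p + v ∈ P) {c : Config d} {t : ℕ} {x : Cell d}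
    (hx : x ∈ M.toppled c t) : ∃ p ∈ P, 0 < (M.step^[t] c) (x + p) := by
  induction t with
  | zero => obtain ⟨s, hs, -⟩ := hx; omega
  | succ t ih =>
    have key : (∃ p ∈ P, M.θ ≤ (M.step^[t] c) (x + p)) →
        ∃ p ∈ P, 0 < (M.step^[t + 1] c) (x + p) := by
      rintro ⟨p, hp, h⟩
      obtain ⟨v, hv, hpv⟩ := hP p hp
      refine ⟨p + v, hpv, ?_⟩
      rw [Function.iterate_succ_apply', ← add_assoc]
      exact step_pos_of_fires hv h
    obtain ⟨s, hs, h⟩ := hx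
    rcases Nat.lt_succ_iff_lt_or_eq.1 hs with hs | rfl
    · obtain ⟨p, hp, h'⟩ := ih ⟨s, hs, h⟩
      by_cases hf : M.θ ≤ (M.step^[t] c) (x + p)
      · exact key ⟨p, hp, hf⟩
      · refine ⟨p, hp, ?_⟩
        rw [Function.iterate_succ_apply']
        exact h'.trans_le (le_step_of_lt (not_le.1 hf))
    · exact key ⟨0, h₀, by simpa using h⟩

/-- Each toppled cell keeps a grain within a translate of `P`, and each grain serves at most
`P.card` cells, so the number of toppled cells is bounded in terms of the number of grains. -/
theorem ncard_toppled_le (hθ : 0 < M.θ) {P : Finset (Cell d)} (h₀ : 0 ∈ P)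
    (hP : ∀ p ∈ P, ∃ v ∈ M.N, p + v ∈ P) {c : Config d} (hc : c.support.Finite) (t : ℕ) :
    (M.toppled c t).Finite ∧
      ((M.toppled c t).ncard : ℤ) ≤ weight (fun _ => 1) c * P.card := by
  have hs := finite_support_iterate (M := M) hc t
  have hsub : M.toppled c t ⊆ (hs.toFinset.image₂ (fun y p => y - p) P : Finset (Cell d)) := by
    intro x hx
    obtain ⟨p, hp, h⟩ := exists_pos_of_mem_toppled h₀ hP hx
    exact Finset.mem_image₂.2 ⟨x + p, by simpa using h.ne', p, hp, by simp⟩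
  refine ⟨(Finset.finite_toSet _).subset hsub, ?_⟩
  have h₁ := (Set.ncard_le_ncard hsub (Finset.finite_toSet _)).trans_eq (Set.ncard_coe_finset _)
  have h₂ := h₁.trans (Finset.card_image₂_le _ _ _)
  have h₃ := card_support_le hs
  rw [weight_one_iterate hθ hc] at h₃
  calc ((M.toppled c t).ncard : ℤ) ≤ hs.toFinset.card * P.card := by exact_mod_cast h₂
    _ ≤ _ := by gcongr

/-- A grain is where there was one initially, or next to a cell that has toppled. -/
theorem pos_of_iterate_pos {c : Config d} {t : ℕ} {x : Cell d} (h : 0 < (M.step^[t] c) x) :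
    0 < c x ∨ ∃ v ∈ M.N, x - v ∈ M.toppled c t := by
  induction t with
  | zero => exact Or.inl h
  | succ t ih =>
    rw [Function.iterate_succ_apply'] at h
    rcases pos_of_step_pos h with h | ⟨v, hv, h⟩
    · rcases ih h with h | ⟨v, hv, h⟩
      · exact Or.inl h
      · exact Or.inr ⟨v, hv, toppled_mono t.le_succ h⟩
    · exact Or.inr ⟨v, hv, t, t.lt_succ_self, h⟩

/-- The cells that topple are close to the initial hypercube: a cell outside of it that topples for
the first time has a neighbor that toppled before. -/
theorem toppled_subset_box (hθ : 0 < M.θ) {r n : ℕ} (hr : ∀ v ∈ M.N, ∀ i, |v i| ≤ r)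
    {c : Config d} (hc : ∀ x, x ∉ cube d 0 n → c x = 0)
    (hfin : ∀ t, (M.toppled c t).Finite) (t : ℕ) {x : Cell d} (hx : x ∈ M.toppled c t) (i : Fin d) :
    |x i| ≤ n + r * ((M.toppled c t).ncard : ℤ) := by
  induction t generalizing x with
  | zero => obtain ⟨s, hs, -⟩ := hx; omega
  | succ t ih =>
    have hmono := toppled_mono (M := M) (c := c) t.le_succ
    have hle := Set.ncard_le_ncard hmono (hfin _)
    have hle' : (r : ℤ) * (M.toppled c t).ncard ≤ r * (M.toppled c (t + 1)).ncard := by gcongr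
    by_cases hxt : x ∈ M.toppled c t
    · exact (ih hxt).trans (by linarith)
    · obtain ⟨s, hs, h⟩ := hx
      have hst : s = t := by
        by_contra hst
        exact hxt ⟨s, by omega, h⟩
      subst hst
      rcases pos_of_iterate_pos (hθ.trans_le h) with h' | ⟨v, hv, h'⟩
      · have hcube : x ∈ cube d 0 n := by
          by_contra hn
          exact h'.ne' (hc x hn)
        have := hcube i
        rw [abs_of_nonneg this.1]
        have : 0 ≤ (r : ℤ) * (M.toppled c (s + 1)).ncard := by positivity
        omega
      · have hlt : (M.toppled c s).ncard + 1 ≤ (M.toppled c (s + 1)).ncard :=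
          Set.ncard_lt_ncard ⟨hmono, fun hh => hxt (hh ⟨s, s.lt_succ_self, h⟩)⟩ (hfin _)
        have h₁ := ih h'
        have h₂ := hr v hv i
        have h₃ : |x i| ≤ |(x - v) i| + |v i| := by
          have := abs_add_le ((x - v) i) (v i)
          simpa using this
        have h₄ : (r : ℤ) * ((M.toppled c s).ncard + 1) ≤ r * (M.toppled c (s + 1)).ncard := by
          gcongr
          exact_mod_cast hlt
        linarith

/-- The total number of grains of an input configuration. -/
theorem weight_one_le {n : ℕ} {c : Config d} (hc : ∀ x, x ∉ cube d 0 n → c x = 0)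
    (hlt : ∀ x, c x < 2 * M.θ) : weight (fun _ => 1) c ≤ (2 * M.θ * n ^ d : ℕ) := by
  let s : Finset (Cell d) := Fintype.piFinset fun _ => Finset.Ico (0 : ℤ) n
  have hs (x) (hx : c x ≠ 0) : x ∈ s := by
    have : x ∈ cube d 0 n := by
      by_contra hn
      exact hx (hc x hn)
    refine Fintype.mem_piFinset.2 fun i => ?_
    simpa using this i
  rw [weight_eq_sum _ hs]
  have h₁ : ∑ x ∈ s, (c x : ℤ) * 1 ≤ ∑ x ∈ s, (2 * M.θ : ℤ) := Finset.sum_le_sum fun x _ => by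
    have := hlt x
    omega
  refine h₁.trans_eq ?_
  simp [s, Fintype.card_piFinset]
  ring

theorem finite_support_of_cube {n : ℕ} {c : Config d} (hc : ∀ x, x ∉ cube d 0 n → c x = 0) :
    c.support.Finite := by
  refine (Finset.finite_toSet (Fintype.piFinset fun _ : Fin d => Finset.Ico (0 : ℤ) n)).subset
    fun x hx => ?_
  have : x ∈ cube d 0 n := by
    by_contra hn
    exact hx (hc x hn)
  simpa [cube] using this

/-- A bound for the coordinates of the cells reached from a configuration on a hypercube of side
`n`, where `a` is the size of a trap and `r` the range of the neighborhood. -/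
def boxBound (M : SandpileModel d) (a r n : ℕ) : ℕ := n + r * (2 * M.θ * n ^ d * a) + r

/-- A bound for the stabilization time of a configuration on a hypercube of side `n`. -/
def timeBound (M : SandpileModel d) (a r n : ℕ) : ℕ :=
  2 * (2 * M.θ * n ^ d) * M.boxBound a r n ^ 2

/-- All grains stay in a box of polynomial size, and a stable configuration is reached after
polynomially many steps. -/
theorem exists_bounds (hd : 0 < d) (M : SandpileModel d) : ∃ a r : ℕ, ∀ (n : ℕ) (c : Config d),
    (∀ x, x ∉ cube d 0 n → c x = 0) → (∀ x, c x < 2 * M.θ) →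
      (∀ t x, (M.step^[t] c) x ≠ 0 → ∀ i, |x i| ≤ M.boxBound a r n) ∧
      M.Stable (M.step^[M.timeBound a r n] c) := by
  have hθ : 0 < M.θ := by have := two_le_θ M hd; omega
  obtain ⟨P, h₀, hP⟩ := exists_trap M hd
  obtain ⟨r, hr⟩ := exists_range M
  obtain ⟨φ, hφ, hφB⟩ := exists_weight M hd
  refine ⟨P.card, r, fun n c hc hlt => ?_⟩
  have hfin := finite_support_of_cube hc
  have hG := weight_one_le hc hlt
  -- the toppled cells are few, and they form a cluster around the initial hypercube
  have hbox (t : ℕ) (x : Cell d) (hx : (M.step^[t] c) x ≠ 0) (i : Fin d) :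
      |x i| ≤ M.boxBound P.card r n := by
    have hcard := (ncard_toppled_le hθ h₀ hP hfin t).2
    have hR : (r : ℤ) * (M.toppled c t).ncard ≤ r * ((2 * M.θ * n ^ d : ℕ) * P.card) := by
      gcongr
      exact hcard.trans (by gcongr)
    have hpos : 0 ≤ (r : ℤ) * (M.toppled c t).ncard := by positivity
    have hB : (M.boxBound P.card r n : ℤ) = n + r * ((2 * M.θ * n ^ d : ℕ) * P.card) + r := by
      unfold boxBound; push_cast; ring
    rcases pos_of_iterate_pos (Nat.pos_of_ne_zero hx) with h | ⟨v, hv, h⟩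
    · have hcube : x ∈ cube d 0 n := by
        by_contra hn
        exact h.ne' (hc x hn)
      have := hcube i
      rw [abs_of_nonneg this.1, hB]
      omega
    · have h₁ := toppled_subset_box hθ hr hc (fun t => (ncard_toppled_le hθ h₀ hP hfin t).1) t h i
      have h₂ := hr v hv i
      have h₃ : |x i| ≤ |(x - v) i| + |v i| := by
        have := abs_add_le ((x - v) i) (v i)
        simpa using this
      rw [hB]
      linarith
  refine ⟨hbox, ?_⟩
  set T := M.timeBound P.card r n
  -- while the configuration is unstable, the weight increases in every step
  have hgrow (t : ℕ) (ht : ∀ s < t, ¬M.Stable (M.step^[s] c)) :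
      weight φ c + t ≤ weight φ (M.step^[t] c) := by
    induction t with
    | zero => simp
    | succ t ih =>
      have h₁ := ih fun s hs => ht s (by omega)
      have hst := ht t (by omega)
      simp only [Stable, not_forall, not_lt] at hst
      obtain ⟨x, hx⟩ := hst
      have hft := finite_support_iterate (M := M) hfin t
      rw [Function.iterate_succ_apply', weight_step hθ _ hft]
      have h₂ : (1 : ℤ) ≤ ∑ᶠ x, (M.fires (M.step^[t] c) x : ℤ) *
          ∑ v ∈ M.N, (M.D v : ℤ) * (φ (x + v) - φ x) := by
        refine le_trans ?_ (single_le_finsum x (hft.subset fun y hy => ?_) fun y => ?_)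
        · rw [fires_eq_one hx]
          simpa using hφ x
        · have h₃ := left_ne_zero_of_mul hy
          have h₄ := fires_le hθ (M.step^[t] c) y
          simp at h₃ ⊢; omega
        · exact mul_nonneg (Int.natCast_nonneg _) (zero_le_one.trans (hφ y))
      push_cast
      linarith
  have habs (t : ℕ) : |weight φ (M.step^[t] c)| ≤
      (2 * M.θ * n ^ d : ℕ) * (M.boxBound P.card r n : ℤ) ^ 2 := by
    refine (abs_weight_le (finite_support_iterate hfin t) fun x hx =>
      hφB x _ (hbox t x hx)).trans ?_
    rw [weight_one_iterate hθ hfin]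
    gcongr
  -- the weight of a given number of grains in the box is bounded, so it cannot grow for longer
  by_contra hT
  have hunst : ∀ s < T + 1, ¬M.Stable (M.step^[s] c) := fun s hs h => hT (by
    have : T = (T - s) + s := by omega
    rw [this, Function.iterate_add_apply, h.iterate_step_eq]
    exact h)
  have h₁ := hgrow (T + 1) hunst
  have h₂ := abs_le.1 (habs 0)
  have h₃ := abs_le.1 (habs (T + 1))
  have h₄ : (T : ℤ) = 2 * ((2 * M.θ * n ^ d : ℕ) * (M.boxBound P.card r n : ℤ) ^ 2) := by
    simp only [T, timeBound]; push_cast; ring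
  simp only [Function.iterate_zero, id_eq] at h₂
  push_cast at h₁ h₂ h₃ h₄
  linarith [h₂.1, h₃.2]

end SandpileModel

end Sandpile

namespace PolyTM.PolyTime

variable {α β γ : Type} [Enc α] [Enc β] [Enc γ]

/-! ### Binary expansions, signed comparison, finite quantifiers -/

/-- The binary expansion, least significant bit first, of the successor. -/
def incr (l : List Bool) : List Bool :=
  (l.takeWhile fun b => b).map (fun _ => false) ++ true :: (l.dropWhile fun b => b).tail

theorem bits_succ (n : ℕ) : (n + 1).bits = incr n.bits := by
  induction n using Nat.strong_induction_on with
  | _ n ih =>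
    obtain ⟨k, rfl | rfl⟩ := n.even_or_odd'
    · rw [Nat.bit1_bits]
      rcases Nat.eq_zero_or_pos k with rfl | hk
      · simp [incr]
      · simp [incr, Nat.bit0_bits k hk.ne']
    · rw [show 2 * k + 1 + 1 = 2 * (k + 1) by ring, Nat.bit0_bits _ (Nat.succ_ne_zero k),
        Nat.bit1_bits, ih k (by omega)]
      simp [incr]

@[fun_prop]
theorem natBits {n : γ → ℕ} (hn : PolyTime n) : PolyTime fun c => (n c).bits := by
  have hincr : PolyTime incr :=
    ((listTakeWhile id id).listMap (const false)).listAppend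
      ((const true).listCons (listDropWhile id id).listTail)
  have key (i : ℕ) : incr^[i] [] = i.bits := by
    induction i with
    | zero => simp
    | succ i ih => rw [Function.iterate_succ_apply', ih, bits_succ]
  have hsz (i : ℕ) : size i.bits ≤ 4 * i + 1 := by
    have h₁ (l : List Bool) : size l ≤ 4 * l.length + 1 := by
      induction l with
      | nil => simp
      | cons b l ih =>
        have := size_bool_le b
        simp; omega
    have h₂ : i.bits.length ≤ i := by
      induction i with
      | zero => simp
      | succ i ih =>
        have h := congrArg List.length (i.bits.takeWhile_append_dropWhile (p := fun b => b))
        rw [List.length_append] at h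
        simp only [bits_succ, incr, List.length_append, List.length_map, List.length_cons,
          List.length_tail]
        omega
    have := h₁ i.bits
    omega
  have H := iterate (n := n) (s := fun _ => ([] : List Bool)) (f := fun _ => incr) hn (const _)
    (hincr.comp snd) ((PolyBounded.const 2).mul hn.1) fun c i hi => by
      have := hsz i
      rw [key, size_nat]
      omega
  simpa only [key] using H

@[fun_prop]
theorem intNeg {a : γ → ℤ} (ha : PolyTime a) : PolyTime fun c => -a c := by
  have H : PolyTime fun c => ((if a c < 0 then (a c).natAbs else 0 : ℕ) : ℤ) -
      ((if a c < 0 then 0 else (a c).natAbs : ℕ) : ℤ) := by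
    fun_prop
  convert H using 2 with c
  split_ifs <;> omega

@[fun_prop]
theorem decide_le_int {a b : γ → ℤ} (ha : PolyTime a) (hb : PolyTime b) :
    PolyTime fun c => decide (a c ≤ b c) := by
  have H : PolyTime fun c => !decide (b c + -a c < 0) := by fun_prop
  convert H using 2 with c
  rw [← decide_not, decide_eq_decide]
  omega

theorem decide_forall {d : ℕ} {p : γ → Fin d → Prop} [∀ c i, Decidable (p c i)]
    [∀ c, Decidable (∀ i, p c i)] (h : ∀ i, PolyTime fun c => decide (p c i)) :
    PolyTime fun c => decide (∀ i, p c i) := by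
  classical
  induction d with
  | zero => simpa using const true
  | succ d ih =>
    have H := (h 0).and (ih (p := fun c i => p c i.succ) fun i => h i.succ)
    convert H using 2 with c
    rw [← Bool.decide_and, decide_eq_decide]
    exact Fin.forall_fin_succ

theorem decide_imp {p q : γ → Prop} [∀ c, Decidable (p c)] [∀ c, Decidable (q c)]
    [∀ c, Decidable (p c → q c)] (hp : PolyTime fun c => decide (p c))
    (hq : PolyTime fun c => decide (q c)) : PolyTime fun c => decide (p c → q c) := by
  convert hp.not.or hq using 2 with c
  by_cases h : p c <;> simp [h]

open Classical in
@[fun_prop]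
theorem decide_toLex_le {d : ℕ} {f g : γ → Fin d → ℤ} (hf : PolyTime f) (hg : PolyTime g) :
    PolyTime fun c => decide (toLex (f c) ≤ toLex (g c)) := by
  -- the lexicographic order in terms of bounded quantifiers over the coordinates
  have key (y z : Fin d → ℤ) :
      toLex y ≤ toLex z ↔ ∀ i, (∀ j, j < i → y j = z j) → y i ≤ z i := by
    constructor
    · intro h i hi
      rcases h.eq_or_lt with h | ⟨k, hk, hlt⟩
      · rw [toLex_inj.1 h]
      · rcases lt_trichotomy i k with hik | rfl | hik
        · exact (hk i hik).le
        · exact hlt.le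
        · exact absurd (hi k hik) hlt.ne
    · intro h
      by_contra! hlt
      obtain ⟨k, hk, hlt⟩ := hlt
      exact (h k fun j hj => (hk j hj).symm).not_gt hlt
  simp only [key]
  exact decide_forall fun i => decide_imp
    (decide_forall fun j => decide_imp (const _) ((hf.proj j).decide_eq (hg.proj j)))
    ((hf.proj i).decide_le_int (hg.proj i))

@[fun_prop]
theorem finsetSum {ι : Type} {s : Finset ι} {f : ι → γ → ℕ} (h : ∀ i ∈ s, PolyTime (f i)) :
    PolyTime fun c => ∑ i ∈ s, f i c := by
  classical
  induction s using Finset.induction_on with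
  | empty => simpa using const 0
  | insert i s hi ih =>
    simp only [Finset.sum_insert hi]
    exact (h i (Finset.mem_insert_self _ _)).natAdd
      (ih fun j hj => h j (Finset.mem_insert_of_mem hj))

end PolyTM.PolyTime

namespace Sandpile

open PolyTM

/-! ### Strings over the alphabet of the instances -/

/-- The enumeration of the alphabet: the two bits, the separator, the cell contents. -/
def symbolEquiv (q : ℕ) : Symbol q ≃ Fin (q + 2 + 1) where
  toFun
    | .bit false => ⟨0, by omega⟩
    | .bit true => ⟨1, by omega⟩
    | .sep => ⟨2, by omega⟩
    | .grain g => ⟨g + 3, by omega⟩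
  invFun k := if (k : ℕ) = 0 then .bit false else if (k : ℕ) = 1 then .bit true else
    if h : (k : ℕ) ≤ 2 then .sep else .grain ⟨k - 3, by omega⟩
  left_inv
    | .bit false => by simp
    | .bit true => by simp
    | .sep => by simp
    | .grain g => by simp
  right_inv k := by
    ext
    simp only
    split_ifs <;> simp <;> omega

instance (q : ℕ) : DecidableEq (Symbol q) := (symbolEquiv q).decidableEq

/-- Symbols are encoded by their numbers in the alphabet. -/
instance (q : ℕ) : Enc (Symbol q) :=
  ⟨fun s => Enc.enc (symbolEquiv q s), Enc.enc_injective.comp (symbolEquiv q).injective⟩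

/-- Every function of a symbol takes polynomial time, since the alphabet is finite. -/
theorem polyTime_symbol {q : ℕ} {β : Type} [Enc β] (f : Symbol q → β) : PolyTime f := by
  have h : PolyTime (symbolEquiv q) := .of_enc_eq fun _ => rfl
  simpa using (PolyTime.of_fin fun k => f ((symbolEquiv q).symm k)).comp h

theorem polyTime_symbolEquiv_symm {q : ℕ} : PolyTime (symbolEquiv q).symm :=
  .of_fin _

theorem inP_of_polyTime {q : ℕ} {L : Set (List (Symbol q))} {f : List (Symbol q) → Bool}
    (hf : PolyTime f) (h : ∀ w, f w = true ↔ w ∈ L) : InP L := by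
  have H := PolyTime.nonempty_computable_bool (symbolEquiv q)
    (hf.comp (PolyTime.listMap (g := fun _ k => (symbolEquiv q).symm k) .id
      (polyTime_symbolEquiv_symm.comp .snd)))
  exact ⟨f, h, by simpa using H⟩

theorem polyTimeComputable_of_polyTime {q : ℕ} {f : List (Symbol q) → List (Symbol q)}
    (hf : PolyTime f) : PolyTimeComputable f := by
  have H := PolyTime.nonempty_computable_list (symbolEquiv q)
    (PolyTime.listMap (g := fun _ s => symbolEquiv q s)
      (hf.comp (PolyTime.listMap (g := fun _ k => (symbolEquiv q).symm k) .id
        (polyTime_symbolEquiv_symm.comp .snd)))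
      ((polyTime_symbol (symbolEquiv q)).comp .snd))
  simpa [PolyTimeComputable] using H

theorem polyTime_bit {q : ℕ} : PolyTime fun b : Bool => (Symbol.bit b : Symbol q) := by
  convert PolyTime.boolCond (c := fun b : Bool => b) .id (.const (Symbol.bit true : Symbol q))
    (.const (Symbol.bit false)) using 2 with b
  cases b <;> rfl

/-- The symbol of a cell content; the separator stands for numbers that are too large. -/
def grainSymbol (q k : ℕ) : Symbol q := if h : k < q then .grain ⟨k, h⟩ else .sep

@[fun_prop]
theorem polyTime_grainSymbol {γ : Type} [Enc γ] {q : ℕ} {k : γ → ℕ} (hk : PolyTime k) :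
    PolyTime fun c => grainSymbol q (k c) := by
  have : PolyTime (grainSymbol q) := .of_eventually_const q fun n hn => by
    simp [grainSymbol, hn]
  exact this.comp hk

theorem polyTime_encodeInt {q : ℕ} : PolyTime fun z : ℤ => (Symbol.sep : Symbol q) ::
    Symbol.bit (decide (z < 0)) :: z.natAbs.bits.map (fun b => (Symbol.bit b : Symbol q)) := by
  have h : PolyTime fun z : ℤ => z.natAbs.bits.map (fun b => (Symbol.bit b : Symbol q)) :=
    PolyTime.listMap (g := fun _ b => (Symbol.bit b : Symbol q)) (.natBits (.natAbs .id))
      (polyTime_bit.comp .snd)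
  have h' : PolyTime fun z : ℤ => (Symbol.bit (decide (z < 0)) : Symbol q) :=
    polyTime_bit.comp (PolyTime.decide_neg .id)
  exact (PolyTime.const _).listCons (h'.listCons h)

theorem polyTime_encodeCell {d q : ℕ} : PolyTime fun x : Cell d => encodeCell q x := by
  have h : PolyTime fun p : Cell d × ℤ => (Symbol.sep : Symbol q) ::
      Symbol.bit (decide (p.2 < 0)) :: p.2.natAbs.bits.map (fun b => (Symbol.bit b : Symbol q)) :=
    polyTime_encodeInt.comp .snd
  have H := PolyTime.listFlatMap (l := fun x : Cell d => List.ofFn x)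
    (g := fun _ z => (Symbol.sep : Symbol q) ::
      Symbol.bit (decide (z < 0)) :: z.natAbs.bits.map (fun b => (Symbol.bit b : Symbol q)))
    PolyTime.id.listOfFn h
  convert H using 2 with x
  rw [encodeCell, List.flatMap_def, List.map_ofFn]
  rfl

end Sandpile

namespace Sandpile

open PolyTM

variable {d : ℕ}

/-! ### Simulating a sandpile on a finite list of cells -/

/-- The configuration given by a list of cells with their contents; the first entry of a cell
counts, and the cells without an entry are empty. -/
def lookup (l : List (Cell d × ℕ)) : Config d := fun x =>
  l.foldr (fun p s => if p.1 = x then p.2 else s) 0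

@[simp] theorem lookup_nil (x : Cell d) : lookup [] x = 0 := rfl

theorem lookup_cons (p : Cell d × ℕ) (l : List (Cell d × ℕ)) (x : Cell d) :
    lookup (p :: l) x = if p.1 = x then p.2 else lookup l x := rfl

theorem lookup_map (cs : List (Cell d)) (g : Config d) (x : Cell d) :
    lookup (cs.map fun x => (x, g x)) x = if x ∈ cs then g x else 0 := by
  induction cs with
  | nil => simp
  | cons y cs ih =>
    rw [List.map_cons, lookup_cons, ih]
    by_cases h : y = x
    · simp [h]
    · simp [h, Ne.symm h]

theorem lookup_of_notMem {l : List (Cell d × ℕ)} {x : Cell d} (h : ∀ p ∈ l, p.1 ≠ x) :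
    lookup l x = 0 := by
  induction l with
  | nil => rfl
  | cons p l ih =>
    rw [lookup_cons, if_neg (h p (by simp)), ih fun p hp => h p (by simp [hp])]

theorem lookup_of_mem {l : List (Cell d × ℕ)} (hl : (l.map Prod.fst).Nodup) {p : Cell d × ℕ}
    (hp : p ∈ l) : lookup l p.1 = p.2 := by
  induction l with
  | nil => simp at hp
  | cons p' l ih =>
    rw [List.map_cons, List.nodup_cons] at hl
    rcases List.mem_cons.1 hp with rfl | hp
    · simp [lookup_cons]
    · rw [lookup_cons, if_neg, ih hl.2 hp]
      rintro h
      exact hl.1 (h ▸ List.mem_map_of_mem hp)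

variable {γ : Type} [Enc γ]

@[fun_prop]
theorem polyTime_lookup {l : γ → List (Cell d × ℕ)} {x : γ → Cell d} (hl : PolyTime l)
    (hx : PolyTime x) : PolyTime fun c => lookup (l c) (x c) := by
  refine PolyTime.foldr (s := fun _ => 0) (K := fun c => size (l c))
    (f := fun c p s => if p.1 = x c then p.2 else s) hl (.const 0) ?_ hl.1 fun c p hp t => ?_
  · exact .ite (.decide_eq (by fun_prop) (hx.comp .fst)) (by fun_prop) (by fun_prop)
  · have h₁ := size_le_of_mem hp
    rw [size_prod] at h₁
    split_ifs <;> omega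

namespace SandpileModel

variable (M : SandpileModel d)

@[fun_prop]
theorem polyTime_step {l : γ → List (Cell d × ℕ)} {x : γ → Cell d} (hl : PolyTime l)
    (hx : PolyTime x) : PolyTime fun c => M.step (lookup (l c)) (x c) := by
  have hsub (v : Cell d) : PolyTime fun c => x c - v := .pi fun i => by
    simpa [sub_eq_add_neg] using (hx.proj i).intAdd (.const (-v i))
  have hfires {y : γ → Cell d} (hy : PolyTime y) : PolyTime fun c => M.fires (lookup (l c)) (y c) :=
    .ite (.decide_le (.const _) (by fun_prop)) (.const 1) (.const 0)
  exact ((polyTime_lookup hl hx).natSub (.natMul (.const _) (hfires hx))).natAdd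
    (.finsetSum fun v _ => .natMul (.const _) (hfires (hsub v)))

/-- One step of the sandpile on the cells `cs`. The contents are capped at `2 * θ`, a value that
legal configurations stay below, so that iterating this function keeps all sizes bounded. -/
def stepList (cs : List (Cell d)) (l : List (Cell d × ℕ)) : List (Cell d × ℕ) :=
  cs.map fun x => (x, min (2 * M.θ) (M.step (lookup l) x))

theorem size_stepList_le (cs : List (Cell d)) (l : List (Cell d × ℕ)) :
    size (M.stepList cs l) ≤ size cs * (4 * M.θ + 4) := by
  induction cs with
  | nil => simp [stepList]
  | cons x cs ih =>
    rw [stepList] at ih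
    have h : min (2 * M.θ) (M.step (lookup l) x) ≤ 2 * M.θ := min_le_left _ _
    simp only [stepList, List.map_cons, size_cons, size_mk, size_nat]
    nlinarith [size_pos x]

/-- `t` steps of the sandpile on the cells `cs`. -/
def simulate (cs : List (Cell d)) (t : ℕ) (l : List (Cell d × ℕ)) : List (Cell d × ℕ) :=
  (M.stepList cs)^[t] l

@[fun_prop]
theorem polyTime_simulate {cs : γ → List (Cell d)} {t : γ → ℕ} {l : γ → List (Cell d × ℕ)}
    (hcs : PolyTime cs) (ht : PolyTime t) (hl : PolyTime l) :
    PolyTime fun c => M.simulate (cs c) (t c) (l c) := by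
  have hstep : PolyTime fun p : γ × List (Cell d × ℕ) => M.stepList (cs p.1) p.2 := by
    have hmin : PolyTime fun n => min (2 * M.θ) n := .of_eventually_const (2 * M.θ) fun n hn => by
      simp [hn]
    refine PolyTime.listMap (l := fun p : γ × List (Cell d × ℕ) => cs p.1)
      (g := fun p x => (x, min (2 * M.θ) (M.step (lookup p.2) x))) (hcs.comp .fst) ?_
    exact .prodMk .snd (hmin.comp (polyTime_step M (by fun_prop) (by fun_prop)))
  refine PolyTime.iterate (f := fun c => M.stepList (cs c))
    (B := fun c => size (l c) + size (cs c) * (4 * M.θ + 4)) ht hl hstep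
    (hl.1.add (hcs.1.mul (.const _))) fun c i _ => ?_
  cases i with
  | zero => simp
  | succ i =>
    rw [Function.iterate_succ_apply']
    exact (size_stepList_le M _ _).trans (by omega)

/-- The simulation is exact if the list `cs` contains all cells that ever hold a grain. -/
theorem lookup_simulate {cs : List (Cell d)} {l : List (Cell d × ℕ)} {c : Config d}
    (hl : lookup l = c) (hlt : ∀ x, c x < 2 * M.θ)
    (hcs : ∀ t x, (M.step^[t] c) x ≠ 0 → x ∈ cs) (t : ℕ) :
    lookup (M.simulate cs t l) = M.step^[t] c := by
  induction t with
  | zero => exact hl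
  | succ t ih =>
    rw [simulate] at ih ⊢
    rw [Function.iterate_succ_apply', stepList, ih, Function.iterate_succ_apply']
    funext x
    rw [lookup_map]
    have h := iterate_step_lt hlt (t + 1) x
    have h' := hcs (t + 1) x
    rw [Function.iterate_succ_apply'] at h h'
    split_ifs with hx
    · exact min_eq_right h.le
    · by_contra h₀
      exact hx (h' (Ne.symm h₀))

end SandpileModel

/-! ### The cells of a hypercube -/

theorem cubeCell_mem {a : ℤ} {n : ℕ} (hn : 0 < n) (k : ℕ) : cubeCell d a n k ∈ cube d a n := by
  intro i
  have := Nat.mod_lt (k / n ^ (d - 1 - (i : ℕ))) hn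
  simp only [cubeCell]
  omega

/-- The coordinates of `cubeCell` as the digits of `k`, read in reverse. -/
theorem cubeCell_eq (a : ℤ) {n k : ℕ} (hk : k < n ^ d) :
    cubeCell d a n k = fun i => a + ((finFunctionFinEquiv.symm ⟨k, hk⟩ i.rev : Fin n) : ℕ) := by
  funext i
  simp only [cubeCell, finFunctionFinEquiv_symm_apply_val, Fin.val_rev]
  rw [show d - 1 - (i : ℕ) = d - (i + 1) by omega]

theorem cubeCell_injOn (a : ℤ) (n : ℕ) : Set.InjOn (cubeCell d a n) {k | k < n ^ d} := by
  intro k hk k' hk' h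
  rw [cubeCell_eq a hk, cubeCell_eq a hk'] at h
  have : finFunctionFinEquiv.symm ⟨k, hk⟩ = finFunctionFinEquiv.symm ⟨k', hk'⟩ := by
    funext i
    have := congrFun h i.rev
    simp only [Fin.rev_rev] at this
    ext
    omega
  simpa using this

theorem exists_cubeCell_eq {a : ℤ} {n : ℕ} {x : Cell d} (hx : x ∈ cube d a n) :
    ∃ k < n ^ d, cubeCell d a n k = x := by
  let f : Fin d → Fin n := fun i => ⟨(x i.rev - a).toNat, by have := hx i.rev; omega⟩
  refine ⟨finFunctionFinEquiv f, Fin.is_lt _, ?_⟩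
  rw [cubeCell_eq a (Fin.is_lt _), Fin.eta, Equiv.symm_apply_apply]
  funext i
  have := hx i
  simp only [f, Fin.rev_rev]
  omega

/-- The cells of a hypercube in lexicographic order. -/
def cells (d : ℕ) (a : ℤ) (n : ℕ) : List (Cell d) := (List.range (n ^ d)).map (cubeCell d a n)

theorem mem_cells {a : ℤ} {n : ℕ} (hn : 0 < n) {x : Cell d} :
    x ∈ cells d a n ↔ x ∈ cube d a n := by
  simp only [cells, List.mem_map, List.mem_range]
  exact ⟨fun ⟨k, _, h⟩ => h ▸ cubeCell_mem hn k, exists_cubeCell_eq⟩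

@[fun_prop]
theorem polyTime_cubeCell {a : γ → ℤ} {n k : γ → ℕ} (ha : PolyTime a) (hn : PolyTime n)
    (hk : PolyTime k) : PolyTime fun c => cubeCell d (a c) (n c) (k c) :=
  .pi fun i => by
    simp only [cubeCell]
    fun_prop

@[fun_prop]
theorem polyTime_cells {a : γ → ℤ} {n : γ → ℕ} (ha : PolyTime a) (hn : PolyTime n) :
    PolyTime fun c => cells d (a c) (n c) := by
  unfold cells
  fun_prop

end Sandpile

namespace Sandpile

open PolyTM

variable {d : ℕ} {γ : Type} [Enc γ]

@[fun_prop]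
theorem polyTime_encodeCell_comp {q : ℕ} {x : γ → Cell d} (hx : PolyTime x) :
    PolyTime fun c => encodeCell q (x c) := polyTime_encodeCell.comp hx

/-! ### Reading the input -/

/-- The symbol is a cell content. -/
def Symbol.isGrain {q : ℕ} : Symbol q → Bool
  | .grain _ => true
  | _ => false

/-- The number of grains that a symbol stands for. -/
def Symbol.grainVal {q : ℕ} : Symbol q → ℕ
  | .grain g => g
  | _ => 0

/-- The symbol is the unary digit. -/
def Symbol.isUnary {q : ℕ} (s : Symbol q) : Bool := decide (s = .bit true)

section Parse

variable {q : ℕ}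

/-- The side of the hypercube, read off from a code. -/
def side (w : List (Symbol q)) : ℕ := (w.takeWhile Symbol.isUnary).length

/-- The cell contents in a code. -/
def grains (w : List (Symbol q)) : List (Symbol q) :=
  (w.dropWhile Symbol.isUnary).tail.takeWhile Symbol.isGrain

/-- The part of a code that follows the cell contents. -/
def rest (w : List (Symbol q)) : List (Symbol q) :=
  (w.dropWhile Symbol.isUnary).tail.dropWhile Symbol.isGrain

/-- The string starts with the code of a configuration. -/
def valid (d : ℕ) (w : List (Symbol q)) : Bool :=
  decide (1 ≤ side w) && decide ((w.dropWhile Symbol.isUnary).headD (.bit true) = .sep) &&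
    decide ((grains w).length = side w ^ d)

/-- The configuration in a code, as a list of cells with their contents. -/
def initial (d : ℕ) (w : List (Symbol q)) : List (Cell d × ℕ) :=
  (List.range (side w ^ d)).map fun k =>
    (cubeCell d 0 (side w) k, ((grains w).getD k .sep).grainVal)

@[fun_prop]
theorem polyTime_side : PolyTime (side (q := q)) :=
  .listLength (.listTakeWhile .id (polyTime_symbol _))

@[fun_prop]
theorem polyTime_grains : PolyTime (grains (q := q)) :=
  .listTakeWhile (.listTail (.listDropWhile .id (polyTime_symbol _))) (polyTime_symbol _)

@[fun_prop]
theorem polyTime_rest : PolyTime (rest (q := q)) :=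
  .listDropWhile (.listTail (.listDropWhile .id (polyTime_symbol _))) (polyTime_symbol _)

@[fun_prop]
theorem polyTime_valid : PolyTime (valid (q := q) d) := by
  have h : PolyTime fun w : List (Symbol q) => (w.dropWhile Symbol.isUnary).headD (.bit true) :=
    .listHeadD (.listDropWhile .id (polyTime_symbol _)) (.const _)
  exact .and (.and (.decide_le (.const _) polyTime_side) (.decide_eq h (.const _)))
    (.decide_eq (.listLength polyTime_grains) (.natPow polyTime_side d))

@[fun_prop]
theorem polyTime_initial : PolyTime (initial (q := q) d) := by
  refine PolyTime.listMap (l := fun w : List (Symbol q) => List.range (side w ^ d))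
    (g := fun w k => (cubeCell d 0 (side w) k, ((grains w).getD k .sep).grainVal))
    (.listRange (.natPow polyTime_side d)) (.prodMk ?_ ?_)
  · exact polyTime_cubeCell (.const _) (polyTime_side.comp .fst) .snd
  · exact (polyTime_symbol Symbol.grainVal).comp
      (.listGetD (polyTime_grains.comp .fst) .snd (.const _))

theorem lookup_initial_of_notMem {w : List (Symbol q)} (hw : 0 < side w) {x : Cell d}
    (hx : x ∉ cube d 0 (side w)) : lookup (initial d w) x = 0 := by
  refine lookup_of_notMem fun p hp => ?_
  simp only [initial, List.mem_map] at hp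
  obtain ⟨k, _, rfl⟩ := hp
  rintro rfl
  exact hx (cubeCell_mem hw k)

theorem lookup_initial {w : List (Symbol q)} {k : ℕ} (hk : k < side w ^ d) :
    lookup (initial d w) (cubeCell d 0 (side w) k) = ((grains w).getD k .sep).grainVal := by
  refine lookup_of_mem (p := (cubeCell d 0 (side w) k, ((grains w).getD k .sep).grainVal)) ?_
    (List.mem_map.2 ⟨k, List.mem_range.2 hk, rfl⟩)
  rw [initial, List.map_map]
  refine List.Nodup.map_on (fun i hi j hj h => ?_) List.nodup_range
  exact cubeCell_injOn 0 (side w) (List.mem_range.1 hi) (List.mem_range.1 hj) h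

/-- `EncodesConfig` with the coercion of the list of cell contents written as a map. -/
theorem encodesConfig_iff {a : ℤ} {n : ℕ} {c : Config d} {w : List (Symbol q)} :
    EncodesConfig q a n c w ↔ (∀ x, x ∉ cube d a n → c x = 0) ∧ ∃ u : List (Fin q),
      u.map Fin.val = (List.range (n ^ d)).map (fun k => c (cubeCell d a n k)) ∧
      w = List.replicate n (Symbol.bit true) ++ Symbol.sep :: u.map Symbol.grain := by
  have h (u : List (Fin q)) : (u >>= fun a => pure (a : ℕ)) = u.map Fin.val := by
    simp [List.map_eq_flatMap]
  simp only [EncodesConfig, h, List.map_id']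

theorem takeWhile_isUnary (w : List (Symbol q)) :
    w.takeWhile Symbol.isUnary = List.replicate (side w) (.bit true) :=
  List.eq_replicate_iff.2 ⟨rfl, fun s hs => by
    simpa [Symbol.isUnary] using List.mem_takeWhile_imp hs⟩

/-- A string that passes the test `valid` starts with the code of the configuration that is read off
from it. -/
theorem encodesConfig_of_valid {w : List (Symbol q)} (h : valid d w = true) :
    0 < side w ∧ ∃ wc, EncodesConfig q 0 (side w) (lookup (initial d w)) wc ∧ w = wc ++ rest w := by
  simp only [valid, Bool.and_eq_true, decide_eq_true_eq] at h
  obtain ⟨⟨h₁, h₂⟩, h₃⟩ := h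
  refine ⟨h₁, List.replicate (side w) (.bit true) ++ .sep :: grains w,
    encodesConfig_iff.2 ⟨fun x hx => lookup_initial_of_notMem h₁ hx, ?_⟩, ?_⟩
  · have hu : grains w ∈ Set.range (List.map (Symbol.grain (q := q))) := by
      have h (s : Symbol q) (hs : s ∈ grains w) : s ∈ Set.range Symbol.grain := by
        have := List.mem_takeWhile_imp hs
        cases s with
        | grain g => exact ⟨g, rfl⟩
        | _ => simp [Symbol.isGrain] at this
      rw [Set.range_list_map]
      exact h
    obtain ⟨u, hu⟩ := hu
    refine ⟨u, List.ext_getElem ?_ fun k hk hk' => ?_, by rw [hu]⟩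
    · simp [← h₃, ← hu]
    · simp only [List.length_map, List.length_range] at hk hk'
      simp [lookup_initial hk', ← hu, List.getElem?_eq_getElem hk, Symbol.grainVal]
  · have h₄ : w.dropWhile Symbol.isUnary = .sep :: (w.dropWhile Symbol.isUnary).tail := by
      cases h : w.dropWhile Symbol.isUnary <;> simp_all
    rw [List.append_assoc, List.cons_append, grains, rest, List.takeWhile_append_dropWhile, ← h₄,
      ← takeWhile_isUnary, List.takeWhile_append_dropWhile]

/-- The code of a configuration can be recovered from any string that continues it with a
separator. -/
theorem EncodesConfig.parse {n : ℕ} (hn : 0 < n) {c : Config d} {wc s : List (Symbol q)}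
    (h : EncodesConfig q 0 n c wc) (hs : ∀ a ∈ s.head?, a = .sep) :
    valid d (wc ++ s) = true ∧ side (wc ++ s) = n ∧ lookup (initial d (wc ++ s)) = c ∧
      rest (wc ++ s) = s := by
  obtain ⟨h₀, u, hu, rfl⟩ := encodesConfig_iff.1 h
  set w := List.replicate n (Symbol.bit true) ++ Symbol.sep :: u.map Symbol.grain ++ s with hw
  have e : w = List.replicate n (Symbol.bit true) ++ Symbol.sep :: (u.map Symbol.grain ++ s) := by
    simp [hw]
  have hT : ∀ a ∈ List.replicate n (Symbol.bit true : Symbol q), a.isUnary = true := fun a ha => by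
    simp [List.eq_of_mem_replicate ha, Symbol.isUnary]
  have hG : ∀ a ∈ u.map Symbol.grain, a.isGrain = true := fun a ha => by
    obtain ⟨g, _, rfl⟩ := List.mem_map.1 ha
    rfl
  have hdrop : w.dropWhile Symbol.isUnary = .sep :: (u.map Symbol.grain ++ s) := by
    rw [e, List.dropWhile_append_of_pos hT]
    simp [Symbol.isUnary]
  have hside : side w = n := by
    rw [side, e, List.takeWhile_append_of_pos hT]
    simp [Symbol.isUnary]
  have hgrains : grains w = u.map Symbol.grain := by
    rw [grains, hdrop, List.tail_cons, List.takeWhile_append_of_pos hG]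
    cases s with
    | nil => simp
    | cons a s => simp [hs a (by simp), Symbol.isGrain]
  have hrest : rest w = s := by
    rw [rest, hdrop, List.tail_cons, List.dropWhile_append_of_pos hG]
    cases s with
    | nil => simp
    | cons a s => simp [hs a (by simp), Symbol.isGrain]
  have hlen : u.length = n ^ d := by simpa using congrArg List.length hu
  refine ⟨?_, hside, ?_, hrest⟩
  · simp [valid, hside, hdrop, hgrains, hlen]
    omega
  · funext x
    by_cases hx : x ∈ cube d 0 n
    · obtain ⟨k, hk, rfl⟩ := exists_cubeCell_eq hx
      have hk' : k < u.length := by omega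
      have := congrArg (fun l => l[k]?) hu
      simp [hk, hk'] at this
      have h := lookup_initial (d := d) (w := w) (k := k) (by rwa [hside])
      rw [hside] at h
      rw [h, hgrains, ← this]
      simp [hk', Symbol.grainVal]
    · rw [h₀ x hx, lookup_initial_of_notMem (by omega) (by rwa [hside])]

/-- Splitting a string into the code of a configuration and a remainder that does not start with a
cell content can be done in only one way. -/
theorem exists_code_iff {Q : ℕ → Config d → List (Symbol q) → Prop}
    (hQ : ∀ n c s, Q n c s → ∀ a ∈ s.head?, a = .sep) (w : List (Symbol q)) :
    (∃ n c wc s, 0 < n ∧ EncodesConfig q 0 n c wc ∧ w = wc ++ s ∧ Q n c s) ↔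
      valid d w = true ∧ Q (side w) (lookup (initial d w)) (rest w) := by
  constructor
  · rintro ⟨n, c, wc, s, hn, h, rfl, hs⟩
    obtain ⟨h₁, h₂, h₃, h₄⟩ := h.parse hn (hQ n c s hs)
    exact ⟨h₁, by rwa [h₂, h₃, h₄]⟩
  · rintro ⟨hv, hq⟩
    obtain ⟨h₁, wc, h₂, h₃⟩ := encodesConfig_of_valid hv
    exact ⟨_, _, wc, _, h₁, h₂, h₃, hq⟩

theorem EncodesConfig.lt {a : ℤ} {n : ℕ} (hq : 0 < q) {c : Config d} {w : List (Symbol q)}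
    (h : EncodesConfig q a n c w) (x : Cell d) : c x < q := by
  obtain ⟨h₀, u, hu, -⟩ := encodesConfig_iff.1 h
  by_cases hx : x ∈ cube d a n
  · obtain ⟨k, hk, rfl⟩ := exists_cubeCell_eq hx
    have : c (cubeCell d a n k) ∈ u.map Fin.val := by
      rw [hu]
      exact List.mem_map.2 ⟨k, List.mem_range.2 hk, rfl⟩
    obtain ⟨g, _, hg⟩ := List.mem_map.1 this
    omega
  · rwa [h₀ x hx]

theorem head_encodeCell_append (hd : 0 < d) (x : Cell d) (s : List (Symbol q)) :
    ∀ a ∈ (encodeCell q x ++ s).head?, a = .sep := by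
  obtain ⟨d, rfl⟩ := Nat.exists_eq_succ_of_ne_zero hd.ne'
  simp [encodeCell, List.ofFn_succ]

end Parse

namespace SandpileModel

variable (M : SandpileModel d)

/-! ### Deciding the prediction problems -/

/-- The evolution of the configuration given by the list `l`, cut off in space and time by the
bounds with parameters `a` and `r`, makes some cell `x` unstable such that `s` is the code of `x`
followed by `e`. -/
def predict (a r n : ℕ) (l : List (Cell d × ℕ)) (s e : List (Symbol (2 * M.θ))) : Bool :=
  (List.range (M.timeBound a r n + 1)).any fun t =>
    (cells d (-(M.boxBound a r n : ℤ)) (2 * M.boxBound a r n + 1)).any fun x =>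
      decide (M.θ ≤ lookup (M.simulate
        (cells d (-(M.boxBound a r n : ℤ)) (2 * M.boxBound a r n + 1)) t l) x) &&
      decide (s = encodeCell (2 * M.θ) x ++ e)

@[fun_prop]
theorem polyTime_boxBound (a r : ℕ) {n : γ → ℕ} (hn : PolyTime n) :
    PolyTime fun c => M.boxBound a r (n c) := by
  unfold boxBound
  fun_prop

@[fun_prop]
theorem polyTime_timeBound (a r : ℕ) {n : γ → ℕ} (hn : PolyTime n) :
    PolyTime fun c => M.timeBound a r (n c) := by
  unfold timeBound
  fun_prop

@[fun_prop]
theorem polyTime_predict (a r : ℕ) {n : γ → ℕ} {l : γ → List (Cell d × ℕ)}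
    {s e : γ → List (Symbol (2 * M.θ))} (hn : PolyTime n) (hl : PolyTime l) (hs : PolyTime s)
    (he : PolyTime e) : PolyTime fun c => M.predict a r (n c) (l c) (s c) (e c) := by
  have hcs {δ : Type} [Enc δ] {n : δ → ℕ} (hn : PolyTime n) : PolyTime fun c =>
      cells d (-(M.boxBound a r (n c) : ℤ)) (2 * M.boxBound a r (n c) + 1) := by fun_prop
  refine PolyTime.listAny (by fun_prop) (PolyTime.listAny (hcs (by fun_prop)) (.and ?_ ?_))
  · exact .decide_le (.const _) (polyTime_lookup (polyTime_simulate M (hcs (by fun_prop))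
      (by fun_prop) (by fun_prop)) (by fun_prop))
  · exact .decide_eq (by fun_prop) (by fun_prop)

variable {M}

/-- `predict` is exact under the bounds of `exists_bounds`: an instability occurs before the
stabilization time and inside the box. -/
theorem predict_iff {a r n : ℕ} {c : Config d} {l : List (Cell d × ℕ)} (hl : lookup l = c)
    (hlt : ∀ x, c x < 2 * M.θ) (hθ : 0 < M.θ)
    (hbox : ∀ t x, (M.step^[t] c) x ≠ 0 → ∀ i, |x i| ≤ M.boxBound a r n)
    (hT : M.Stable (M.step^[M.timeBound a r n] c)) (s e : List (Symbol (2 * M.θ))) :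
    M.predict a r n l s e = true ↔
      ∃ x, M.EventuallyUnstable c x ∧ s = encodeCell (2 * M.θ) x ++ e := by
  have hmem (t : ℕ) (x : Cell d) (hx : (M.step^[t] c) x ≠ 0) :
      x ∈ cells d (-(M.boxBound a r n : ℤ)) (2 * M.boxBound a r n + 1) := by
    refine (mem_cells (by omega)).2 fun i => ?_
    have := abs_le.1 (hbox t x hx i)
    omega
  simp only [predict, List.any_eq_true, Bool.and_eq_true, decide_eq_true_eq,
    lookup_simulate M hl hlt hmem, List.mem_range]
  constructor
  · rintro ⟨t, _, x, _, h, h'⟩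
    exact ⟨x, ⟨t, h⟩, h'⟩
  · rintro ⟨x, ⟨t, h⟩, h'⟩
    refine ⟨t, ?_, x, hmem t x (by omega), h, h'⟩
    by_contra! hlt
    obtain ⟨k, rfl⟩ := Nat.exists_eq_add_of_le hlt
    rw [show M.timeBound a r n + 1 + k = (k + 1) + M.timeBound a r n by omega,
      Function.iterate_add_apply, hT.iterate_step_eq] at h
    exact absurd (hT x) (not_lt.2 h)

end SandpileModel

end Sandpile

namespace Sandpile

open PolyTM

variable {d : ℕ} {γ : Type} [Enc γ]

namespace SandpileModel

variable {M : SandpileModel d}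

theorem inP_PRED (hd : 0 < d) : InP M.PRED := by
  obtain ⟨a, r, hb⟩ := exists_bounds hd M
  have hθ := two_le_θ M hd
  refine inP_of_polyTime (f := fun w => valid d w &&
    M.predict a r (side w) (initial d w) (rest w) []) ?_ fun w => ?_
  · exact .and polyTime_valid (polyTime_predict M a r polyTime_side polyTime_initial polyTime_rest
      (.const _))
  · have key := exists_code_iff (d := d) (q := 2 * M.θ) (Q := fun _ c s => ∃ x,
      M.EventuallyUnstable c x ∧ s = encodeCell (2 * M.θ) x ++ []) (by
        rintro n c s ⟨x, _, rfl⟩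
        exact head_encodeCell_append hd x []) w
    rw [Bool.and_eq_true]
    refine Iff.trans (and_congr_right fun hv => ?_) (key.symm.trans
      ⟨fun ⟨n, c, wc, s, hn, hc, hw, x, hx, hs⟩ =>
        ⟨n, c, x, wc, ⟨hn, hc⟩, by rw [hw, hs, List.append_nil], hx⟩,
      fun ⟨n, c, x, wc, ⟨hn, hc⟩, hw, hx⟩ =>
        ⟨n, c, wc, encodeCell (2 * M.θ) x, hn, hc, hw, x, hx, by simp⟩⟩)
    obtain ⟨-, wc, hwc, -⟩ := encodesConfig_of_valid hv
    have hlt := hwc.lt (by omega)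
    obtain ⟨h₁, h₂⟩ := hb _ _ hwc.1 hlt
    exact predict_iff rfl hlt (by omega) h₁ h₂ _ _

/-- The common form of the stable prediction problems: a grain is added on a cell `y` that is
related to the configuration by `R`, and the string `E y` closes the input. -/
def addition (M : SandpileModel d) (R : ℕ → Config d → Cell d → Prop)
    (E : Cell d → List (Symbol (2 * M.θ))) : Set (List (Symbol (2 * M.θ))) :=
  {w | ∃ (n : ℕ) (c : Config d) (x y : Cell d) (wc : List (Symbol (2 * M.θ))),
    M.EncodesInput n c wc ∧ M.Stable c ∧ R n c y ∧
    w = wc ++ (encodeCell (2 * M.θ) x ++ E y) ∧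
    M.EventuallyUnstable (c + Pi.single y 1) x}

theorem single_lt {c : Config d} (hc : M.Stable c) (y x : Cell d) :
    (c + Pi.single y 1 : Config d) x < 2 * M.θ := by
  have h₁ := hc x
  have h₂ : (Pi.single y 1 : Config d) x ≤ 1 := by
    by_cases h : x = y <;> simp [h]
  rw [Pi.add_apply]
  omega

/-- A stable prediction problem can be decided in polynomial time if the candidates for the
cell on which the grain is added can be listed in polynomial time. -/
theorem inP_addition (hd : 0 < d) {R : ℕ → Config d → Cell d → Prop}
    {E : Cell d → List (Symbol (2 * M.θ))} {Y : ℕ → List (Cell d × ℕ) → List (Cell d)}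
    (hY : PolyTime fun p : ℕ × List (Cell d × ℕ) => Y p.1 p.2) (hE : PolyTime E)
    (hR : ∀ n l, 0 < n → (∀ x, x ∉ cube d 0 n → lookup l x = 0) →
      ∀ y, y ∈ Y n l ↔ R n (lookup l) y)
    (hcube : ∀ n c y, (∀ x, x ∉ cube d 0 n → c x = 0) → R n c y → y ∈ cube d 0 n) :
    InP (M.addition R E) := by
  obtain ⟨a, r, hb⟩ := exists_bounds hd M
  have hθ := two_le_θ M hd
  refine inP_of_polyTime (f := fun w => valid d w &&
    ((initial d w).all (fun p => decide (lookup (initial d w) p.1 + 1 ≤ M.θ)) &&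
    (Y (side w) (initial d w)).any fun y => M.predict a r (side w)
      ((y, lookup (initial d w) y + 1) :: initial d w) (rest w) (E y))) ?_ fun w => ?_
  · refine .and polyTime_valid (.and (.listAll polyTime_initial ?_) (.listAny ?_ ?_))
    · exact .decide_le (.natSucc (polyTime_lookup (polyTime_initial.comp .fst) (by fun_prop)))
        (.const _)
    · exact hY.comp (.prodMk polyTime_side polyTime_initial)
    · have hi : PolyTime fun p : List (Symbol (2 * M.θ)) × Cell d => initial d p.1 :=
        polyTime_initial.comp .fst
      exact polyTime_predict M a r (polyTime_side.comp .fst)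
        (.listCons (.prodMk .snd (.natSucc (polyTime_lookup hi .snd))) hi)
        (polyTime_rest.comp .fst) (hE.comp .snd)
  · have key := exists_code_iff (d := d) (q := 2 * M.θ) (Q := fun n c s => M.Stable c ∧
      ∃ y, R n c y ∧ ∃ x, M.EventuallyUnstable (c + Pi.single y 1) x ∧
        s = encodeCell (2 * M.θ) x ++ E y) (by
        rintro n c s ⟨_, y, _, x, _, rfl⟩
        exact head_encodeCell_append hd x _) w
    rw [Bool.and_eq_true, Bool.and_eq_true]
    refine Iff.trans (and_congr_right fun hv => ?_) (key.symm.trans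
      ⟨fun ⟨n, c, wc, s, hn, hc, hw, hst, y, hy, x, hx, hs⟩ =>
        ⟨n, c, x, y, wc, ⟨hn, hc⟩, hst, hy, by rw [hw, hs], hx⟩,
      fun ⟨n, c, x, y, wc, ⟨hn, hc⟩, hst, hy, hw, hx⟩ =>
        ⟨n, c, wc, _, hn, hc, hw, hst, y, hy, x, hx, rfl⟩⟩)
    obtain ⟨hn, wc, hwc, -⟩ := encodesConfig_of_valid hv
    set l := initial d w with hl
    have hstable : l.all (fun p => decide (lookup l p.1 + 1 ≤ M.θ)) = true ↔
        M.Stable (lookup l) := by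
      simp only [List.all_eq_true, decide_eq_true_eq]
      refine ⟨fun h x => ?_, fun h p _ => h p.1⟩
      by_cases hx : ∃ p ∈ l, p.1 = x
      · obtain ⟨p, hp, rfl⟩ := hx
        exact h p hp
      · rw [lookup_of_notMem fun p hp h => hx ⟨p, hp, h⟩]
        omega
    rw [hstable]
    refine and_congr_right fun hst => ?_
    rw [List.any_eq_true]
    refine exists_congr fun y => (and_congr_left' (hR _ l hn hwc.1 y)).trans
      (and_congr_right fun hy => ?_)
    have hadd : lookup ((y, lookup l y + 1) :: l) = lookup l + Pi.single y 1 := by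
      funext x
      by_cases h : x = y
      · subst h
        simp [lookup_cons]
      · simp [lookup_cons, h, Ne.symm h]
    have hyc := hcube _ _ y hwc.1 hy
    have hlt := single_lt hst y
    obtain ⟨h₁, h₂⟩ := hb (side w) _ (fun x hx => by
      have hxy : x ≠ y := fun h => hx (h ▸ hyc)
      simp [hwc.1 x hx, hxy]) hlt
    exact predict_iff hadd hlt (by omega) h₁ h₂ _ _

theorem inP_SPRED (hd : 0 < d) : InP M.SPRED := by
  have hθ := two_le_θ M hd
  have H := inP_addition (M := M) hd (R := fun n _ y => y ∈ cube d 0 n)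
    (E := encodeCell (2 * M.θ)) (Y := fun n _ => cells d 0 n)
    (polyTime_cells (.const _) .fst) polyTime_encodeCell (fun n l hn _ y => mem_cells hn)
    fun n c y _ h => h
  convert H using 1
  ext w
  refine ⟨fun ⟨n, c, x, y, wc, hc, hst, hw, hx⟩ => ⟨n, c, x, y, wc, hc, hst, ?_, hw, hx⟩,
    fun ⟨n, c, x, y, wc, hc, hst, _, hw, hx⟩ => ⟨n, c, x, y, wc, hc, hst, hw, hx⟩⟩
  -- a single grain on an empty cell leaves the configuration stable
  by_contra hy
  refine Stable.not_eventuallyUnstable (fun z => ?_) x hx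
  by_cases h : z = y
  · subst h
    simp [hc.2.1 z hy]
    omega
  · simpa [h] using hst z

/-- The lexicographically minimal elements of a list of cells. -/
noncomputable def lexMins (s : List (Cell d)) : List (Cell d) :=
  open Classical in s.filter fun y => s.all fun z => decide (toLex y ≤ toLex z)

theorem polyTime_lexMins : PolyTime (lexMins (d := d)) := by
  classical
  exact .listFilter .id (.listAll (l := fun p : List (Cell d) × Cell d => p.1) .fst
    (.decide_toLex_le (.comp .snd .fst) .snd))

theorem mem_lexMins {s : List (Cell d)} {y : Cell d} :
    y ∈ lexMins s ↔ IsLexMin {z | z ∈ s} y := by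
  simp [lexMins, IsLexMin]

theorem inP_FirstColSPRED (hd : 0 < d) : InP M.FirstColSPRED := by
  have H := inP_addition (M := M) hd (R := fun n _ y => IsLexMin (cube d 0 n) y)
    (E := fun _ => []) (Y := fun n _ => lexMins (cells d 0 n))
    (polyTime_lexMins.comp (polyTime_cells (.const _) .fst)) (.const _) (fun n l hn _ y => by
      rw [mem_lexMins]
      simp only [mem_cells hn, Set.ofPred_mem_eq])
    fun n c y _ h => h.1
  simpa only [addition, List.append_nil, FirstColSPRED] using H

theorem inP_FirstColSPREDNonempty (hd : 0 < d) : InP M.FirstColSPREDNonempty := by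
  have H := inP_addition (M := M) hd (R := fun _ c y => IsLexMin {z | c z ≠ 0} y)
    (E := fun _ => [])
    (Y := fun n l => lexMins ((cells d 0 n).filter fun z => decide (1 ≤ lookup l z)))
    (polyTime_lexMins.comp (.listFilter (polyTime_cells (.const _) .fst)
      (.decide_le (.const _) (polyTime_lookup (.comp .snd .fst) .snd))))
    (.const _) (fun n l hn hl y => by
      have h (z : Cell d) : z ∈ (cells d 0 n).filter (fun z => decide (1 ≤ lookup l z)) ↔
          lookup l z ≠ 0 := by
        rw [List.mem_filter, mem_cells hn, decide_eq_true_eq, Nat.one_le_iff_ne_zero]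
        exact and_iff_right_of_imp fun hz => by_contra fun h => hz (hl z h)
      rw [mem_lexMins]
      simp only [h])
    fun n c y hc h => by_contra fun hy => h.1 (hc y hy)
  simpa only [addition, List.append_nil, FirstColSPREDNonempty] using H

/-! ### Computing the stable configuration -/

theorem exists_solvesComputePRED (hd : 0 < d) :
    ∃ g, PolyTimeComputable g ∧ M.SolvesComputePRED g := by
  obtain ⟨a, r, hb⟩ := exists_bounds hd M
  have hθ := two_le_θ M hd
  let m (w : List (Symbol (2 * M.θ))) : ℕ := M.boxBound a r (side w)
  let cs (w : List (Symbol (2 * M.θ))) : List (Cell d) := cells d (-(m w : ℤ)) (2 * m w + 1)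
  let l (w : List (Symbol (2 * M.θ))) : List (Cell d × ℕ) :=
    M.simulate (cs w) (M.timeBound a r (side w)) (initial d w)
  have hm : PolyTime m := polyTime_boxBound M a r polyTime_side
  have hcs : PolyTime cs := by fun_prop
  have hl : PolyTime l :=
    polyTime_simulate M hcs (polyTime_timeBound M a r polyTime_side) polyTime_initial
  refine ⟨fun w => List.replicate (2 * m w + 1) (.bit true) ++ .sep ::
    (cs w).map fun x => grainSymbol (2 * M.θ) (lookup (l w) x),
    polyTimeComputable_of_polyTime (.listAppend 
      (PolyTime.listReplicate (a := fun _ => Symbol.bit true) (by fun_prop) (.const _))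
      (.listCons (.const _) (.listMap hcs (polyTime_grainSymbol
        (polyTime_lookup (hl.comp .fst) .snd))))), fun n c w ⟨hn, hc⟩ => ?_⟩
  have hlt := hc.lt (by omega)
  obtain ⟨h₁, h₂⟩ := hb n c hc.1 hlt
  refine ⟨_, M.boxBound a r n, h₂, ?_⟩
  obtain ⟨-, hside, hinit, -⟩ := hc.parse hn (s := []) (by simp)
  rw [List.append_nil] at hside hinit
  have hmem (t : ℕ) (x : Cell d) (hx : (M.step^[t] c) x ≠ 0) :
      x ∈ cube d (-(M.boxBound a r n : ℤ)) (2 * M.boxBound a r n + 1) := fun i => by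
    have := abs_le.1 (h₁ t x hx i)
    omega
  have hlook := lookup_simulate M hinit hlt (fun t x hx => (mem_cells (by omega)).2 (hmem t x hx))
    (M.timeBound a r n)
  refine encodesConfig_iff.2 ⟨fun x hx => by_contra fun h => hx (hmem _ x h),
    (cs w).map fun x => ⟨(M.step^[M.timeBound a r n] c) x, iterate_step_lt hlt _ x⟩, ?_, ?_⟩
  · simp [cs, m, cells, hside]
  · simp only [cs, m, l, hside, hlook, List.map_map]
    congr 2
    refine List.map_congr_left fun x _ => ?_
    simp [grainSymbol, iterate_step_lt hlt _ x]

end SandpileModel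

end Sandpile

theorem mainTheorem5 (d : ℕ) (hd : 0 < d) (M : Sandpile.SandpileModel d) :
    Sandpile.InP M.PRED ∧
    Sandpile.InP M.SPRED ∧
    (Sandpile.InP M.FirstColSPRED ∧ Sandpile.InP M.FirstColSPREDNonempty) ∧
    ∃ g, Sandpile.PolyTimeComputable g ∧ M.SolvesComputePRED g :=
  ⟨Sandpile.SandpileModel.inP_PRED hd, Sandpile.SandpileModel.inP_SPRED hd,
    ⟨Sandpile.SandpileModel.inP_FirstColSPRED hd,
      Sandpile.SandpileModel.inP_FirstColSPREDNonempty hd⟩,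
    Sandpile.SandpileModel.exists_solvesComputePRED hd⟩
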